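/- **Theorem (Prior concentration for sparse functions).** *Soft trees.* Fix a gating function $\psi:\mathbb R\to\mathbb R$ and let $p\ge 1$. A soft decision tree on $[0,1]^p$ is a finite binary tree whose branches $b$ carry a coordinate $j_b\in\{1,\dots,p\}$ and a cut point $C_b$, whose leaves $\ell$ carry coefficients $\mu_\ell\in\mathbb R$, and which has one bandwidth $\tau>0$. It defines $$g(x)=\sum_{\ell}\mu_\ell\,\phi(x;\ell),\qquad \phi(x;\ell)=\prod_{b\in A(\ell)}\psi\Big(\frac{x_{j_b}-C_b}{\tau}\Big)^{1-R_b}\Big(1-\psi\Big(\frac{x_{j_b}-C_b}{\tau}\Big)\Big)^{R_b},$$ where $A(\ell)$ is the set of ancestors of $\ell$ and $R_b=1$ if the path to $\ell$ goes right at $b$, $R_b=0$ otherwise. *Prior.* The prior $\Pi=\Pi_p$ is the law of $f=\sum_{t=1}^{T}g_t$, where $T\in\{0,1,2,\dots\}$ is random, $s=(s_1,\dots,s_p)$ has the Dirichlet distribution $\mathcal D(a/p^{\xi},\dots,a/p^{\xi})$ with $a>0$, $T$ and $s$ are independent, and, given $T$ and $s$, the trees are i.i.d. and generated as follows. The topology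 is that of a branching process that terminates almost surely, in which each node of depth $k$ is, independently, a branch with probability $q(k)\in[0,1]$ (the root has depth $0$). Given the topology, each branch $b$ independently selects the coordinate $j_b=j$ with probability $s_j$, and, given its coordinate and the ancestors' rules, $C_b$ is uniform on the side along coordinate $j_b$ of the cell of $[0,1]^p$ determined by the rules $x_j\le C$ (left) and $x_j>C$ (right) on the path to $b$. Independently of these, the leaf coefficients are i.i.d. with density $\pi_\mu$ on $\mathbb R$ and the bandwidth of the tree has density $\pi_\tau$ on $(0,\infty)$. The law of $T$, the numbers $q(k)$, $\pi_\tau$, $\pi_\mu$, $a$ and $\xi$ do not depend on $(n,p)$. *Assumption G.* $\psi$ is differentiable with $\sup_x|\psi'(x)|<\infty$, and $K=\psi(1-\psi)$ is integrable and satisfies: (1) $\int_{\mathbb R}K(x)\,dx>0$ and $\int_{\mathbb R}|x|^m|K(x)|\,dx<\infty$ for every positive integer $m$; (2) for some $\rho>0$, $K$ extends to a uniformly bounded analytic function on the strip $\{z\in\mathbb C:|\operatorname{Im}z|\le\rho\}$. *Assumption P* (for an integer $d\ge 0$). (P1) There are $C_1,C_2>0$ with $\Pi(T=t)\ge C_1e^{-C_2t}$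 for $t=0,1,2,\dots$. (P2) There are $a_1,a_2>0$ with $\pi_\tau(\tau)\ge a_1\tau^{a_2}$ for all sufficiently small $\tau>0$. (P3) $\xi>1$. (P4) There are $B_1,B_2>0$ with $\pi_\mu(\mu)\ge B_1e^{-B_2|\mu|}$ for all $\mu\in\mathbb R$. (P5) The depth $D_t$ of a tree satisfies $\Pi(D_t=k)>0$ for $k=0,1,\dots,2d$. *Hölder ball.* For $\alpha>0$ let $\beta$ be the largest integer strictly less than $\alpha$. $\mathcal C^{\alpha,R}([0,1]^p)$ is the set of functions $f$ that are $\beta$ times continuously differentiable on $[0,1]^p$ with $$\max_{|k|\le\beta}\sup_{x}|D^kf(x)|+\max_{|k|=\beta}\sup_{x\ne y}\frac{|D^kf(x)-D^kf(y)|}{\|x-y\|^{\alpha-\beta}}\le R ,$$ with suprema over $[0,1]^p$ and the Euclidean norm $\|\cdot\|$. *Claim.* Suppose that Assumptions G and P hold, and let $\alpha,R>0$. Then there are constants $A,C>0$ and $N$, independent of $(n,p)$, such that for all $n\ge N$, all $p\ge1$, every $f_0\in\mathcal C^{\alpha,R}([0,1]^p)$ that depends on at most $d$ covariates, and every $t\ge\alpha(d+1)/(2\alpha+d)$,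 $$\Pi\Big[\sup_{x\in[0,1]^p}|f(x)-f_0(x)|\le A\,\varepsilon_n\Big]\ge\exp(-C\,n\,\varepsilon_n^2),\qquad \varepsilon_n=n^{-\alpha/(2\alpha+d)}(\log n)^t+\sqrt{\frac{d\log p}{n}} .$$ -/

import Mathlib

open MeasureTheory ProbabilityTheory

noncomputable section

namespace SoftBART

/-! ### Soft decision trees -/

/-- Nodes of the infinite binary tree, coded by the path from the root with the *latest* step first:
`[]` is the root, `false :: u` the left child of `u` and `true :: u` its right child. The depth of
a node is the length of its path. -/
abbrev Node := List Bool

/-- `B u = true` means that `u` is a branch if it is reached. A node belongs to the tree when all its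
proper ancestors are branches. -/
def IsNode (B : Node → Bool) : Node → Prop
  | [] => True
  | _ :: u => IsNode B u ∧ B u = true

/-- The leaves: nodes of the tree that are not branches. -/
def IsLeaf (B : Node → Bool) (v : Node) : Prop := IsNode B v ∧ B v = false

/-- The depth of the tree, the largest depth of one of its nodes (infinite if it never ends). -/
def treeDepth (B : Node → Bool) : ℕ∞ := ⨆ v : {v : Node // IsNode B v}, (v.1.length : ℕ∞)

/-- The `j`-th side `[(cell v j).1, (cell v j).2]` of the cell of `[0,1]^p` that the path to `v`
defines by the rules `x_j ≤ C_b` (left) and `x_j > C_b` (right). Here `J u` is the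
coordinate that `u` splits and `V u` the relative position of its cut point in the side of its cell.
-/
def cell {p : ℕ} (J : Node → Fin p) (V : Node → unitInterval) : Node → Fin p → ℝ × ℝ
  | [] => fun _ => (0, 1)
  | b :: u =>
    let I := cell J V u (J u)
    let c := I.1 + (V u : ℝ) * (I.2 - I.1)
    Function.update (cell J V u) (J u) (if b then (c, I.2) else (I.1, c))

/-- The cut point `C_u`. It is uniform on the side of the cell of `u` along the coordinate
`J u` when `V u` is uniform on `[0,1]`. -/
def cutPoint {p : ℕ} (J : Node → Fin p) (V : Node → unitInterval) (u : Node) : ℝ :=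
  (cell J V u (J u)).1 + (V u : ℝ) * ((cell J V u (J u)).2 - (cell J V u (J u)).1)

/-- The weight `φ(x; v)`: the product over the ancestors `u` of `v` of `ψ((x_j - C_u)/τ)` when
the path to `v` goes left at `u`, and of `1 - ψ((x_j - C_u)/τ)` when it goes right. -/
def weight {p : ℕ} (ψ : ℝ → ℝ) (J : Node → Fin p) (V : Node → unitInterval) (τ : ℝ)
    (x : EuclideanSpace ℝ (Fin p)) : Node → ℝ
  | [] => 1
  | b :: u =>
    let g := ψ ((x (J u) - cutPoint J V u) / τ)
    weight ψ J V τ x u * (if b then 1 - g else g)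

/-- The soft decision tree `g(x) = ∑ μ_ℓ φ(x; ℓ)`, summed over the leaves `ℓ`. -/
def softTree {p : ℕ} (ψ : ℝ → ℝ) (B : Node → Bool) (J : Node → Fin p) (V : Node → unitInterval)
    (μ : Node → ℝ) (τ : ℝ) (x : EuclideanSpace ℝ (Fin p)) : ℝ :=
  ∑ᶠ v ∈ {v : Node | IsLeaf B v}, μ v * weight ψ J V τ x v

/-! ### The prior -/

/-- The free ingredients of the prior. -/
structure PriorSpec where
  /-- the law of the number of trees -/
  numTrees : PMF ℕ
  /-- a node of depth `k` is a branch with probability `splitProb k` -/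
  splitProb : ℕ → unitInterval
  /-- the density of the bandwidth of a tree -/
  bandwidthPDF : ℝ → ℝ
  bandwidthPDF_measurable : Measurable bandwidthPDF
  bandwidthPDF_nonneg : ∀ τ, 0 ≤ bandwidthPDF τ
  bandwidthPDF_eq_zero : ∀ τ ≤ 0, bandwidthPDF τ = 0
  bandwidthPDF_lintegral : ∫⁻ τ, ENNReal.ofReal (bandwidthPDF τ) = 1
  /-- the density of a leaf coefficient -/
  leafPDF : ℝ → ℝ
  leafPDF_measurable : Measurable leafPDF
  leafPDF_nonneg : ∀ m, 0 ≤ leafPDF m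
  leafPDF_lintegral : ∫⁻ m, ENNReal.ofReal (leafPDF m) = 1
  /-- the splitting proportions are Dirichlet with all parameters `a / p ^ ξ` -/
  a : ℝ
  a_pos : 0 < a
  ξ : ℝ

/-- The Dirichlet distribution, as the law of normalized independent Gamma variables. -/
def dirichlet {p : ℕ} (c : Fin p → ℝ) : Measure (Fin p → ℝ) :=
  (Measure.pi fun j => gammaMeasure (c j) 1).map fun g j => g j / ∑ i, g i

/-- The coordinate selected by `w`: the first `j` with `w ≤ s_0 + ⋯ + s_j`. For a probability vector
`s` and `w` uniform on `[0,1]`, it is `j` with probability `s_j`. -/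
def selectCoord {p : ℕ} [NeZero p] (s : Fin p → ℝ) (w : unitInterval) : Fin p :=
  open Classical in
  if h : (Finset.univ.filter fun j : Fin p => (w : ℝ) ≤ ∑ i ∈ Finset.Iic j, s i).Nonempty
  then (Finset.univ.filter fun j : Fin p => (w : ℝ) ≤ ∑ i ∈ Finset.Iic j, s i).min' h
  else 0

/-- The random ingredients of one tree: the bandwidth `τ`, and for all nodes the branch indicators
`B`, the variables `W` that select the coordinates, the relative positions `V` of the cut points,
and the leaf coefficients `μ`. -/
abbrev TreeDraw :=
  ℝ × (Node → Bool) × (Node → unitInterval) × (Node → unitInterval) × (Node → ℝ)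

/-- A draw from the prior in dimension `p`: the number of trees, the splitting proportions, and
the trees. -/
abbrev Draw (p : ℕ) := ℕ × (Fin p → ℝ) × (ℕ → TreeDraw)

/-- The function `f = ∑_{t < T} g_t` belonging to a draw. -/
def Draw.toFun {p : ℕ} [NeZero p] (ψ : ℝ → ℝ) (ω : Draw p) (x : EuclideanSpace ℝ (Fin p)) : ℝ :=
  ∑ t ∈ Finset.range ω.1,
    softTree ψ (ω.2.2 t).2.1 (fun u => selectCoord ω.2.1 ((ω.2.2 t).2.2.1 u)) (ω.2.2 t).2.2.2.1
      (ω.2.2 t).2.2.2.2 (ω.2.2 t).1 x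

namespace PriorSpec

variable (P : PriorSpec)

def bandwidthLaw : Measure ℝ := volume.withDensity fun τ => ENNReal.ofReal (P.bandwidthPDF τ)

def leafLaw : Measure ℝ := volume.withDensity fun m => ENNReal.ofReal (P.leafPDF m)

/-- The law of the branching process: the branch indicators are independent, that of a node of
depth `k` being `true` with probability `splitProb k`. -/
def branchLaw : Measure (Node → Bool) :=
  Measure.infinitePi fun v : Node => bernoulliMeasure true false (P.splitProb v.length)

/-- The law of the ingredients of one tree, which are all independent. -/
def treeLaw : Measure TreeDraw :=
  P.bandwidthLaw.prod <| P.branchLaw.prod <|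
    (Measure.infinitePi fun _ : Node => (volume : Measure unitInterval)).prod <|
    (Measure.infinitePi fun _ : Node => (volume : Measure unitInterval)).prod <|
    Measure.infinitePi fun _ : Node => P.leafLaw

/-- The prior in dimension `p`. The number of trees, the splitting proportions and the ingredients of
the trees are independent, and the latter are identically distributed. -/
def prior (p : ℕ) : Measure (Draw p) :=
  P.numTrees.toMeasure.prod <|
    (dirichlet fun _ : Fin p => P.a / (p : ℝ) ^ P.ξ).prod <|
    Measure.infinitePi fun _ : ℕ => P.treeLaw

instance : IsProbabilityMeasure P.bandwidthLaw :=
  ⟨by simp [bandwidthLaw, P.bandwidthPDF_lintegral]⟩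

instance : IsProbabilityMeasure P.leafLaw := ⟨by simp [leafLaw, P.leafPDF_lintegral]⟩

instance : IsProbabilityMeasure P.branchLaw := by unfold branchLaw; infer_instance

instance : IsProbabilityMeasure P.treeLaw := by unfold treeLaw; infer_instance

instance (p : ℕ) [NeZero p] : IsProbabilityMeasure (P.prior p) := by
  have hp : (0 : ℝ) < p := by exact_mod_cast Nat.pos_of_ne_zero (NeZero.ne p)
  have h1 (j : Fin p) : IsProbabilityMeasure (gammaMeasure (P.a / (p : ℝ) ^ P.ξ) 1) :=
    isProbabilityMeasure_gammaMeasure (div_pos P.a_pos (Real.rpow_pos_of_pos hp _)) one_pos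
  have h2 : IsProbabilityMeasure (dirichlet fun _ : Fin p => P.a / (p : ℝ) ^ P.ξ) :=
    have h3 : IsProbabilityMeasure
        (Measure.pi fun _ : Fin p => gammaMeasure (P.a / (p : ℝ) ^ P.ξ) 1) :=
      @Measure.pi.instIsProbabilityMeasure _ _ _ _ _ h1
    Measure.isProbabilityMeasure_map (by fun_prop)
  unfold prior
  infer_instance

end PriorSpec

/-! ### Assumptions and function classes -/

/-- The assumption on the gating function, with the effective kernel `K = ψ (1 - ψ)`. -/
structure AssumptionG (ψ : ℝ → ℝ) : Prop where
  differentiable : Differentiable ℝ ψ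
  deriv_bounded : ∃ L : ℝ, ∀ x, |deriv ψ x| ≤ L
  integrable : Integrable fun x => ψ x * (1 - ψ x)
  integral_pos : 0 < ∫ x, ψ x * (1 - ψ x)
  moments : ∀ m : ℕ, 0 < m → Integrable fun x => |x| ^ m * |ψ x * (1 - ψ x)|
  analytic : ∃ ρ > 0, ∃ F : ℂ → ℂ, AnalyticOnNhd ℂ F {z | |z.im| ≤ ρ} ∧
    (∃ M : ℝ, ∀ z : ℂ, |z.im| ≤ ρ → ‖F z‖ ≤ M) ∧
    ∀ x : ℝ, F (x : ℂ) = ((ψ x * (1 - ψ x) : ℝ) : ℂ)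

/-- The assumption on the prior, for the sparsity level `d`. -/
structure AssumptionP (P : PriorSpec) (d : ℕ) : Prop where
  numTrees : ∃ C₁ > 0, ∃ C₂ > 0, ∀ t : ℕ,
    C₁ * Real.exp (-C₂ * t) ≤ (P.numTrees t).toReal
  bandwidth : ∃ a₁ > 0, ∃ a₂ > 0, ∃ τ₀ > 0, ∀ τ : ℝ, 0 < τ → τ < τ₀ →
    a₁ * τ ^ a₂ ≤ P.bandwidthPDF τ
  dirichlet : 1 < P.ξ
  leaf : ∃ B₁ > 0, ∃ B₂ > 0, ∀ m : ℝ, B₁ * Real.exp (-B₂ * |m|) ≤ P.leafPDF m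
  depth : ∀ k : ℕ, k ≤ 2 * d → 0 < P.branchLaw {B | treeDepth B = k}

/-- The unit cube `[0,1]^p`. -/
def cube (p : ℕ) : Set (EuclideanSpace ℝ (Fin p)) := {x | ∀ j, 0 ≤ x j ∧ x j ≤ 1}

/-- The partial derivative of `f` on the unit cube along the coordinates `i 0, …, i (m - 1)`. -/
def partialDeriv {p : ℕ} (f : EuclideanSpace ℝ (Fin p) → ℝ) {m : ℕ} (i : Fin m → Fin p)
    (x : EuclideanSpace ℝ (Fin p)) : ℝ :=
  iteratedFDerivWithin ℝ m f (cube p) x fun r => EuclideanSpace.single (i r) 1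

/-- The Hölder ball `C^{α,R}([0,1]^p)`, where `⌈α⌉₊ - 1` is the largest integer strictly less than
`α`. The norm is the maximum of the sup norms of the partial derivatives up to that order,
plus the maximum of the Hölder seminorms of those of that order. -/
def HolderBall (p : ℕ) (α R : ℝ) : Set (EuclideanSpace ℝ (Fin p) → ℝ) :=
  {f | ContDiffOn ℝ (⌈α⌉₊ - 1 : ℕ) f (cube p) ∧ ∃ M L : ℝ, 0 ≤ M ∧ 0 ≤ L ∧ M + L ≤ R ∧
    (∀ m ≤ ⌈α⌉₊ - 1, ∀ i : Fin m → Fin p, ∀ x ∈ cube p, |partialDeriv f i x| ≤ M) ∧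
    ∀ i : Fin (⌈α⌉₊ - 1) → Fin p, ∀ x ∈ cube p, ∀ y ∈ cube p,
      |partialDeriv f i x - partialDeriv f i y| ≤ L * ‖x - y‖ ^ (α - (⌈α⌉₊ - 1 : ℕ))}

/-- On the unit cube, `f` depends on at most `d` covariates. -/
def DependsOnAtMost {p : ℕ} (d : ℕ) (f : EuclideanSpace ℝ (Fin p) → ℝ) : Prop :=
  ∃ S : Finset (Fin p), S.card ≤ d ∧
    ∀ x ∈ cube p, ∀ y ∈ cube p, (∀ j ∈ S, x j = y j) → f x = f y

/-- The rate `ε_n = n^{-α/(2α+d)} (log n)^t + √(d log p / n)`. -/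
def rate (α : ℝ) (d : ℕ) (t : ℝ) (n p : ℕ) : ℝ :=
  (n : ℝ) ^ (-α / (2 * α + d)) * Real.log n ^ t + √(d * Real.log p / n)

end SoftBART

end

/-! A single soft tree can imitate a product kernel. With `K = ψ (1 - ψ)`, take a full tree of depth
`2 * d₀` that cuts each of the `d₀` relevant coordinates twice. The path that goes left and then
right at two nearly equal cuts carries the weight `∏ K ((x_j - c_j) / τ)`, and the other leaves get
coefficients close to `0`. The parameters need accuracy `δ`, a power of `1 / n`, so the prior
charges each tree about `log n` plus the size of its coefficient on the logarithmic scale. Choosing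
the relevant coordinates costs `d log p`, since `ξ > 1` makes the irrelevant Gamma variables almost
free. This is `exists_le_prior`. It remains to approximate `f₀` to order `h ^ α` by about `(log n /
h) ^ d` product kernels with coefficients of the same total size and centres in the cube. The
balance `n h ^ (2α) = (log n) ^ (d + 1) h ^ (-d)` then gives the rate.

The approximation result is `exists_isKernelApprox`. It has to cope with three obstacles.

(1) `K` has a nonzero integral but its higher moments need not vanish. A smooth function of scale
`s` supported in `[0,1]` is nevertheless a convolution with `K (· / τ)` up to `(τ / s) ^ N`, by
inverting the moment expansion (`exists_smear_approx`).

(2) Centres outside the cube are unavailable. Near an endpoint the jet of the function is matched by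
translates of `K` with centres in `[0,1]`. Such translates have all jets because `K` is analytic and
solves no linear equation with constant coefficients (`span_jet_eq_top`). The difference extends by
zero but only has the smaller scale `τ`, so it must be treated at a still finer bandwidth. In a
product each pass turns at least one more coordinate into the harmless kind, and `d + 1` bandwidths
suffice (`exists_multilevel`).

(3) The number of kernels must be controlled. Since `K` is analytic in a strip, every translate is a
combination of the translates on one grid of `N / τ` points, up to about `2 ^ (-N)` (`exists_grid`).
With `N` of order `log n` the count depends on the grid alone.

A Hölder function is cut into smooth pieces by telescoping quasi-interpolants over dyadic scales
(`isShapeSum_sub`). Coarse levels get bandwidths well below their own scale, yet large enough for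
the numbers of kernels to form a geometric series. -/

namespace SoftBART

/-! ### Chains of derivatives and Taylor's formula -/

/-- `u 0, …, u N` are the successive derivatives of `u 0`. -/
def IsDerivChain (N : ℕ) (u : ℕ → ℝ → ℝ) : Prop :=
  ∀ m < N, ∀ x, HasDerivAt (u m) (u (m + 1) x) x

lemma IsDerivChain.shift {N : ℕ} {u : ℕ → ℝ → ℝ} (hu : IsDerivChain N u) (k : ℕ) :
    IsDerivChain (N - k) fun m => u (m + k) := by
  intro m hm x
  have := hu (m + k) (by omega) x
  rwa [show m + k + 1 = m + 1 + k by ring] at this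

lemma IsDerivChain.continuous {N : ℕ} {u : ℕ → ℝ → ℝ} (hu : IsDerivChain N u) {m : ℕ}
    (hm : m < N) : Continuous (u m) :=
  continuous_iff_continuousAt.2 fun x => (hu m hm x).continuousAt

lemma isDerivChain_iteratedDeriv {f : ℝ → ℝ} {N : ℕ} (hf : ContDiff ℝ N f) :
    IsDerivChain N fun m => iteratedDeriv m f := by
  intro m hm x
  have h : DifferentiableAt ℝ (iteratedDeriv m f) x :=
    (hf.differentiable_iteratedDeriv m (by exact_mod_cast hm)) x
  have := h.hasDerivAt
  rwa [← iteratedDeriv_succ] at this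

lemma hasDerivAt_taylorSum (a : ℕ → ℝ) (x y : ℝ) (N : ℕ) :
    HasDerivAt (fun y => ∑ m ∈ Finset.range (N + 1), a m * (y - x) ^ m / (m.factorial : ℝ))
      (∑ m ∈ Finset.range N, a (m + 1) * (y - x) ^ m / (m.factorial : ℝ)) y := by
  simp_rw [Finset.sum_range_succ' _ N]
  simp only [pow_zero, Nat.factorial_zero, Nat.cast_one, div_one, mul_one]
  refine HasDerivAt.add_const _ ?_
  refine HasDerivAt.fun_sum fun m _ => ?_
  have h1 : HasDerivAt (fun y => (y - x) ^ (m + 1)) (((m + 1 : ℕ) : ℝ) * (y - x) ^ m * 1) y := by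
    exact ((hasDerivAt_id' y).sub_const x).fun_pow (m + 1)
  have h2 := (h1.const_mul (a (m + 1))).div_const ((m + 1).factorial : ℝ)
  refine h2.congr_deriv ?_
  rw [Nat.factorial_succ]
  push_cast
  have : (m.factorial : ℝ) ≠ 0 := by positivity
  have : (m : ℝ) + 1 ≠ 0 := by positivity
  field_simp

/-- The top coefficient is a free constant `c`, so one statement serves smooth functions (`c = 0`)
and functions whose last derivative is only Hölder (`c = u N x`). The derivative of the remainder is
the remainder of the shifted chain, and the mean value inequality is applied on the part of `s`
within `|y - x|` of `x`. -/
lemma abs_sub_taylor_le {s : Set ℝ} (hs : Convex ℝ s) (N : ℕ) : ∀ {u : ℕ → ℝ → ℝ} {x y B c : ℝ},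
    (∀ m < N, ∀ y ∈ s, HasDerivWithinAt (u m) (u (m + 1) y) s y) → x ∈ s →
    (∀ y ∈ s, |u N y - c| ≤ B) → y ∈ s →
    |u 0 y - ∑ m ∈ Finset.range N, u m x * (y - x) ^ m / (m.factorial : ℝ)
      - c * (y - x) ^ N / (N.factorial : ℝ)| ≤ B * |y - x| ^ N := by
  induction N with
  | zero => intro u x y B c _ _ hB hy; simpa using hB y hy
  | succ N ih =>
    intro u x y B c hu hx hB hy
    have hB0 : 0 ≤ B := (abs_nonneg _).trans (hB x hx)
    -- The Taylor coefficients at `x`, with the top one replaced by `c`.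
    set a : ℕ → ℝ := fun m => if m = N + 1 then c else u m x with ha
    have hsum (z : ℝ) : ∑ m ∈ Finset.range (N + 2), a m * (z - x) ^ m / (m.factorial : ℝ)
        = ∑ m ∈ Finset.range (N + 1), u m x * (z - x) ^ m / (m.factorial : ℝ)
          + c * (z - x) ^ (N + 1) / ((N + 1).factorial : ℝ) := by
      rw [Finset.sum_range_succ]
      congr 1
      · refine Finset.sum_congr rfl fun m hm => ?_
        have : m ≠ N + 1 := by have := Finset.mem_range.1 hm; omega
        simp [ha, this]
      · simp [ha]
    set φ : ℝ → ℝ := fun z => u 0 z - ∑ m ∈ Finset.range (N + 2), a m * (z - x) ^ m /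
      (m.factorial : ℝ) with hφ
    have hderiv : ∀ z ∈ s ∩ Metric.closedBall x |y - x|, HasDerivWithinAt φ
        (u 1 z - ∑ m ∈ Finset.range (N + 1), a (m + 1) * (z - x) ^ m / (m.factorial : ℝ))
        (s ∩ Metric.closedBall x |y - x|) z := fun z hz =>
      ((hu 0 (by omega) z hz.1).sub
        (hasDerivAt_taylorSum a x z (N + 1)).hasDerivWithinAt).mono Set.inter_subset_left
    have hbound : ∀ z ∈ s ∩ Metric.closedBall x |y - x|,
        ‖u 1 z - ∑ m ∈ Finset.range (N + 1), a (m + 1) * (z - x) ^ m / (m.factorial : ℝ)‖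
          ≤ B * |y - x| ^ N := by
      intro z hz
      have h1 := ih (u := fun m => u (m + 1)) (x := x) (y := z) (B := B) (c := c)
        (fun m hm => hu (m + 1) (by omega)) hx hB hz.1
      have h2 : |z - x| ≤ |y - x| := by simpa [Real.dist_eq] using hz.2
      rw [Real.norm_eq_abs, Finset.sum_range_succ]
      have h3 : ∑ m ∈ Finset.range N, a (m + 1) * (z - x) ^ m / (m.factorial : ℝ)
          = ∑ m ∈ Finset.range N, u (m + 1) x * (z - x) ^ m / (m.factorial : ℝ) := by
        refine Finset.sum_congr rfl fun m hm => ?_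
        have : m ≠ N := (Finset.mem_range.1 hm).ne
        simp [ha, this]
      have h4 : a (N + 1) = c := by simp [ha]
      rw [h3, h4, ← sub_sub]
      exact h1.trans (by gcongr)
    have hxm : x ∈ s ∩ Metric.closedBall x |y - x| := ⟨hx, by simp⟩
    have hym : y ∈ s ∩ Metric.closedBall x |y - x| := ⟨hy, by simp [Real.dist_eq]⟩
    have hconv : Convex ℝ (s ∩ Metric.closedBall x |y - x|) := hs.inter (convex_closedBall _ _)
    have key := hconv.norm_image_sub_le_of_norm_hasDerivWithin_le hderiv hbound hxm hym
    have hφx : φ x = 0 := by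
      simp only [hφ, sub_self]
      rw [Finset.sum_range_succ']
      simp [ha]
    rw [hφx, sub_zero, Real.norm_eq_abs, Real.norm_eq_abs] at key
    rw [sub_sub, ← hsum y]
    calc _ ≤ _ := key
      _ = _ := by ring

/-! ### Localizing weights -/

/-- The weight `1 / (1 + ((x - x₀) / s)²)`. -/
noncomputable def peak (x₀ s x : ℝ) : ℝ := (1 + ((x - x₀) / s) ^ 2)⁻¹

lemma peak_pos (x₀ s x : ℝ) : 0 < peak x₀ s x := by unfold peak; positivity

lemma peak_nonneg (x₀ s x : ℝ) : 0 ≤ peak x₀ s x := (peak_pos x₀ s x).le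

lemma peak_le_one (x₀ s x : ℝ) : peak x₀ s x ≤ 1 := by
  unfold peak
  exact inv_le_one_of_one_le₀ (by nlinarith [sq_nonneg ((x - x₀) / s)])

/-- Peetre's inequality. -/
lemma peak_le (x₀ s x y : ℝ) :
    peak x₀ s y ≤ 2 * (1 + ((y - x) / s) ^ 2) * peak x₀ s x := by
  unfold peak
  rw [← div_eq_mul_inv, le_div_iff₀ (by positivity), inv_mul_le_iff₀ (by positivity)]
  have h : (x - x₀) / s = (y - x₀) / s - (y - x) / s := by ring
  rw [h]
  set a := (y - x₀) / s
  set b := (y - x) / s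
  nlinarith [sq_nonneg (a + b), mul_nonneg (sq_nonneg a) (sq_nonneg b), sq_nonneg a, sq_nonneg b]

/-- A shift by `τ z` costs a factor polynomial in `z`, which the moments of the kernel absorb. Hence
convolutions and Taylor remainders stay localized, and errors of the many pieces of one dyadic level
can later be summed without loss. -/
lemma peak_le_of_abs_le {x₀ s τ x y z : ℝ} (hτ : 0 < τ) (hs : τ ≤ s) (h : |y - x| ≤ τ * |z|) :
    peak x₀ s y ≤ 2 * (1 + z ^ 2) * peak x₀ s x := by
  refine (peak_le x₀ s x y).trans ?_
  have hs0 : 0 < s := hτ.trans_le hs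
  have h1 : ((y - x) / s) ^ 2 ≤ z ^ 2 := by
    rw [sq_le_sq, abs_div, abs_of_pos hs0, div_le_iff₀ hs0]
    calc |y - x| ≤ τ * |z| := h
      _ ≤ |z| * s := by rw [mul_comm]; gcongr
  have := peak_nonneg x₀ s x
  gcongr

lemma integral_peak (x₀ : ℝ) {s : ℝ} (hs : 0 < s) :
    Integrable (peak x₀ s) ∧ ∫ x, peak x₀ s x = s * Real.pi := by
  have h0 : Integrable fun x : ℝ => (1 + (x / s) ^ 2)⁻¹ :=
    integrable_inv_one_add_sq.comp_div hs.ne'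
  constructor
  · exact h0.comp_sub_right x₀
  · unfold peak
    rw [integral_sub_right_eq_self (fun x : ℝ => (1 + (x / s) ^ 2)⁻¹) x₀,
      Measure.integral_comp_div (fun x : ℝ => (1 + x ^ 2)⁻¹) s, integral_univ_inv_one_add_sq,
      abs_of_pos hs, smul_eq_mul]

/-! ### Kernels -/

/-- Analytic kernels with positive integral all of whose derivatives decay rapidly. -/
structure IsKernel (K : ℝ → ℝ) : Prop where
  analytic : AnalyticOnNhd ℝ K Set.univ
  decay : ∀ m p : ℕ, ∃ C > 0, ∀ x, |iteratedDeriv m K x| * (1 + x ^ 2) ^ p ≤ C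
  integral_pos : 0 < ∫ x, K x

namespace IsKernel

variable {K : ℝ → ℝ}

lemma contDiff (hK : IsKernel K) {n : WithTop ℕ∞} : ContDiff ℝ n K := hK.analytic.contDiff

lemma continuous (hK : IsKernel K) : Continuous K := (hK.contDiff (n := 0)).continuous

lemma integrable_moment (hK : IsKernel K) (m : ℕ) : Integrable fun z => |z| ^ m * |K z| := by
  obtain ⟨C, hC, h⟩ := hK.decay 0 (m + 1)
  refine (integrable_inv_one_add_sq.const_mul C).mono'
    (by have := hK.continuous; exact Continuous.aestronglyMeasurable (by fun_prop))
    (.of_forall fun z => ?_)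
  have h1 := h z
  simp only [iteratedDeriv_zero] at h1
  rw [Real.norm_eq_abs, abs_of_nonneg (by positivity), ← div_eq_mul_inv,
    le_div_iff₀ (by positivity)]
  have h2 : |z| ≤ 1 + z ^ 2 := by
    nlinarith [abs_nonneg z, sq_abs z, sq_nonneg (|z| - 1)]
  calc |z| ^ m * |K z| * (1 + z ^ 2) ≤ (1 + z ^ 2) ^ m * |K z| * (1 + z ^ 2) := by gcongr
    _ = |K z| * (1 + z ^ 2) ^ (m + 1) := by ring
    _ ≤ C := h1

lemma integrable_pow_mul (hK : IsKernel K) (m : ℕ) : Integrable fun z => z ^ m * K z := by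
  refine (hK.integrable_moment m).mono'
    (by have := hK.continuous; exact Continuous.aestronglyMeasurable (by fun_prop))
    (.of_forall fun z => ?_)
  simp

end IsKernel

lemma integral_comp_affine (h : ℝ → ℝ) (x : ℝ) {τ : ℝ} (hτ : 0 < τ) :
    τ⁻¹ * ∫ c, h ((x - c) / τ) = ∫ z, h z := by
  rw [integral_sub_left_eq_self (fun c => h (c / τ)) volume x, Measure.integral_comp_div h τ,
    abs_of_pos hτ, smul_eq_mul, inv_mul_cancel_left₀ hτ.ne']

lemma integrable_of_eq_zero_off_Icc {g : ℝ → ℝ} (hg : Continuous g)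
    (h0 : ∀ x ∉ Set.Icc (0 : ℝ) 1, g x = 0) : Integrable g :=
  hg.integrable_of_hasCompactSupport (HasCompactSupport.intro isCompact_Icc h0)

/-! ### Deconvolution of functions supported in the unit interval -/

/-- The convolution of `g` with the rescaled kernel. -/
noncomputable def smear (K : ℝ → ℝ) (τ : ℝ) (g : ℝ → ℝ) (x : ℝ) : ℝ :=
  τ⁻¹ * ∫ c, K ((x - c) / τ) * g c

lemma smear_eq (K : ℝ → ℝ) {τ : ℝ} (hτ : 0 < τ) (g : ℝ → ℝ) (x : ℝ) :
    smear K τ g x = ∫ z, K z * g (x - τ * z) := by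
  rw [← integral_comp_affine _ x hτ]
  unfold smear
  congr 2 with c
  rw [mul_div_cancel₀ _ hτ.ne', sub_sub_cancel]

lemma integrable_kernel_mul {K : ℝ → ℝ} (hK : Continuous K) (τ x : ℝ) {g : ℝ → ℝ}
    (hg : Continuous g) (h0 : ∀ x ∉ Set.Icc (0 : ℝ) 1, g x = 0) :
    Integrable fun c => K ((x - c) / τ) * g c :=
  integrable_of_eq_zero_off_Icc (by fun_prop) fun c hc => by simp [h0 c hc]

/-- A chain of derivatives whose growth is controlled at scale `s` and localized by a weight. -/
structure Controlled (N : ℕ) (s B : ℝ) (w : ℝ → ℝ) (u : ℕ → ℝ → ℝ) : Prop where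
  chain : IsDerivChain N u
  bound : ∀ m ≤ N, ∀ x, |u m x| * s ^ m ≤ B * w x

/-- All functions of the chain vanish outside the unit interval. -/
def VanishesOff (N : ℕ) (u : ℕ → ℝ → ℝ) : Prop := ∀ m ≤ N, ∀ x ∉ Set.Icc (0 : ℝ) 1, u m x = 0

lemma Controlled.shift {N : ℕ} {s B : ℝ} {w : ℝ → ℝ} {u : ℕ → ℝ → ℝ} (hs : 0 < s)
    (hu : Controlled N s B w u) {k : ℕ} (hk : k ≤ N) :
    Controlled (N - k) s (B / s ^ k) w fun m => u (m + k) where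
  chain := hu.chain.shift k
  bound m hm x := by
    have := hu.bound (m + k) (by omega) x
    rw [div_mul_eq_mul_div, le_div_iff₀ (by positivity)]
    calc _ = |u (m + k) x| * s ^ (m + k) := by ring
      _ ≤ _ := this

/-- Taylor's formula under the integral sign. -/
lemma abs_smear_sub_taylor_le {K : ℝ → ℝ} (hK : IsKernel K) (N : ℕ) {u : ℕ → ℝ → ℝ}
    {B s τ s₀ x₀ : ℝ} (hN : 0 < N) (hτ : 0 < τ) (hτs : τ ≤ s) (hτs₀ : τ ≤ s₀)
    (hu : Controlled N s B (peak x₀ s₀) u) (h0 : VanishesOff N u) (x : ℝ) :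
    |smear K τ (u 0) x - ∑ m ∈ Finset.range N,
        (∫ z, z ^ m * K z) * (-τ) ^ m / (m.factorial : ℝ) * u m x|
      ≤ (∫ z, 2 * (|z| ^ N * |K z| + |z| ^ (N + 2) * |K z|)) *
        (B * (τ / s) ^ N * peak x₀ s₀ x) := by
  have hs : 0 < s := hτ.trans_le hτs
  have hB : 0 ≤ B := by
    have h1 := hu.bound 0 (Nat.zero_le _) x₀
    have h2 := peak_pos x₀ s₀ x₀
    have h3 : 0 ≤ B * peak x₀ s₀ x₀ := le_trans (by positivity) h1
    exact nonneg_of_mul_nonneg_left h3 h2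
  have hc0 : Continuous (u 0) := hu.chain.continuous hN
  have hint1 : Integrable fun z => K z * u 0 (x - τ * z) := by
    have h1 := integrable_kernel_mul hK.continuous τ x hc0 (h0 0 (Nat.zero_le _))
    have h2 := (h1.comp_sub_left x).comp_mul_left' (R := τ) hτ.ne'
    refine h2.congr (.of_forall fun z => ?_)
    simp only
    rw [sub_sub_cancel, mul_div_cancel_left₀ _ hτ.ne']
  have hint2 (m : ℕ) : Integrable fun z => z ^ m * K z * (-τ) ^ m / (m.factorial : ℝ) * u m x :=
    (((hK.integrable_pow_mul m).mul_const _).div_const _).mul_const _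
  rw [smear_eq K hτ]
  have e1 : ∑ m ∈ Finset.range N, (∫ z, z ^ m * K z) * (-τ) ^ m / (m.factorial : ℝ) * u m x
      = ∫ z, ∑ m ∈ Finset.range N, z ^ m * K z * (-τ) ^ m / (m.factorial : ℝ) * u m x := by
    rw [integral_finsetSum _ fun m _ => hint2 m]
    refine Finset.sum_congr rfl fun m _ => ?_
    rw [integral_mul_const, integral_div, integral_mul_const]
  rw [e1, ← integral_sub hint1 (integrable_finsetSum _ fun m _ => hint2 m), ← integral_mul_const,
    ← Real.norm_eq_abs]
  refine norm_integral_le_of_norm_le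
    ((((hK.integrable_moment N).add (hK.integrable_moment (N + 2))).const_mul 2).mul_const _)
    (.of_forall fun z => ?_)
  have hseg : ∀ y ∈ Set.uIcc x (x - τ * z), |y - x| ≤ τ * |z| := by
    intro y hy
    have := Set.abs_sub_left_of_mem_uIcc hy
    rw [sub_sub_cancel_left, abs_neg, abs_mul, abs_of_pos hτ] at this
    exact this
  have hT := abs_sub_taylor_le (convex_uIcc x (x - τ * z)) N (u := u) (x := x) (y := x - τ * z)
    (c := 0) (B := B * (2 * (1 + z ^ 2) * peak x₀ s₀ x) / s ^ N)
    (fun m hm y _ => (hu.chain m hm y).hasDerivWithinAt) Set.left_mem_uIcc (fun y hy => by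
      rw [sub_zero, le_div_iff₀ (by positivity)]
      refine (hu.bound N le_rfl y).trans ?_
      gcongr
      exact peak_le_of_abs_le hτ hτs₀ (hseg y hy)) Set.right_mem_uIcc
  rw [zero_mul, zero_div, sub_zero, sub_sub_cancel_left, abs_neg, abs_mul, abs_of_pos hτ] at hT
  have e2 : K z * u 0 (x - τ * z) - ∑ m ∈ Finset.range N,
        z ^ m * K z * (-τ) ^ m / (m.factorial : ℝ) * u m x
      = K z * (u 0 (x - τ * z) - ∑ m ∈ Finset.range N, u m x * (-(τ * z)) ^ m /
        (m.factorial : ℝ)) := by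
    rw [mul_sub, Finset.mul_sum]
    congr 1
    refine Finset.sum_congr rfl fun m _ => ?_
    rw [show -(τ * z) = z * (-τ) by ring, mul_pow]
    ring
  rw [e2, Real.norm_eq_abs, abs_mul]
  calc |K z| * _ ≤ |K z| * (B * (2 * (1 + z ^ 2) * peak x₀ s₀ x) / s ^ N * (τ * |z|) ^ N) := by
        gcongr
    _ = 2 * (|z| ^ N * |K z| + |z| ^ (N + 2) * |K z|) * (B * (τ / s) ^ N * peak x₀ s₀ x) := by
        rw [← sq_abs z, div_pow]; ring

/-- A controlled function supported in the unit interval is, up to a power of the bandwidth, a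
convolution with the rescaled kernel of a function supported in the unit interval. -/
theorem exists_smear_approx {K : ℝ → ℝ} (hK : IsKernel K) (N : ℕ) :
    ∃ C > 0, ∀ (u : ℕ → ℝ → ℝ) (B s τ s₀ x₀ : ℝ), 0 ≤ B → 0 < τ → τ ≤ s → τ ≤ s₀ →
      Controlled N s B (peak x₀ s₀) u → VanishesOff N u →
      ∃ g : ℝ → ℝ, Continuous g ∧ (∀ x ∉ Set.Icc (0 : ℝ) 1, g x = 0) ∧
        (∀ x, |g x| ≤ C * B * peak x₀ s₀ x) ∧
        ∀ x, |u 0 x - smear K τ g x| ≤ C * B * (τ / s) ^ N * peak x₀ s₀ x := by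
  induction N using Nat.strong_induction_on with
  | _ N ih =>
  -- At order `0` nothing has to be gained, and `g = 0` works.
  rcases Nat.eq_zero_or_pos N with rfl | hN
  · refine ⟨1, one_pos, fun u B s τ s₀ x₀ hB hτ hτs hτs₀ hu h0 => ⟨fun _ => 0, continuous_const,
      fun _ _ => rfl, fun x => ?_, fun x => ?_⟩⟩
    · have := peak_nonneg x₀ s₀ x
      rw [abs_zero]; positivity
    · simpa [smear] using hu.bound 0 le_rfl x
  have ih' : ∀ k : ℕ, ∃ C > 0, k < N → ∀ (u : ℕ → ℝ → ℝ) (B s τ s₀ x₀ : ℝ), 0 ≤ B → 0 < τ →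
      τ ≤ s → τ ≤ s₀ → Controlled k s B (peak x₀ s₀) u → VanishesOff k u →
      ∃ g : ℝ → ℝ, Continuous g ∧ (∀ x ∉ Set.Icc (0 : ℝ) 1, g x = 0) ∧
        (∀ x, |g x| ≤ C * B * peak x₀ s₀ x) ∧
        ∀ x, |u 0 x - smear K τ g x| ≤ C * B * (τ / s) ^ k * peak x₀ s₀ x := by
    intro k
    by_cases hk : k < N
    · obtain ⟨C, hC, h⟩ := ih k hk
      exact ⟨C, hC, fun _ => h⟩
    · exact ⟨1, one_pos, fun h => absurd h hk⟩
  clear ih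
  choose C hC ih using ih'
  -- Convolving `u 0` gives `κ * u 0 + ∑ a m * u (m + 1)` up to order `N`, where `a m` is of size `τ
  -- ^ (m + 1)`. The unwanted terms are removed by deconvolving `u (m + 1)` to the lower order `N -
  -- (m + 1)`: if `g m` does this, `κ⁻¹ * (u 0 - ∑ a m * g m)` is the required function. The missing
  -- order is supplied by `a m`, and the support stays in `[0,1]`.
  set M : ℕ → ℝ := fun m => ∫ z, z ^ m * K z with hM
  set κ : ℝ := ∫ z, K z with hκ
  have hκ0 : 0 < κ := hK.integral_pos
  set R : ℝ := ∫ z, 2 * (|z| ^ N * |K z| + |z| ^ (N + 2) * |K z|) with hR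
  have hR0 : 0 ≤ R := integral_nonneg fun z => by positivity
  obtain ⟨n, rfl⟩ : ∃ n, N = n + 1 := ⟨N - 1, by omega⟩
  set D : ℝ := κ⁻¹ * (1 + R + ∑ m ∈ Finset.range n, |M (m + 1)| * C (n - m)) with hD
  have hS0 : 0 ≤ ∑ m ∈ Finset.range n, |M (m + 1)| * C (n - m) :=
    Finset.sum_nonneg fun m _ => mul_nonneg (abs_nonneg _) (hC _).le
  refine ⟨D, by positivity, fun u B s τ s₀ x₀ hB hτ hτs hτs₀ hu h0 => ?_⟩
  have hs : 0 < s := hτ.trans_le hτs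
  have hg : ∀ m : ℕ, ∃ g : ℝ → ℝ, m < n → Continuous g ∧ (∀ x ∉ Set.Icc (0 : ℝ) 1, g x = 0) ∧
        (∀ x, |g x| ≤ C (n - m) * (B / s ^ (m + 1)) * peak x₀ s₀ x) ∧
        ∀ x, |u (m + 1) x - smear K τ g x| ≤
          C (n - m) * (B / s ^ (m + 1)) * (τ / s) ^ (n - m) * peak x₀ s₀ x := by
    intro m
    by_cases hm : m < n
    · have h1 := hu.shift hs (k := m + 1) (by omega)
      rw [show n + 1 - (m + 1) = n - m by omega] at h1
      obtain ⟨g, h⟩ := ih (n - m) (by omega) (fun i => u (i + (m + 1))) (B / s ^ (m + 1)) s τ s₀ x₀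
        (by positivity) hτ hτs hτs₀ h1 (fun i hi x hx => h0 _ (by omega) x hx)
      exact ⟨g, fun _ => by simpa using h⟩
    · exact ⟨fun _ => 0, fun h => absurd h hm⟩
  choose g hg using hg
  set a : ℕ → ℝ := fun m => M (m + 1) * (-τ) ^ (m + 1) / ((m + 1).factorial : ℝ) with ha
  have haτ (m : ℕ) : |a m| ≤ |M (m + 1)| * τ ^ (m + 1) := by
    simp only [ha]
    rw [abs_div, abs_mul, abs_pow, abs_neg, abs_of_pos hτ, Nat.abs_cast]
    exact div_le_self (by positivity) (by exact_mod_cast Nat.one_le_of_lt (Nat.factorial_pos _))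
  have hu0c : Continuous (u 0) := hu.chain.continuous (by omega)
  have hsum_smear (x : ℝ) :
      smear K τ (fun x => κ⁻¹ * (u 0 x - ∑ m ∈ Finset.range n, a m * g m x)) x
      = κ⁻¹ * (smear K τ (u 0) x - ∑ m ∈ Finset.range n, a m * smear K τ (g m) x) := by
    have hi0 := integrable_kernel_mul hK.continuous τ x hu0c (h0 0 (Nat.zero_le _))
    have hi (m : ℕ) (hm : m ∈ Finset.range n) :
        Integrable fun c => a m * (K ((x - c) / τ) * g m c) :=
      (integrable_kernel_mul hK.continuous τ x (hg m (Finset.mem_range.1 hm)).1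
        (hg m (Finset.mem_range.1 hm)).2.1).const_mul _
    unfold smear
    have e1 : (fun c => K ((x - c) / τ) * (κ⁻¹ * (u 0 c - ∑ m ∈ Finset.range n, a m * g m c)))
        = fun c => κ⁻¹ * (K ((x - c) / τ) * u 0 c -
          ∑ m ∈ Finset.range n, a m * (K ((x - c) / τ) * g m c)) := by
      funext c
      rw [mul_left_comm, mul_sub, Finset.mul_sum]
      congr 2
      exact Finset.sum_congr rfl fun m _ => by ring
    rw [e1, integral_const_mul, integral_sub hi0 (integrable_finsetSum _ hi),
      integral_finsetSum _ hi]
    simp_rw [integral_const_mul]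
    rw [mul_left_comm, mul_sub, Finset.mul_sum]
    congr 2
    exact Finset.sum_congr rfl fun m _ => by ring
  refine ⟨fun x => κ⁻¹ * (u 0 x - ∑ m ∈ Finset.range n, a m * g m x), ?_, ?_, ?_, ?_⟩
  · exact continuous_const.mul (hu0c.sub (continuous_finsetSum _ fun m hm =>
      continuous_const.mul (hg m (Finset.mem_range.1 hm)).1))
  · intro x hx
    beta_reduce
    rw [h0 0 (Nat.zero_le _) x hx, Finset.sum_eq_zero, sub_zero, mul_zero]
    exact fun m hm => by rw [(hg m (Finset.mem_range.1 hm)).2.1 x hx, mul_zero]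
  · intro x
    have hw := peak_nonneg x₀ s₀ x
    have h1 : |u 0 x| ≤ B * peak x₀ s₀ x := by simpa using hu.bound 0 (Nat.zero_le _) x
    have h2 : |∑ m ∈ Finset.range n, a m * g m x| ≤
        (∑ m ∈ Finset.range n, |M (m + 1)| * C (n - m)) * (B * peak x₀ s₀ x) := by
      rw [Finset.sum_mul]
      refine (Finset.abs_sum_le_sum_abs _ _).trans (Finset.sum_le_sum fun m hm => ?_)
      have h3 := (hg m (Finset.mem_range.1 hm)).2.2.1 x
      have h4 : τ ^ (m + 1) / s ^ (m + 1) ≤ 1 := by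
        rw [← div_pow]; exact pow_le_one₀ (by positivity) ((div_le_one hs).2 hτs)
      have h5 := (hC (n - m)).le
      rw [abs_mul]
      calc |a m| * |g m x| ≤ (|M (m + 1)| * τ ^ (m + 1)) *
            (C (n - m) * (B / s ^ (m + 1)) * peak x₀ s₀ x) := by gcongr; exact haτ m
        _ = |M (m + 1)| * C (n - m) * (B * peak x₀ s₀ x) * (τ ^ (m + 1) / s ^ (m + 1)) := by ring
        _ ≤ _ := mul_le_of_le_one_right (by positivity) h4
    rw [abs_mul, abs_of_pos (inv_pos.2 hκ0)]
    calc _ ≤ κ⁻¹ * (|u 0 x| + |∑ m ∈ Finset.range n, a m * g m x|) := by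
          gcongr; exact abs_sub _ _
      _ ≤ κ⁻¹ * (B * peak x₀ s₀ x + (∑ m ∈ Finset.range n, |M (m + 1)| * C (n - m)) *
          (B * peak x₀ s₀ x)) := by gcongr
      _ ≤ κ⁻¹ * (B * peak x₀ s₀ x + (∑ m ∈ Finset.range n, |M (m + 1)| * C (n - m)) *
          (B * peak x₀ s₀ x)) + κ⁻¹ * (R * (B * peak x₀ s₀ x)) :=
          le_add_of_nonneg_right (by positivity)
      _ = _ := by rw [hD]; ring
  · intro x
    have hw := peak_nonneg x₀ s₀ x
    rw [hsum_smear]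
    have hT := abs_smear_sub_taylor_le hK (n + 1) (by omega) hτ hτs hτs₀ hu h0 x
    have e0 : ∑ m ∈ Finset.range (n + 1),
        (∫ z, z ^ m * K z) * (-τ) ^ m / (m.factorial : ℝ) * u m x
        = κ * u 0 x + ∑ m ∈ Finset.range n, a m * u (m + 1) x := by
      rw [Finset.sum_range_succ', add_comm]
      simp [hκ, ha, hM]
    rw [e0] at hT
    have h2 : |∑ m ∈ Finset.range n, a m * (u (m + 1) x - smear K τ (g m) x)| ≤
        (∑ m ∈ Finset.range n, |M (m + 1)| * C (n - m)) *
          (B * (τ / s) ^ (n + 1) * peak x₀ s₀ x) := by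
      rw [Finset.sum_mul]
      refine (Finset.abs_sum_le_sum_abs _ _).trans (Finset.sum_le_sum fun m hm => ?_)
      have hm' := Finset.mem_range.1 hm
      have h3 := (hg m hm').2.2.2 x
      rw [abs_mul]
      have h6 : n + 1 = (m + 1) + (n - m) := by omega
      calc |a m| * _ ≤ (|M (m + 1)| * τ ^ (m + 1)) *
            (C (n - m) * (B / s ^ (m + 1)) * (τ / s) ^ (n - m) * peak x₀ s₀ x) := by
              gcongr; exact haτ m
        _ = |M (m + 1)| * C (n - m) * (B * ((τ / s) ^ (m + 1) * (τ / s) ^ (n - m)) *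
            peak x₀ s₀ x) := by rw [div_pow τ s (m + 1)]; ring
        _ = _ := by rw [← pow_add, ← h6]
    have e3 : u 0 x - κ⁻¹ * (smear K τ (u 0) x - ∑ m ∈ Finset.range n, a m * smear K τ (g m) x)
        = κ⁻¹ * (-(smear K τ (u 0) x - (κ * u 0 x + ∑ m ∈ Finset.range n, a m * u (m + 1) x))
          - ∑ m ∈ Finset.range n, a m * (u (m + 1) x - smear K τ (g m) x)) := by
      simp_rw [mul_sub, Finset.sum_sub_distrib]
      field_simp
      ring
    rw [e3, abs_mul, abs_of_pos (inv_pos.2 hκ0)]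
    have hP : 0 ≤ B * (τ / s) ^ (n + 1) * peak x₀ s₀ x := by positivity
    calc _ ≤ κ⁻¹ * (R * (B * (τ / s) ^ (n + 1) * peak x₀ s₀ x) +
          (∑ m ∈ Finset.range n, |M (m + 1)| * C (n - m)) *
          (B * (τ / s) ^ (n + 1) * peak x₀ s₀ x)) := by
          gcongr
          refine (abs_sub _ _).trans ?_
          rw [abs_neg]
          exact add_le_add hT h2
      _ ≤ κ⁻¹ * (R * (B * (τ / s) ^ (n + 1) * peak x₀ s₀ x) +
          (∑ m ∈ Finset.range n, |M (m + 1)| * C (n - m)) *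
          (B * (τ / s) ^ (n + 1) * peak x₀ s₀ x)) + κ⁻¹ * (B * (τ / s) ^ (n + 1) * peak x₀ s₀ x) :=
          le_add_of_nonneg_right (by positivity)
      _ = _ := by rw [hD]; ring

/-! ### Matching the jet of a function at the boundary -/

namespace IsKernel

variable {K : ℝ → ℝ}

lemma hasDerivAt_iteratedDeriv (hK : IsKernel K) (m : ℕ) (x : ℝ) :
    HasDerivAt (iteratedDeriv m K) (iteratedDeriv (m + 1) K x) x :=
  isDerivChain_iteratedDeriv (N := m + 1) hK.contDiff m (Nat.lt_succ_self m) x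

lemma comp_neg (hK : IsKernel K) : IsKernel fun z => K (-z) where
  analytic x _ := AnalyticAt.fun_comp (hK.analytic (-x) (Set.mem_univ _)) analyticAt_id.neg
  decay m p := by
    obtain ⟨C, hC, h⟩ := hK.decay m p
    refine ⟨C, hC, fun x => ?_⟩
    have := h (-x)
    rw [neg_sq] at this
    rw [iteratedDeriv_comp_neg, smul_eq_mul, abs_mul, abs_pow, abs_neg, abs_one, one_pow, one_mul]
    exact this
  integral_pos := by rw [integral_neg_eq_self (fun z => K z)]; exact hK.integral_pos

lemma decay_shift (hK : IsKernel K) (m p : ℕ) : ∃ C > 0, ∀ z, ∀ c ∈ Set.Icc (0 : ℝ) 1,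
    |iteratedDeriv m K (z - c)| * (1 + z ^ 2) ^ p ≤ C := by
  obtain ⟨C, hC, h⟩ := hK.decay m p
  refine ⟨4 ^ p * C, by positivity, fun z c hc => ?_⟩
  have h1 : 1 + z ^ 2 ≤ 4 * (1 + (z - c) ^ 2) := by
    nlinarith [sq_nonneg (z - 2 * c), hc.1, hc.2, sq_nonneg (z - c), mul_nonneg hc.1 (sub_nonneg.2 hc.2)]
  calc |iteratedDeriv m K (z - c)| * (1 + z ^ 2) ^ p
      ≤ |iteratedDeriv m K (z - c)| * (4 * (1 + (z - c) ^ 2)) ^ p := by gcongr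
    _ = 4 ^ p * (|iteratedDeriv m K (z - c)| * (1 + (z - c) ^ 2) ^ p) := by rw [mul_pow]; ring
    _ ≤ 4 ^ p * C := by gcongr; exact h _

lemma abs_iteratedDeriv_le (hK : IsKernel K) (m : ℕ) :
    ∃ C > 0, ∀ x, |iteratedDeriv m K x| ≤ C * (1 + x ^ 2)⁻¹ := by
  obtain ⟨C, hC, h⟩ := hK.decay m 1
  refine ⟨C, hC, fun x => ?_⟩
  rw [← div_eq_mul_inv, le_div_iff₀ (by positivity)]
  simpa using h x

lemma integrable_iteratedDeriv (hK : IsKernel K) (m : ℕ) : Integrable (iteratedDeriv m K) := by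
  obtain ⟨C, _, h⟩ := hK.abs_iteratedDeriv_le m
  exact (integrable_inv_one_add_sq.const_mul C).mono'
    (hK.contDiff.continuous_iteratedDeriv (n := m) m le_rfl).aestronglyMeasurable (.of_forall h)

lemma tendsto_iteratedDeriv (hK : IsKernel K) (m : ℕ) {l : Filter ℝ}
    (hl : Filter.Tendsto (fun x : ℝ => |x|) l Filter.atTop) :
    Filter.Tendsto (iteratedDeriv m K) l (nhds 0) := by
  obtain ⟨C, _, h⟩ := hK.abs_iteratedDeriv_le m
  refine squeeze_zero_norm h ?_
  rw [← mul_zero C]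
  refine Filter.Tendsto.const_mul C (tendsto_inv_atTop_zero.comp ?_)
  have h1 : Filter.Tendsto (fun x : ℝ => |x| ^ 2) l Filter.atTop :=
    (Filter.tendsto_pow_atTop two_ne_zero).comp hl
  simpa using Filter.tendsto_atTop_add_const_left l 1 h1

lemma integral_iteratedDeriv_succ (hK : IsKernel K) (m : ℕ) :
    ∫ x, iteratedDeriv (m + 1) K x = 0 := by
  rw [integral_of_hasDerivAt_of_tendsto (hK.hasDerivAt_iteratedDeriv m)
    (hK.integrable_iteratedDeriv (m + 1))
    (hK.tendsto_iteratedDeriv m Filter.tendsto_abs_atBot_atTop)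
    (hK.tendsto_iteratedDeriv m Filter.tendsto_abs_atTop_atTop), sub_zero]

/-- A kernel solves no linear differential equation with constant coefficients. -/
lemma coeff_eq_zero_of_ode (hK : IsKernel K) (n : ℕ) : ∀ a : ℕ → ℝ,
    (∀ x, ∑ k ∈ Finset.range n, a k * iteratedDeriv k K x = 0) → ∀ k < n, a k = 0 := by
  induction n with
  | zero => intro a _ k hk; omega
  | succ n ih =>
    intro a ha
    -- Integrating the equation over the line kills all derivatives of positive order and leaves `a
    -- 0 * ∫ K = 0`.
    have h0 : a 0 = 0 := by
      have h1 : ∫ x, ∑ k ∈ Finset.range (n + 1), a k * iteratedDeriv k K x = 0 := by simp [ha]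
      rw [integral_finsetSum _ fun k _ => (hK.integrable_iteratedDeriv k).const_mul _,
        Finset.sum_range_succ'] at h1
      simp only [integral_const_mul, hK.integral_iteratedDeriv_succ, mul_zero,
        Finset.sum_const_zero, zero_add, iteratedDeriv_zero] at h1
      exact (mul_eq_zero.1 h1).resolve_right hK.integral_pos.ne'
    -- `G` is an antiderivative of the remaining equation. It is constant and tends to `0` at
    -- infinity, so `K` satisfies an equation of lower order.
    set G : ℝ → ℝ := fun x => ∑ k ∈ Finset.range n, a (k + 1) * iteratedDeriv k K x with hG
    have hG' (x : ℝ) : HasDerivAt G 0 x := by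
      have h1 : HasDerivAt G (∑ k ∈ Finset.range n, a (k + 1) * iteratedDeriv (k + 1) K x) x :=
        HasDerivAt.fun_sum fun k _ => (hK.hasDerivAt_iteratedDeriv k x).const_mul _
      have h2 := ha x
      rw [Finset.sum_range_succ', h0, zero_mul, add_zero] at h2
      rwa [h2] at h1
    have hconst := is_const_of_deriv_eq_zero (fun x => (hG' x).differentiableAt)
      fun x => (hG' x).deriv
    have hlim : Filter.Tendsto G Filter.atTop (nhds 0) := by
      have := tendsto_finsetSum (Finset.range n) fun k _ =>
        (hK.tendsto_iteratedDeriv k Filter.tendsto_abs_atTop_atTop).const_mul (a (k + 1))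
      simpa using this
    have hzero (x : ℝ) : G x = 0 := by
      have h1 : G = fun _ => G x := funext fun y => hconst y x
      rw [h1] at hlim
      exact tendsto_nhds_unique tendsto_const_nhds hlim
    intro k hk
    rcases k with _ | k
    · exact h0
    · exact ih (fun k => a (k + 1)) hzero k (by omega)

/-- A functional that kills all these jets is a differential equation with constant coefficients
that `K` satisfies on `[-1,0]`. By analyticity it holds on the whole line, so `coeff_eq_zero_of_ode`
makes the functional vanish. -/
lemma span_jet_eq_top (hK : IsKernel K) (N : ℕ) :
    Submodule.span ℝ ((fun (c : ℝ) (k : Fin (N + 1)) => iteratedDeriv k K (-c)) ''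
      Set.Icc (0 : ℝ) 1) = ⊤ := by
  by_contra hne
  obtain ⟨f, hf0, hf⟩ := Submodule.exists_le_ker_of_lt_top _ (lt_top_iff_ne_top.2 hne)
  set b : Fin (N + 1) → ℝ := fun k => f fun j => if k = j then 1 else 0 with hb
  set a : ℕ → ℝ := fun k => if h : k < N + 1 then b ⟨k, h⟩ else 0 with ha
  have hsum (v : ℕ → ℝ) : f (fun k : Fin (N + 1) => v k) = ∑ k ∈ Finset.range (N + 1), a k * v k := by
    rw [LinearMap.pi_apply_eq_sum_univ f, Finset.sum_range]
    refine Finset.sum_congr rfl fun k _ => ?_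
    simp only [ha, hb, k.2, dif_pos, smul_eq_mul, Fin.eta, mul_comm]
  have hzero : ∀ x ∈ Set.Icc (-1 : ℝ) 0,
      ∑ k ∈ Finset.range (N + 1), a k * iteratedDeriv k K x = 0 := by
    intro x hx
    rw [← hsum fun k => iteratedDeriv k K x]
    refine hf (Submodule.subset_span ⟨-x, ⟨by linarith [hx.2], by linarith [hx.1]⟩, ?_⟩)
    simp
  have han : AnalyticOnNhd ℝ (fun x => ∑ k ∈ Finset.range (N + 1), a k * iteratedDeriv k K x)
      Set.univ := by
    refine Finset.analyticOnNhd_fun_sum _ fun k _ => analyticOnNhd_const.mul ?_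
    rw [iteratedDeriv_eq_iterate]
    exact hK.analytic.iterated_deriv k
  have hev : (fun x => ∑ k ∈ Finset.range (N + 1), a k * iteratedDeriv k K x)
      =ᶠ[nhds (-1 / 2)] 0 := by
    filter_upwards [Icc_mem_nhds (show (-1 : ℝ) < -1 / 2 by norm_num)
      (show (-1 / 2 : ℝ) < 0 by norm_num)] with x hx using hzero x hx
  have hall := han.eqOn_zero_of_preconnected_of_eventuallyEq_zero isPreconnected_univ
    (Set.mem_univ _) hev
  have hcoef := hK.coeff_eq_zero_of_ode (N + 1) a fun x => hall (Set.mem_univ x)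
  refine hf0 (LinearMap.ext fun v => ?_)
  rw [LinearMap.pi_apply_eq_sum_univ f, LinearMap.zero_apply]
  refine Finset.sum_eq_zero fun k _ => ?_
  have := hcoef k k.2
  simp only [ha, k.2, dif_pos, hb] at this
  rw [this, smul_zero]

/-- Combinations of translates of the kernel with prescribed jets at the origin. -/
lemma exists_cardinal (hK : IsKernel K) (N m : ℕ) : ∃ (n : ℕ) (A c : Fin n → ℝ),
    (∀ i, c i ∈ Set.Icc (0 : ℝ) 1) ∧
      ∀ k ≤ N, ∑ i, A i * iteratedDeriv k K (-c i) = if k = m then 1 else 0 := by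
  have h : (fun k : Fin (N + 1) => if (k : ℕ) = m then (1 : ℝ) else 0) ∈
      Submodule.span ℝ ((fun (c : ℝ) (k : Fin (N + 1)) => iteratedDeriv k K (-c)) ''
        Set.Icc (0 : ℝ) 1) := by
    rw [hK.span_jet_eq_top]; trivial
  obtain ⟨n, A, g, hg⟩ := Submodule.mem_span_set'.1 h
  choose c hc hgc using fun i => (g i).2
  refine ⟨n, A, c, hc, fun k hk => ?_⟩
  have h1 := congrFun hg ⟨k, by omega⟩
  simp only [Finset.sum_apply, Pi.smul_apply, smul_eq_mul] at h1
  rw [← h1]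
  refine Finset.sum_congr rfl fun i _ => ?_
  rw [← hgc i]

end IsKernel

/-! ### A cutoff function -/

/-- A smooth function equal to `1` on `x ≤ 2/3` and to `0` on `x ≥ 5/6`. -/
noncomputable def cutoff (x : ℝ) : ℝ := Real.smoothTransition (5 - 6 * x)

lemma contDiff_cutoff {n : ℕ∞} : ContDiff ℝ n cutoff :=
  Real.smoothTransition.contDiff.comp (by fun_prop)

lemma cutoff_eq_one {x : ℝ} (hx : x ≤ 2 / 3) : cutoff x = 1 :=
  Real.smoothTransition.one_of_one_le (by linarith)

lemma cutoff_eq_zero {x : ℝ} (hx : 5 / 6 ≤ x) : cutoff x = 0 :=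
  Real.smoothTransition.zero_of_nonpos (by linarith)

lemma abs_one_sub_cutoff_le (x : ℝ) : |1 - cutoff x| ≤ 1 := by
  rw [abs_le]
  have h1 := Real.smoothTransition.nonneg (5 - 6 * x)
  have h2 := Real.smoothTransition.le_one (5 - 6 * x)
  constructor <;> unfold cutoff <;> linarith

lemma exists_abs_iteratedDeriv_cutoff_le (m : ℕ) : ∃ C > 0, ∀ x, |iteratedDeriv m cutoff x| ≤ C := by
  have hc : Continuous (iteratedDeriv m cutoff) :=
    (contDiff_cutoff (n := m)).continuous_iteratedDeriv m le_rfl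
  obtain ⟨C, hC⟩ := (isCompact_Icc (a := (0 : ℝ)) (b := 1)).exists_bound_of_continuousOn
    hc.continuousOn
  refine ⟨max C 1, by positivity, fun x => ?_⟩
  by_cases hx : x ∈ Set.Icc (0 : ℝ) 1
  · exact (hC x hx).trans (le_max_left _ _)
  · refine le_trans ?_ (le_max_right _ _)
    have h : ∃ c : ℝ, |c| ≤ 1 ∧ cutoff =ᶠ[nhds x] fun _ => c := by
      rcases lt_or_ge x 0 with h | h
      · refine ⟨1, by simp, ?_⟩
        filter_upwards [Iio_mem_nhds h] with y hy
        exact cutoff_eq_one (by linarith [Set.mem_Iio.1 hy])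
      · refine ⟨0, by simp, ?_⟩
        have : 1 < x := by by_contra h'; exact hx ⟨h, not_lt.1 h'⟩
        filter_upwards [Ioi_mem_nhds this] with y hy
        exact cutoff_eq_zero (by linarith [Set.mem_Ioi.1 hy])
    obtain ⟨c, hc1, hc2⟩ := h
    rw [hc2.iteratedDeriv_eq, iteratedDeriv_const]
    split_ifs <;> simp [hc1]

/-! ### Gluing with zero -/

/-- The difference of two chains on the right half-line, extended by zero. -/
noncomputable def glue (u v : ℕ → ℝ → ℝ) (m : ℕ) (x : ℝ) : ℝ := if 0 ≤ x then u m x - v m x else 0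

/-- Only the origin matters. There the equality of the jets at orders `m` and `m + 1` makes the left
and right derivatives agree. -/
lemma isDerivChain_glue {N : ℕ} {u v : ℕ → ℝ → ℝ} (hu : IsDerivChain N u) (hv : IsDerivChain N v)
    (h : ∀ m ≤ N, u m 0 = v m 0) : IsDerivChain N (glue u v) := by
  intro m hm x
  rcases lt_trichotomy x 0 with hx | rfl | hx
  · have h1 : glue u v m =ᶠ[nhds x] fun _ => 0 := by
      filter_upwards [Iio_mem_nhds hx] with y hy
      simp [glue, not_le.2 (Set.mem_Iio.1 hy)]
    have h2 : glue u v (m + 1) x = 0 := by simp [glue, not_le.2 hx]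
    rw [h2]
    exact (hasDerivAt_const x 0).congr_of_eventuallyEq h1
  · have h2 : glue u v (m + 1) 0 = u (m + 1) 0 - v (m + 1) 0 := by simp [glue]
    have hR : HasDerivWithinAt (glue u v m) (glue u v (m + 1) 0) (Set.Ici 0) 0 := by
      rw [h2]
      refine ((hu m hm 0).sub (hv m hm 0)).hasDerivWithinAt.congr (fun y hy => ?_) ?_
      · simp [glue, Set.mem_Ici.1 hy]
      · simp [glue]
    have hL : HasDerivWithinAt (glue u v m) (glue u v (m + 1) 0) (Set.Iic 0) 0 := by
      rw [h2, h (m + 1) (by omega), sub_self]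
      refine (hasDerivWithinAt_const 0 (Set.Iic 0) (0 : ℝ)).congr (fun y hy => ?_) ?_
      · rcases (Set.mem_Iic.1 hy).lt_or_eq with hy | rfl
        · simp [glue, not_le.2 hy]
        · simp [glue, h m hm.le]
      · simp [glue, h m hm.le]
    have := hL.union hR
    rwa [Set.Iic_union_Ici, hasDerivWithinAt_univ] at this
  · have h1 : glue u v m =ᶠ[nhds x] fun y => u m y - v m y := by
      filter_upwards [Ioi_mem_nhds hx] with y hy
      simp [glue, (Set.mem_Ioi.1 hy).le]
    have h2 : glue u v (m + 1) x = u (m + 1) x - v (m + 1) x := by simp [glue, hx.le]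
    rw [h2]
    exact ((hu m hm x).sub (hv m hm x)).congr_of_eventuallyEq h1

/-- A linear combination of translates of the rescaled kernel. -/
noncomputable def kernelSum {I : Type} [Fintype I] (K : ℝ → ℝ) (τ : ℝ) (a c : I → ℝ) (x : ℝ) : ℝ :=
  ∑ i, a i * K ((x - c i) / τ)

lemma hasDerivAt_kernelSum_deriv {K : ℝ → ℝ} (hK : IsKernel K) {I : Type} [Fintype I] {τ : ℝ}
    (a c : I → ℝ) (k : ℕ) (x : ℝ) :
    HasDerivAt (fun x => ∑ i, a i * (τ⁻¹ ^ k * iteratedDeriv k K (x / τ - c i)))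
      (∑ i, a i * (τ⁻¹ ^ (k + 1) * iteratedDeriv (k + 1) K (x / τ - c i))) x := by
  refine HasDerivAt.fun_sum fun i _ => HasDerivAt.const_mul _ ?_
  have h1 : HasDerivAt (fun x => x / τ - c i) (1 / τ) x :=
    ((hasDerivAt_id' x).div_const τ).sub_const _
  refine (((hK.hasDerivAt_iteratedDeriv k _).comp x h1).const_mul (τ⁻¹ ^ k)).congr_deriv ?_
  rw [pow_succ]
  ring

lemma iteratedDeriv_kernelSum {K : ℝ → ℝ} (hK : IsKernel K) {I : Type} [Fintype I] {τ : ℝ}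
    (hτ : τ ≠ 0) (a c : I → ℝ) (k : ℕ) :
    iteratedDeriv k (kernelSum K τ a fun i => τ * c i)
      = fun x => ∑ i, a i * (τ⁻¹ ^ k * iteratedDeriv k K (x / τ - c i)) := by
  induction k with
  | zero =>
    funext x
    simp only [iteratedDeriv_zero, kernelSum, pow_zero, one_mul]
    refine Finset.sum_congr rfl fun i _ => ?_
    rw [sub_div, mul_div_cancel_left₀ _ hτ]
  | succ k ih =>
    funext x
    rw [iteratedDeriv_succ, ih]
    exact (hasDerivAt_kernelSum_deriv hK a c k x).deriv

lemma contDiff_kernelSum {K : ℝ → ℝ} (hK : IsKernel K) {I : Type} [Fintype I] {τ : ℝ}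
    (a c : I → ℝ) {n : WithTop ℕ∞} : ContDiff ℝ n (kernelSum K τ a c) := by
  unfold kernelSum
  exact ContDiff.sum fun i _ => contDiff_const.mul (hK.contDiff.comp (by fun_prop))

/-- A controlled function vanishing near the right end of the unit interval is the sum of a
function that is nearly a kernel combination and of a function that extends by zero. -/
theorem exists_left_split {K : ℝ → ℝ} (hK : IsKernel K) (N : ℕ) :
    ∃ C > 0, ∀ (u : ℕ → ℝ → ℝ) (B s τ s₀ x₀ : ℝ), 0 ≤ B → 0 < τ → τ ≤ s → τ ≤ s₀ → τ ≤ 1 →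
      Controlled N s B (peak x₀ s₀) u → (∀ m ≤ N, ∀ x, 5 / 6 < x → u m x = 0) →
      ∃ (I : Type) (_ : Fintype I) (a c : I → ℝ) (v r : ℕ → ℝ → ℝ),
        (∀ i, c i ∈ Set.Icc (0 : ℝ) 1) ∧ ∑ i, |a i| ≤ C * B ∧
        (∀ x ∈ Set.Icc (0 : ℝ) 1, u 0 x = v 0 x + r 0 x) ∧
        Controlled N τ (C * B) (peak x₀ s₀) v ∧ (∀ m ≤ N, ∀ x, 5 / 6 < x → v m x = 0) ∧
        Controlled N τ (C * B) (peak x₀ s₀) r ∧ VanishesOff N r ∧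
        ∀ x ∈ Set.Icc (0 : ℝ) 1, |v 0 x - kernelSum K τ a c x| ≤ C * B * τ ^ N * peak x₀ s₀ x := by
  choose n A c hc hA using fun m => hK.exists_cardinal N m
  choose C' hC' hdecay using fun k => hK.decay_shift k (N + 1)
  choose Cχ hCχ hχ using exists_abs_iteratedDeriv_cutoff_le
  let I : Type := Σ m : Fin (N + 1), Fin (n m)
  set SA : ℝ := ∑ p : I, |A p.1 p.2| with hSA
  have hSA0 : 0 ≤ SA := Finset.sum_nonneg fun _ _ => abs_nonneg _
  set e : ℕ → ℝ := fun m => ∑ i ∈ Finset.range (m + 1),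
    (m.choose i : ℝ) * Cχ i * (2 * (SA * C' (m - i))) with he
  have he0 (m : ℕ) : 0 ≤ e m := Finset.sum_nonneg fun i _ => by
    have := (hCχ i).le
    have := (hC' (m - i)).le
    positivity
  set E : ℝ := ∑ m ∈ Finset.range (N + 1), e m with hE
  have hE0 : 0 ≤ E := Finset.sum_nonneg fun m _ => he0 m
  have heE (m : ℕ) (hm : m ≤ N) : e m ≤ E :=
    Finset.single_le_sum (fun m _ => he0 m) (Finset.mem_range.2 (by omega))
  have hC0 := hC' 0
  set C : ℝ := 1 + SA + E + 2 * (SA * C' 0) with hC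
  have hSAC : 0 ≤ SA * C' 0 := by positivity
  refine ⟨C, by positivity, fun u B s τ s₀ x₀ hB hτ hτs hτs₀ hτ1 hu h0 => ?_⟩
  have hs : 0 < s := hτ.trans_le hτs
  set w := peak x₀ s₀ with hw
  have hw0 (x : ℝ) : 0 ≤ w x := peak_nonneg _ _ x
  -- Differentiating `m` times a kernel of bandwidth `τ` produces `τ⁻¹ ^ m`. With these coefficients
  -- the combination therefore has the jet of `u` at `0`.
  set a : I → ℝ := fun p => τ ^ (p.1 : ℕ) * u p.1 0 * A p.1 p.2 with ha
  set cc : I → ℝ := fun p => c p.1 p.2 with hcc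
  have hab (p : I) : |a p| ≤ |A p.1 p.2| * (B * w 0) := by
    have h1 := hu.bound p.1 (by have := p.1.2; omega) 0
    rw [ha, abs_mul, abs_mul, abs_pow, abs_of_pos hτ, mul_comm]
    refine mul_le_mul_of_nonneg_left (le_trans ?_ h1) (abs_nonneg _)
    rw [mul_comm]
    gcongr
  set Φ := kernelSum K τ a fun i => τ * cc i with hΦ
  have hΦd : ∀ k x, iteratedDeriv k Φ x = ∑ i, a i * (τ⁻¹ ^ k * iteratedDeriv k K (x / τ - cc i)) :=
    fun k x => congrFun (iteratedDeriv_kernelSum hK hτ.ne' a cc k) x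
  have hΦc {n : WithTop ℕ∞} : ContDiff ℝ n Φ := contDiff_kernelSum hK a _
  -- Of the `N + 1` powers of decay, one pays for moving the weight from `0` to `x`. The other `N`
  -- make `Φ` of order `τ ^ N` away from the left end.
  have hΦb (k : ℕ) (x : ℝ) : |iteratedDeriv k Φ x| * τ ^ k * (1 + (x / τ) ^ 2) ^ N
      ≤ 2 * (SA * C' k) * (B * w x) := by
    have hz : 0 < 1 + (x / τ) ^ 2 := by positivity
    have hC'k := (hC' k).le
    refine le_of_mul_le_mul_right ?_ hz
    calc |iteratedDeriv k Φ x| * τ ^ k * (1 + (x / τ) ^ 2) ^ N * (1 + (x / τ) ^ 2)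
        = |iteratedDeriv k Φ x| * τ ^ k * (1 + (x / τ) ^ 2) ^ (N + 1) := by ring
      _ ≤ (∑ i, |a i| * (τ⁻¹ ^ k * |iteratedDeriv k K (x / τ - cc i)|)) * τ ^ k *
          (1 + (x / τ) ^ 2) ^ (N + 1) := by
          gcongr
          rw [hΦd]
          refine (Finset.abs_sum_le_sum_abs _ _).trans (Finset.sum_le_sum fun i _ => ?_)
          rw [abs_mul (a i), abs_mul (τ⁻¹ ^ k), abs_of_nonneg (by positivity : 0 ≤ τ⁻¹ ^ k)]
      _ = ∑ i, |a i| * (|iteratedDeriv k K (x / τ - cc i)| * (1 + (x / τ) ^ 2) ^ (N + 1)) := by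
          rw [Finset.sum_mul, Finset.sum_mul]
          refine Finset.sum_congr rfl fun i _ => ?_
          have : τ⁻¹ ^ k * τ ^ k = 1 := by rw [← mul_pow, inv_mul_cancel₀ hτ.ne', one_pow]
          calc _ = |a i| * (|iteratedDeriv k K (x / τ - cc i)| * (1 + (x / τ) ^ 2) ^ (N + 1)) *
                (τ⁻¹ ^ k * τ ^ k) := by ring
            _ = _ := by rw [this, mul_one]
      _ ≤ ∑ i : I, |A i.1 i.2| * (B * w 0) * C' k := by
          refine Finset.sum_le_sum fun i _ => ?_
          have := hw0 0
          exact mul_le_mul (hab i) (hdecay k _ _ (hc _ _)) (by positivity) (by positivity)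
      _ = SA * C' k * (B * w 0) := by
          rw [hSA, Finset.sum_mul, Finset.sum_mul]
          exact Finset.sum_congr rfl fun i _ => by ring
      _ ≤ SA * C' k * (B * (2 * (1 + (x / τ) ^ 2) * w x)) := by
          gcongr
          refine peak_le_of_abs_le hτ hτs₀ (le_of_eq ?_)
          rw [zero_sub, abs_neg, abs_div, abs_of_pos hτ, mul_div_cancel₀ _ hτ.ne']
      _ = _ := by ring
  have hΦb' (k : ℕ) (x : ℝ) : |iteratedDeriv k Φ x| * τ ^ k ≤ 2 * (SA * C' k) * (B * w x) := by
    refine le_trans (le_mul_of_one_le_right (by positivity) (one_le_pow₀ ?_)) (hΦb k x)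
    nlinarith [sq_nonneg (x / τ)]
  -- The cutoff preserves the jet at `0` and makes `v` vanish near the right end. Hence `u - v`, cut
  -- off at `0` by zero, vanishes outside `[0,1]`. The price is that `v`, and with it the
  -- difference, is controlled only at the scale `τ` instead of `s`.
  set v : ℕ → ℝ → ℝ := fun m => iteratedDeriv m fun x => cutoff x * Φ x with hv
  have hvc : IsDerivChain N v :=
    isDerivChain_iteratedDeriv ((contDiff_cutoff (n := N)).mul hΦc)
  have hvb : ∀ m ≤ N, ∀ x, |v m x| * τ ^ m ≤ E * B * w x := by
    intro m hm x
    have hBw : 0 ≤ B * w x := mul_nonneg hB (hw0 x)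
    simp only [hv]
    rw [iteratedDeriv_fun_mul ((contDiff_cutoff (n := m)).contDiffAt) hΦc.contDiffAt]
    calc _ ≤ (∑ i ∈ Finset.range (m + 1), (m.choose i : ℝ) * |iteratedDeriv i cutoff x| *
            |iteratedDeriv (m - i) Φ x|) * τ ^ m := by
          gcongr
          refine (Finset.abs_sum_le_sum_abs _ _).trans (Finset.sum_le_sum fun i _ => ?_)
          rw [abs_mul, abs_mul, Nat.abs_cast]
      _ ≤ ∑ i ∈ Finset.range (m + 1), (m.choose i : ℝ) * Cχ i * (2 * (SA * C' (m - i))) *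
            (B * w x) := by
          rw [Finset.sum_mul]
          refine Finset.sum_le_sum fun i hi => ?_
          have h1 : τ ^ m ≤ τ ^ (m - i) := pow_le_pow_of_le_one hτ.le hτ1 (Nat.sub_le _ _)
          have h2 := (hCχ i).le
          calc _ ≤ (m.choose i : ℝ) * Cχ i * |iteratedDeriv (m - i) Φ x| * τ ^ (m - i) := by
                gcongr; exact hχ i x
            _ = (m.choose i : ℝ) * Cχ i * (|iteratedDeriv (m - i) Φ x| * τ ^ (m - i)) := by ring
            _ ≤ (m.choose i : ℝ) * Cχ i * (2 * (SA * C' (m - i)) * (B * w x)) := by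
                exact mul_le_mul_of_nonneg_left (hΦb' _ _) (by positivity)
            _ = _ := by ring
      _ = e m * (B * w x) := by rw [he, Finset.sum_mul]
      _ ≤ E * (B * w x) := by gcongr; exact heE m hm
      _ = _ := by ring
  have hvR : ∀ m ≤ N, ∀ x, 5 / 6 < x → v m x = 0 := by
    intro m _ x hx
    have h1 : (fun x => cutoff x * Φ x) =ᶠ[nhds x] fun _ => 0 := by
      filter_upwards [Ioi_mem_nhds hx] with y hy
      rw [cutoff_eq_zero (Set.mem_Ioi.1 hy).le, zero_mul]
    simp only [hv]
    rw [h1.iteratedDeriv_eq, iteratedDeriv_const]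
    simp
  have hv0 : ∀ m ≤ N, u m 0 = v m 0 := by
    intro m hm
    have h1 : (fun x => cutoff x * Φ x) =ᶠ[nhds 0] Φ := by
      filter_upwards [Iio_mem_nhds (show (0 : ℝ) < 2 / 3 by norm_num)] with y hy
      rw [cutoff_eq_one (Set.mem_Iio.1 hy).le, one_mul]
    simp only [hv]
    rw [h1.iteratedDeriv_eq, hΦd, Fintype.sum_sigma]
    have h2 (k : Fin (N + 1)) : ∑ i : Fin (n k), a ⟨k, i⟩ *
        (τ⁻¹ ^ m * iteratedDeriv m K (0 / τ - cc ⟨k, i⟩))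
        = τ ^ (k : ℕ) * u k 0 * τ⁻¹ ^ m * if m = (k : ℕ) then 1 else 0 := by
      rw [← hA k m hm, Finset.mul_sum]
      refine Finset.sum_congr rfl fun i _ => ?_
      rw [zero_div, zero_sub]
      simp only [ha, hcc]
      ring
    simp_rw [h2]
    rw [Finset.sum_eq_single ⟨m, by omega⟩]
    · rw [if_pos rfl, mul_one, inv_pow]
      field_simp
    · intro k _ hk
      rw [if_neg, mul_zero]
      rintro rfl
      exact hk rfl
    · simp
  refine ⟨I, inferInstance, a, fun i => τ * cc i, v, glue u v, ?_, ?_, ?_, ⟨hvc, ?_⟩, hvR,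
    ⟨isDerivChain_glue hu.chain hvc hv0, ?_⟩, ?_, ?_⟩
  · intro i
    have := hc i.1 i.2
    exact ⟨mul_nonneg hτ.le this.1, mul_le_one₀ hτ1 this.1 this.2⟩
  · calc ∑ i, |a i| ≤ ∑ i : I, |A i.1 i.2| * (B * w 0) := Finset.sum_le_sum fun i _ => hab i
      _ = SA * (B * w 0) := by rw [hSA, Finset.sum_mul]
      _ ≤ SA * (B * 1) := by gcongr; exact peak_le_one _ _ _
      _ ≤ C * B := by rw [mul_one]; gcongr; rw [hC]; linarith
  · intro x hx
    simp [glue, hx.1]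
  · intro m hm x
    refine (hvb m hm x).trans ?_
    have := hw0 x
    gcongr
    rw [hC]; linarith
  · intro m hm x
    have hwx := hw0 x
    unfold glue
    split_ifs
    · have h1 : |u m x| * τ ^ m ≤ B * w x :=
        le_trans (by gcongr) (hu.bound m hm x)
      calc |u m x - v m x| * τ ^ m ≤ (|u m x| + |v m x|) * τ ^ m := by gcongr; exact abs_sub _ _
        _ = |u m x| * τ ^ m + |v m x| * τ ^ m := by ring
        _ ≤ B * w x + E * B * w x := add_le_add h1 (hvb m hm x)
        _ = (1 + E) * B * w x := by ring
        _ ≤ C * B * w x := by gcongr; rw [hC]; linarith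
    · rw [abs_zero, zero_mul]; positivity
  · intro m hm x hx
    unfold glue
    split_ifs with h
    · have h1 : 1 < x := by by_contra h'; exact hx ⟨h, not_lt.1 h'⟩
      rw [h0 m hm x (by linarith), hvR m hm x (by linarith), sub_zero]
    · rfl
  · intro x hx
    have hwx := hw0 x
    have e1 : v 0 x - Φ x = -((1 - cutoff x) * Φ x) := by
      simp only [hv, iteratedDeriv_zero]; ring
    rw [e1, abs_neg, abs_mul]
    rcases le_or_gt x (2 / 3) with h | h
    · rw [cutoff_eq_one h, sub_self, abs_zero, zero_mul]
      positivity
    · have h1 := hΦb 0 x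
      simp only [iteratedDeriv_zero, pow_zero, mul_one] at h1
      -- For `x > 2 / 3` each power of the decay is worth a factor `τ`.
      have h2 : 1 ≤ τ * (1 + (x / τ) ^ 2) := by
        have : τ * (1 + (x / τ) ^ 2) = τ + x ^ 2 / τ := by field_simp
        rw [this]
        have h3 : (4 / 9) / τ ≤ x ^ 2 / τ := by
          gcongr
          nlinarith
        have h4 : 1 ≤ τ + (4 / 9) / τ := by
          rw [← sub_le_iff_le_add', le_div_iff₀ hτ]
          nlinarith [sq_nonneg (τ - 1 / 2)]
        linarith
      calc |1 - cutoff x| * |Φ x| ≤ 1 * |Φ x| := by gcongr; exact abs_one_sub_cutoff_le x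
        _ ≤ |Φ x| * (τ * (1 + (x / τ) ^ 2)) ^ N := by
            rw [one_mul]
            exact le_mul_of_one_le_right (abs_nonneg _) (one_le_pow₀ h2)
        _ = |Φ x| * (1 + (x / τ) ^ 2) ^ N * τ ^ N := by rw [mul_pow]; ring
        _ ≤ 2 * (SA * C' 0) * (B * w x) * τ ^ N := by gcongr
        _ = 2 * (SA * C' 0) * B * τ ^ N * w x := by ring
        _ ≤ C * B * τ ^ N * w x := by gcongr; rw [hC]; linarith

/-- The version of `exists_left_split` at the right end. -/
theorem exists_right_split {K : ℝ → ℝ} (hK : IsKernel K) (N : ℕ) :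
    ∃ C > 0, ∀ (u : ℕ → ℝ → ℝ) (B s τ s₀ x₀ : ℝ), 0 ≤ B → 0 < τ → τ ≤ s → τ ≤ s₀ → τ ≤ 1 →
      Controlled N s B (peak x₀ s₀) u → (∀ m ≤ N, ∀ x, x < 1 / 6 → u m x = 0) →
      ∃ (I : Type) (_ : Fintype I) (a c : I → ℝ) (v r : ℕ → ℝ → ℝ),
        (∀ i, c i ∈ Set.Icc (0 : ℝ) 1) ∧ ∑ i, |a i| ≤ C * B ∧
        (∀ x ∈ Set.Icc (0 : ℝ) 1, u 0 x = v 0 x + r 0 x) ∧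
        Controlled N τ (C * B) (peak x₀ s₀) v ∧ (∀ m ≤ N, ∀ x, x < 1 / 6 → v m x = 0) ∧
        Controlled N τ (C * B) (peak x₀ s₀) r ∧ VanishesOff N r ∧
        ∀ x ∈ Set.Icc (0 : ℝ) 1, |v 0 x - kernelSum K τ a c x| ≤ C * B * τ ^ N * peak x₀ s₀ x := by
  -- The reflection `x ↦ 1 - x` exchanges the ends and turns `K` into `fun z => K (-z)`, which is
  -- again a kernel.
  obtain ⟨C, hC, h⟩ := exists_left_split hK.comp_neg N
  have hpeak (x₀ s₀ x : ℝ) : peak (1 - x₀) s₀ (1 - x) = peak x₀ s₀ x := by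
    unfold peak
    rw [show (1 - x - (1 - x₀)) / s₀ = -((x - x₀) / s₀) by ring, neg_sq]
  have hrefl {s B : ℝ} {s₀ x₀ : ℝ} {u : ℕ → ℝ → ℝ} (hu : Controlled N s B (peak x₀ s₀) u) :
      Controlled N s B (peak (1 - x₀) s₀) fun m x => (-1) ^ m * u m (1 - x) := by
    refine ⟨fun m hm x => ?_, fun m hm x => ?_⟩
    · have h1 : HasDerivAt (fun x : ℝ => 1 - x) (-1) x := by
        simpa using (hasDerivAt_id' x).const_sub 1
      refine (((hu.chain m hm (1 - x)).comp x h1).const_mul ((-1) ^ m)).congr_deriv ?_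
      rw [pow_succ]; ring
    · have := hu.bound m hm (1 - x)
      rw [← hpeak, sub_sub_cancel] at this
      simpa [abs_mul] using this
  refine ⟨C, hC, fun u B s τ s₀ x₀ hB hτ hτs hτs₀ hτ1 hu h0 => ?_⟩
  obtain ⟨I, hI, a, c, v, r, h1, h2, h3, h4, h5, h6, h7, h8⟩ := h _ B s τ s₀ (1 - x₀) hB hτ hτs
    hτs₀ hτ1 (hrefl hu) fun m hm x hx => by rw [h0 m hm (1 - x) (by linarith), mul_zero]
  have hmem {x : ℝ} (hx : x ∈ Set.Icc (0 : ℝ) 1) : 1 - x ∈ Set.Icc (0 : ℝ) 1 :=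
    ⟨by linarith [hx.2], by linarith [hx.1]⟩
  have h4' := hrefl h4
  have h6' := hrefl h6
  rw [sub_sub_cancel] at h4' h6'
  refine ⟨I, hI, a, fun i => 1 - c i, _, _, fun i => hmem (h1 i), h2, fun x hx => ?_, h4',
    fun m hm x hx => ?_, h6', fun m hm x hx => ?_, fun x hx => ?_⟩
  · simpa using h3 (1 - x) (hmem hx)
  · rw [h5 m hm (1 - x) (by linarith), mul_zero]
  · beta_reduce
    rw [h7 m hm (1 - x) fun h' => hx (by simpa using hmem h'), mul_zero]
  · have := h8 (1 - x) (hmem hx)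
    rw [hpeak] at this
    have e : kernelSum (fun z => K (-z)) τ a c (1 - x) = kernelSum K τ a (fun i => 1 - c i) x := by
      unfold kernelSum
      refine Finset.sum_congr rfl fun i _ => ?_
      beta_reduce
      rw [show -((1 - x - c i) / τ) = (x - (1 - c i)) / τ by ring]
    rw [e] at this
    simpa using this

/-! ### Moving kernels to a fixed grid -/

/-- The polynomial with the given coefficients. -/
def polyVal {N : ℕ} (a : Fin N → ℝ) (t : ℝ) : ℝ := ∑ j, a j * t ^ (j : ℕ)

lemma contDiff_polyVal {N : ℕ} (a : Fin N → ℝ) {n : WithTop ℕ∞} : ContDiff ℝ n (polyVal a) := by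
  unfold polyVal
  exact ContDiff.sum fun j _ => contDiff_const.mul (contDiff_id.pow _)

/-- Interpolation nodes whose Lebesgue functions are bounded by `1`, obtained by maximizing the
Vandermonde determinant, together with the interpolation basis. -/
lemma exists_stable_nodes (N : ℕ) : ∃ (x : Fin N → ℝ) (a : Fin N → Fin N → ℝ),
    (∀ i, x i ∈ Set.Icc (0 : ℝ) 1) ∧ (∀ i, ∀ t ∈ Set.Icc (0 : ℝ) 1, |polyVal (a i) t| ≤ 1) ∧
    ∀ t, ∀ j < N, ∑ i, polyVal (a i) t * x i ^ j = t ^ j := by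
  have hc : Continuous fun x : Fin N → ℝ => |(Matrix.vandermonde x).det| := by
    refine (Continuous.matrix_det ?_).abs
    exact continuous_matrix fun i j => by
      simp only [Matrix.vandermonde_apply]; fun_prop
  obtain ⟨x, hx, hmax⟩ := (isCompact_univ_pi fun _ : Fin N => isCompact_Icc (a := (0 : ℝ))
    (b := 1)).exists_isMaxOn ⟨fun _ => 0, fun _ _ => by simp⟩ hc.continuousOn
  have hx' (i : Fin N) : x i ∈ Set.Icc (0 : ℝ) 1 := hx i (Set.mem_univ i)
  -- The maximum is positive because equispaced nodes already give a nonzero determinant.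
  have hdet : (Matrix.vandermonde x).det ≠ 0 := by
    have h1 : (fun i : Fin N => ((i : ℕ) : ℝ) / N) ∈
        Set.univ.pi fun _ : Fin N => Set.Icc (0 : ℝ) 1 := by
      intro i _
      have hN : (0 : ℝ) < N := by exact_mod_cast i.pos
      refine ⟨by positivity, (div_le_one hN).2 (by exact_mod_cast i.2.le)⟩
    have h2 : (Matrix.vandermonde fun i : Fin N => ((i : ℕ) : ℝ) / N).det ≠ 0 := by
      refine Matrix.det_vandermonde_ne_zero_iff.2 fun i j h => ?_
      have hN : (N : ℝ) ≠ 0 := by have := i.pos; positivity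
      have h3 : ((i : ℕ) : ℝ) = j := by
        simpa [div_left_inj' hN] using h
      exact Fin.ext (by exact_mod_cast h3)
    have h3 := isMaxOn_iff.1 hmax _ h1
    exact abs_pos.1 ((abs_pos.2 h2).trans_le h3)
  set A := (Matrix.vandermonde x).transpose with hA
  have hAdet : A.det ≠ 0 := by rwa [hA, Matrix.det_transpose]
  -- By Cramer's rule the `i`-th basis polynomial at `t` is the quotient of two Vandermonde
  -- determinants, the upper one with the node `x i` moved to `t`. Maximality bounds the quotient by
  -- `1` on the unit interval.
  have hcr (i : Fin N) (t : ℝ) : Matrix.cramer A (fun j : Fin N => t ^ (j : ℕ)) i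
      = (Matrix.vandermonde (Function.update x i t)).det := by
    rw [Matrix.cramer_apply, ← Matrix.det_transpose (Matrix.vandermonde _)]
    congr 1
    ext j k
    rw [Matrix.updateCol_apply, Matrix.transpose_apply, Matrix.vandermonde_apply]
    by_cases h : k = i
    · subst h; simp
    · simp [h, hA, Matrix.vandermonde_apply]
  have hval (i : Fin N) (t : ℝ) : polyVal (fun j => A.det⁻¹ * A.adjugate i j) t
      = A.det⁻¹ * Matrix.cramer A (fun j : Fin N => t ^ (j : ℕ)) i := by
    rw [Matrix.cramer_eq_adjugate_mulVec, Matrix.mulVec, dotProduct, Finset.mul_sum]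
    exact Finset.sum_congr rfl fun j _ => mul_assoc _ _ _
  refine ⟨x, fun i j => A.det⁻¹ * A.adjugate i j, hx', ?_, ?_⟩
  · intro i t ht
    rw [hval, hcr, abs_mul, abs_inv, hA, Matrix.det_transpose]
    have h1 : Function.update x i t ∈ Set.univ.pi fun _ : Fin N => Set.Icc (0 : ℝ) 1 := by
      intro j _
      by_cases h : j = i
      · subst h; simpa using ht
      · simpa [Function.update_of_ne h] using hx' j
    have h2 := isMaxOn_iff.1 hmax _ h1
    rw [inv_mul_le_iff₀ (abs_pos.2 hdet), mul_one]
    exact h2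
  · intro t j hj
    have h1 := congrFun (Matrix.mulVec_cramer A fun j : Fin N => t ^ (j : ℕ)) ⟨j, hj⟩
    simp only [Matrix.mulVec, dotProduct, Pi.smul_apply, smul_eq_mul, hA,
      Matrix.transpose_apply, Matrix.vandermonde_apply] at h1
    rw [← hA] at h1
    simp_rw [hval, mul_assoc, ← Finset.mul_sum]
    rw [inv_mul_eq_iff_eq_mul₀ hAdet, hA, ← h1]
    exact Finset.sum_congr rfl fun i _ => mul_comm _ _

/-- `K` is near every point approximated geometrically fast by polynomials. -/
def PolyApprox (K : ℝ → ℝ) (M ρ : ℝ) : Prop :=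
  ∀ (N : ℕ) (x : ℝ), ∃ a : ℕ → ℝ, ∀ y, |y| ≤ ρ →
    |K (x - y) - ∑ j ∈ Finset.range N, a j * y ^ j| ≤ M * (1 / 2) ^ N

/-- Every translate of the rescaled kernel with centre in the unit interval is, up to `η`, a
combination of the translates with centres `γ i`, with coefficients of total size at most `V`. -/
structure IsGrid (K : ℝ → ℝ) (τ V η : ℝ) {n : ℕ} (γ : Fin n → ℝ) (l : Fin n → ℝ → ℝ) : Prop where
  mem : ∀ i, γ i ∈ Set.Icc (0 : ℝ) 1
  measurable : ∀ i, Measurable (l i)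
  sum_le : ∀ c ∈ Set.Icc (0 : ℝ) 1, ∑ i, |l i c| ≤ V
  approx : ∀ c ∈ Set.Icc (0 : ℝ) 1, ∀ x,
    |K ((x - c) / τ) - ∑ i, l i c * K ((x - γ i) / τ)| ≤ η

/-- The unit interval is cut into cells of length at most `ρ * τ`. While `c` runs through one cell,
`K ((x - c) / τ)` is, for every `x`, within `M * (1 / 2) ^ N` of a polynomial in `c` of degree less
than `N`. Interpolation in `c` at `N` stable nodes is exact on it, and its coefficients, bounded by
`1`, do not depend on `x`. The polynomial error enters once at `c` and once at each node. -/
theorem exists_grid {K : ℝ → ℝ} {M ρ : ℝ} (hρ : 0 < ρ) (hK : PolyApprox K M ρ) {τ : ℝ}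
    (hτ : 0 < τ) (hτ1 : τ ≤ 1) (N : ℕ) :
    ∃ (n : ℕ) (γ : Fin n → ℝ) (l : Fin n → ℝ → ℝ), (n : ℝ) ≤ (ρ⁻¹ + 1) * (N / τ) ∧
      IsGrid K τ N ((N + 1) * (M * (1 / 2) ^ N)) γ l := by
  obtain ⟨x, b, hx, hl1, hlsum⟩ := exists_stable_nodes N
  set l : Fin N → ℝ → ℝ := fun i => polyVal (b i) with hl_def
  have hl (i : Fin N) : Continuous (l i) := (contDiff_polyVal (n := 0) (b i)).continuous
  set a : ℕ := ⌈1 / (ρ * τ)⌉₊ with ha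
  have hρτ : 0 < ρ * τ := mul_pos hρ hτ
  have ha0 : 0 < a := Nat.ceil_pos.2 (by positivity)
  have ha0' : (0 : ℝ) < a := by exact_mod_cast ha0
  have hale : 1 / (ρ * τ) ≤ a := Nat.le_ceil _
  have hacell : 1 / (a : ℝ) ≤ ρ * τ := by
    rw [div_le_iff₀ ha0']
    rwa [div_le_iff₀ hρτ, mul_comm] at hale
  -- The minimum with `a - 1` assigns the point `c = 1` to the last cell.
  have hcell : ∀ c ∈ Set.Icc (0 : ℝ) 1, ∃ i : Fin a, c * a - (i : ℕ) ∈ Set.Icc (0 : ℝ) 1 ∧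
      ∀ j : Fin a, min ⌊c * a⌋₊ (a - 1) = j ↔ j = i := by
    intro c hc
    refine ⟨⟨min ⌊c * a⌋₊ (a - 1), by omega⟩, ?_, fun j => ?_⟩
    · have hca : 0 ≤ c * a := mul_nonneg hc.1 ha0'.le
      have h1 : (⌊c * a⌋₊ : ℝ) ≤ c * a := Nat.floor_le hca
      have h2 : c * a < ⌊c * a⌋₊ + 1 := Nat.lt_floor_add_one _
      simp only
      rcases le_total ⌊c * a⌋₊ (a - 1) with h | h
      · rw [min_eq_left h]
        exact ⟨by linarith, by linarith⟩
      · rw [min_eq_right h]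
        have h3 : c * a ≤ a := mul_le_of_le_one_left ha0'.le hc.2
        have h4 : ((a - 1 : ℕ) : ℝ) = a - 1 := by push_cast [Nat.one_le_iff_ne_zero.2 ha0.ne']; ring
        have h5 : ((a - 1 : ℕ) : ℝ) ≤ ⌊c * a⌋₊ := by exact_mod_cast h
        rw [h4] at h5 ⊢
        exact ⟨by linarith, by linarith⟩
    · rw [Fin.ext_iff]; exact eq_comm
  let L : Fin a × Fin N → ℝ → ℝ := fun p c =>
    if min ⌊c * a⌋₊ (a - 1) = (p.1 : ℕ) then l p.2 (c * a - (p.1 : ℕ)) else 0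
  let G : Fin a × Fin N → ℝ := fun p => ((p.1 : ℕ) + x p.2) / a
  have hLc : ∀ c ∈ Set.Icc (0 : ℝ) 1, ∃ i : Fin a, c * a - (i : ℕ) ∈ Set.Icc (0 : ℝ) 1 ∧
      ∀ F : Fin a × Fin N → ℝ → ℝ, (∀ p, F p 0 = 0) → ∑ p, F p (L p c) =
        ∑ k, F (i, k) (l k (c * a - (i : ℕ))) := by
    intro c hc
    obtain ⟨i, hi, hi'⟩ := hcell c hc
    refine ⟨i, hi, fun F hF => ?_⟩
    rw [Fintype.sum_prod_type, Finset.sum_eq_single i]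
    · refine Finset.sum_congr rfl fun k _ => ?_
      simp only [L, if_pos ((hi' i).2 rfl)]
    · intro j _ hj
      refine Finset.sum_eq_zero fun k _ => ?_
      have : ¬ (min ⌊c * a⌋₊ (a - 1) = (j : ℕ)) := fun h => hj ((hi' j).1 h)
      simp only [L, if_neg this, hF]
    · simp
  have hgrid : (∀ p, G p ∈ Set.Icc (0 : ℝ) 1) ∧ (∀ p, Measurable (L p)) ∧
      (∀ c ∈ Set.Icc (0 : ℝ) 1, ∑ p, |L p c| ≤ N) ∧
      ∀ c ∈ Set.Icc (0 : ℝ) 1, ∀ y,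
        |K ((y - c) / τ) - ∑ p, L p c * K ((y - G p) / τ)| ≤ (N + 1) * (M * (1 / 2) ^ N) := by
    refine ⟨fun p => ?_, fun p => ?_, fun c hc => ?_, fun c hc y => ?_⟩
    · have h1 := hx p.2
      have h2 : ((p.1 : ℕ) : ℝ) + 1 ≤ a := by exact_mod_cast p.1.2
      exact ⟨div_nonneg (add_nonneg (by positivity) h1.1) ha0'.le,
        (div_le_one ha0').2 (by linarith [h1.2])⟩
    · have h1 : Measurable fun c : ℝ => min ⌊c * a⌋₊ (a - 1) :=
        (Nat.measurable_floor.comp (measurable_id.mul_const _)).min measurable_const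
      refine Measurable.ite (h1 (measurableSet_singleton _)) ?_ measurable_const
      exact (hl p.2).measurable.comp ((measurable_id.mul_const _).sub_const _)
    · obtain ⟨i, hi, hsum⟩ := hLc c hc
      rw [hsum (fun _ t => |t|) fun _ => abs_zero]
      calc ∑ k, |l k (c * a - (i : ℕ))| ≤ ∑ _k : Fin N, (1 : ℝ) :=
            Finset.sum_le_sum fun k _ => hl1 k _ hi
        _ = N := by simp
    · obtain ⟨i, hi, hsum⟩ := hLc c hc
      rw [hsum (fun p t => t * K ((y - G p) / τ)) fun _ => zero_mul _]
      set t := c * a - (i : ℕ) with ht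
      obtain ⟨b, hb⟩ := hK N ((y - (i : ℕ) / a) / τ)
      have key : ∀ s ∈ Set.Icc (0 : ℝ) 1, |K ((y - ((i : ℕ) + s) / a) / τ) -
          ∑ j ∈ Finset.range N, b j * (s / (a * τ)) ^ j| ≤ M * (1 / 2) ^ N := by
        intro s hs
        have h1 := hb (s / (a * τ)) (by
          rw [abs_of_nonneg (div_nonneg hs.1 (by positivity)), div_le_iff₀ (by positivity)]
          have h2 : 1 ≤ ρ * τ * a := by rwa [div_le_iff₀ ha0'] at hacell
          calc s ≤ 1 := hs.2
            _ ≤ ρ * (a * τ) := by linarith)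
        have e : (y - (i : ℕ) / a) / τ - s / (a * τ) = (y - ((i : ℕ) + s) / a) / τ := by
          field_simp; ring
        rwa [e] at h1
      have hce : ((i : ℕ) + t) / a = c := by rw [ht]; field_simp; ring
      have h0 := key t hi
      rw [hce] at h0
      have hrep : ∑ j ∈ Finset.range N, b j * (t / (a * τ)) ^ j
          = ∑ k, l k t * ∑ j ∈ Finset.range N, b j * (x k / (a * τ)) ^ j := by
        simp_rw [Finset.mul_sum]
        rw [Finset.sum_comm]
        refine Finset.sum_congr rfl fun j hj => ?_
        rw [div_pow, ← hlsum t j (Finset.mem_range.1 hj), Finset.sum_div, Finset.mul_sum]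
        refine Finset.sum_congr rfl fun k _ => ?_
        rw [div_pow]; ring
      have e : K ((y - c) / τ) - ∑ k, l k t * K ((y - G (i, k)) / τ)
          = (K ((y - c) / τ) - ∑ j ∈ Finset.range N, b j * (t / (a * τ)) ^ j)
            - ∑ k, l k t * (K ((y - G (i, k)) / τ) -
              ∑ j ∈ Finset.range N, b j * (x k / (a * τ)) ^ j) := by
        rw [hrep]
        simp_rw [mul_sub, Finset.sum_sub_distrib]
        ring
      rw [e]
      have h2 : |∑ k, l k t * (K ((y - G (i, k)) / τ) -
              ∑ j ∈ Finset.range N, b j * (x k / (a * τ)) ^ j)| ≤ N * (M * (1 / 2) ^ N) := by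
        calc _ ≤ ∑ k, |l k t * (K ((y - G (i, k)) / τ) -
              ∑ j ∈ Finset.range N, b j * (x k / (a * τ)) ^ j)| := Finset.abs_sum_le_sum_abs _ _
          _ ≤ ∑ _k : Fin N, 1 * (M * (1 / 2) ^ N) := by
              refine Finset.sum_le_sum fun k _ => ?_
              rw [abs_mul]
              exact mul_le_mul (hl1 k t hi) (key (x k) (hx k)) (abs_nonneg _) zero_le_one
          _ = _ := by simp
      calc _ ≤ _ := abs_sub _ _
        _ ≤ M * (1 / 2) ^ N + N * (M * (1 / 2) ^ N) := add_le_add h0 h2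
        _ = _ := by ring
  obtain ⟨h1, h2, h3, h4⟩ := hgrid
  refine ⟨a * N, fun i => G (finProdFinEquiv.symm i), fun i => L (finProdFinEquiv.symm i), ?_,
    fun i => h1 _, fun i => h2 _, fun c hc => ?_, fun c hc y => ?_⟩
  · have h5 : (a : ℝ) ≤ 1 / (ρ * τ) + 1 := (Nat.ceil_lt_add_one (by positivity)).le
    have h6 : (a : ℝ) ≤ (ρ⁻¹ + 1) / τ := by
      refine h5.trans ?_
      rw [add_div, div_eq_mul_inv, mul_inv, one_mul, ← div_eq_mul_inv]
      gcongr
      exact (one_le_div hτ).2 hτ1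
    push_cast
    calc (a : ℝ) * N ≤ (ρ⁻¹ + 1) / τ * N := by gcongr
      _ = _ := by ring
  · rw [Equiv.sum_comp finProdFinEquiv.symm fun p => |L p c|]
    exact h3 c hc
  · rw [Equiv.sum_comp finProdFinEquiv.symm fun p => L p c * K ((y - G p) / τ)]
    exact h4 c hc y

/-! ### Combinations of product kernels on a grid -/

/-- Telescoping, one factor at a time. Errors are measured relative to the bounds `A i`, so that
localizing weights contained in `A i` survive in the product. -/
lemma abs_prod_sub_prod_le {ι : Type*} (s : Finset ι) {a b A : ι → ℝ} {e : ℝ}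
    (ha : ∀ i ∈ s, |a i| ≤ A i) (hb : ∀ i ∈ s, |b i| ≤ A i)
    (hab : ∀ i ∈ s, |a i - b i| ≤ e * A i) :
    |∏ i ∈ s, a i - ∏ i ∈ s, b i| ≤ s.card * e * ∏ i ∈ s, A i := by
  classical
  induction s using Finset.induction_on with
  | empty => simp
  | insert i s hi ih =>
    have ih' := ih (fun j hj => ha j (Finset.mem_insert_of_mem hj))
      (fun j hj => hb j (Finset.mem_insert_of_mem hj))
      (fun j hj => hab j (Finset.mem_insert_of_mem hj))
    have hP : |∏ j ∈ s, a j| ≤ ∏ j ∈ s, A j := by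
      rw [Finset.abs_prod]
      exact Finset.prod_le_prod (fun _ _ => abs_nonneg _)
        fun j hj => ha j (Finset.mem_insert_of_mem hj)
    have hb' := hb i (Finset.mem_insert_self _ _)
    have hab' := hab i (Finset.mem_insert_self _ _)
    rw [Finset.prod_insert hi, Finset.prod_insert hi, Finset.prod_insert hi,
      Finset.card_insert_of_notMem hi]
    have e1 : a i * ∏ j ∈ s, a j - b i * ∏ j ∈ s, b j
        = (a i - b i) * ∏ j ∈ s, a j + b i * (∏ j ∈ s, a j - ∏ j ∈ s, b j) := by ring
    rw [e1]
    calc _ ≤ |a i - b i| * |∏ j ∈ s, a j| + |b i| * |∏ j ∈ s, a j - ∏ j ∈ s, b j| := by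
          rw [← abs_mul, ← abs_mul]; exact abs_add_le _ _
      _ ≤ (e * A i) * ∏ j ∈ s, A j + A i * (s.card * e * ∏ j ∈ s, A j) := by
          refine add_le_add (mul_le_mul hab' hP (abs_nonneg _) ((abs_nonneg _).trans hab')) ?_
          exact mul_le_mul hb' ih' (abs_nonneg _) ((abs_nonneg _).trans hb')
      _ = _ := by push_cast; ring

lemma abs_prod_le_pow {ι : Type*} (s : Finset ι) {a : ι → ℝ} {A : ℝ}
    (ha : ∀ i ∈ s, |a i| ≤ A) : |∏ i ∈ s, a i| ≤ A ^ s.card := by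
  rw [Finset.abs_prod, ← Finset.prod_const]
  exact Finset.prod_le_prod (fun _ _ => abs_nonneg _) ha

/-- `f` is, up to `V * η`, a combination of kernels on the grid with coefficients of total size at
most `V`. -/
def IsMixture (K : ℝ → ℝ) (τ η : ℝ) {n : ℕ} (γ : Fin n → ℝ) (V : ℝ) (f : ℝ → ℝ) : Prop :=
  ∃ w : Fin n → ℝ, ∑ i, |w i| ≤ V ∧ ∀ x, |f x - ∑ i, w i * K ((x - γ i) / τ)| ≤ V * η

/-- The analogue of `IsMixture` for product kernels. -/
def IsProductMixture {ι : Type} [Fintype ι] [DecidableEq ι] (K : ℝ → ℝ) (τ η : ℝ) {n : ℕ}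
    (γ : Fin n → ℝ) (V : ℝ) (f : (ι → ℝ) → ℝ) : Prop :=
  ∃ w : (ι → Fin n) → ℝ, ∑ σ, |w σ| ≤ V ∧
    ∀ y, |f y - ∑ σ, w σ * ∏ j, K ((y j - γ (σ j)) / τ)| ≤ V * η

section

variable {K : ℝ → ℝ} {τ η V : ℝ} {n : ℕ} {γ : Fin n → ℝ} {l : Fin n → ℝ → ℝ}

lemma IsMixture.mono {V' : ℝ} {f : ℝ → ℝ} (h : IsMixture K τ η γ V f) (hV : V ≤ V')
    (hη : 0 ≤ η) : IsMixture K τ η γ V' f := by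
  obtain ⟨w, h1, h2⟩ := h
  exact ⟨w, h1.trans hV, fun x => (h2 x).trans (by gcongr)⟩

lemma IsGrid.isMixture_kernelSum (hγ : IsGrid K τ V η γ l) (hV : 1 ≤ V) (hη : 0 ≤ η) {I : Type}
    [Fintype I] {a c : I → ℝ} (hc : ∀ i, c i ∈ Set.Icc (0 : ℝ) 1) {A : ℝ} (hA : ∑ i, |a i| ≤ A) :
    IsMixture K τ η γ (V * A) (kernelSum K τ a c) := by
  have hA0 : 0 ≤ A := (Finset.sum_nonneg fun _ _ => abs_nonneg _).trans hA
  refine ⟨fun k => ∑ i, a i * l k (c i), ?_, fun x => ?_⟩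
  · calc ∑ k, |∑ i, a i * l k (c i)| ≤ ∑ k, ∑ i, |a i| * |l k (c i)| := by
          refine Finset.sum_le_sum fun k _ => (Finset.abs_sum_le_sum_abs _ _).trans (le_of_eq ?_)
          simp_rw [abs_mul]
      _ = ∑ i, |a i| * ∑ k, |l k (c i)| := by
          rw [Finset.sum_comm]; simp_rw [Finset.mul_sum]
      _ ≤ ∑ i, |a i| * V := by gcongr with i; exact hγ.sum_le _ (hc i)
      _ = V * ∑ i, |a i| := by rw [← Finset.sum_mul, mul_comm]
      _ ≤ V * A := by gcongr
  · have e : kernelSum K τ a c x - ∑ k, (∑ i, a i * l k (c i)) * K ((x - γ k) / τ)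
        = ∑ i, a i * (K ((x - c i) / τ) - ∑ k, l k (c i) * K ((x - γ k) / τ)) := by
      unfold kernelSum
      simp_rw [mul_sub, Finset.sum_sub_distrib, Finset.mul_sum, Finset.sum_mul]
      rw [Finset.sum_comm]
      simp_rw [mul_assoc]
    rw [e]
    calc _ ≤ ∑ i, |a i| * η := by
          refine (Finset.abs_sum_le_sum_abs _ _).trans (Finset.sum_le_sum fun i _ => ?_)
          rw [abs_mul]
          gcongr
          exact hγ.approx _ (hc i) x
      _ = (∑ i, |a i|) * η := by rw [Finset.sum_mul]
      _ ≤ A * η := by gcongr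
      _ ≤ V * A * η := by gcongr; exact le_mul_of_one_le_left hA0 hV

/-- A convolution is a continuous superposition of translates. Integrating the grid coefficients `l
k` against `g` makes it a finite combination, with no quadrature error beyond the accuracy of the
grid. -/
lemma IsGrid.isMixture_smear (hγ : IsGrid K τ V η γ l) (hKc : Continuous K) (hτ : 0 < τ)
    (hV : 1 ≤ V) (hη : 0 ≤ η) {g : ℝ → ℝ} (hg : Continuous g)
    (hg0 : ∀ x ∉ Set.Icc (0 : ℝ) 1, g x = 0) {A : ℝ} (hA : ∫ c, |g c| ≤ A) :
    IsMixture K τ η γ (V * (τ⁻¹ * A)) (smear K τ g) := by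
  have hgi : Integrable g := integrable_of_eq_zero_off_Icc hg hg0
  have hlg (k : Fin n) : Integrable fun c => l k c * g c := by
    refine (hgi.norm.const_mul V).mono' ((hγ.measurable k).mul hg.measurable).aestronglyMeasurable
      (.of_forall fun c => ?_)
    by_cases hc : c ∈ Set.Icc (0 : ℝ) 1
    · rw [norm_mul]
      gcongr
      exact (Finset.single_le_sum (f := fun k => |l k c|) (fun _ _ => abs_nonneg _)
        (Finset.mem_univ k)).trans (hγ.sum_le c hc)
    · rw [hg0 c hc, mul_zero, norm_zero, mul_zero]
  refine ⟨fun k => τ⁻¹ * ∫ c, l k c * g c, ?_, fun x => ?_⟩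
  · calc ∑ k, |τ⁻¹ * ∫ c, l k c * g c| ≤ ∑ k, τ⁻¹ * ∫ c, |l k c * g c| := by
          refine Finset.sum_le_sum fun k _ => ?_
          rw [abs_mul, abs_of_pos (inv_pos.2 hτ)]
          gcongr
          exact abs_integral_le_integral_abs
      _ = τ⁻¹ * ∫ c, ∑ k, |l k c * g c| := by
          rw [← Finset.mul_sum, integral_finsetSum _ fun k _ => (hlg k).abs]
      _ ≤ τ⁻¹ * ∫ c, V * |g c| := by
          refine mul_le_mul_of_nonneg_left (integral_mono (integrable_finsetSum _ fun k _ =>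
            (hlg k).abs) (hgi.abs.const_mul V) fun c => ?_) (inv_pos.2 hτ).le
          beta_reduce
          by_cases hc : c ∈ Set.Icc (0 : ℝ) 1
          · simp_rw [abs_mul]
            rw [← Finset.sum_mul]
            gcongr
            exact hγ.sum_le c hc
          · simp [hg0 c hc]
      _ ≤ τ⁻¹ * (V * A) := by rw [integral_const_mul]; gcongr
      _ = _ := by ring
  · have hint := integrable_kernel_mul hKc τ x hg hg0
    have e : smear K τ g x - ∑ k, (τ⁻¹ * ∫ c, l k c * g c) * K ((x - γ k) / τ)
        = τ⁻¹ * ∫ c, (K ((x - c) / τ) - ∑ k, l k c * K ((x - γ k) / τ)) * g c := by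
      have h1 (k : Fin n) : Integrable fun c => K ((x - γ k) / τ) * (l k c * g c) :=
        (hlg k).const_mul _
      have e1 : (fun c => (K ((x - c) / τ) - ∑ k, l k c * K ((x - γ k) / τ)) * g c)
          = fun c => K ((x - c) / τ) * g c - ∑ k, K ((x - γ k) / τ) * (l k c * g c) := by
        funext c
        rw [sub_mul, Finset.sum_mul]
        congr 1
        exact Finset.sum_congr rfl fun k _ => by ring
      rw [e1, integral_sub hint (integrable_finsetSum _ fun k _ => h1 k),
        integral_finsetSum _ fun k _ => h1 k, mul_sub, Finset.mul_sum]
      unfold smear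
      congr 1
      refine Finset.sum_congr rfl fun k _ => ?_
      rw [integral_const_mul]; ring
    have hA0 : 0 ≤ A := (integral_nonneg fun _ => abs_nonneg _).trans hA
    rw [e, abs_mul, abs_of_pos (inv_pos.2 hτ)]
    calc _ ≤ τ⁻¹ * ∫ c, η * |g c| := by
          gcongr
          rw [← Real.norm_eq_abs]
          refine norm_integral_le_of_norm_le (hgi.abs.const_mul η) (.of_forall fun c => ?_)
          by_cases hc : c ∈ Set.Icc (0 : ℝ) 1
          · rw [norm_mul, Real.norm_eq_abs, Real.norm_eq_abs]
            gcongr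
            exact hγ.approx c hc x
          · simp [hg0 c hc]
      _ ≤ τ⁻¹ * (η * A) := by rw [integral_const_mul]; gcongr
      _ = 1 * (τ⁻¹ * A) * η := by ring
      _ ≤ V * (τ⁻¹ * A) * η := by gcongr

variable {ι : Type} [Fintype ι] [DecidableEq ι]

lemma IsProductMixture.mono {V' : ℝ} {f : (ι → ℝ) → ℝ} (h : IsProductMixture K τ η γ V f)
    (hV : V ≤ V') (hη : 0 ≤ η) : IsProductMixture K τ η γ V' f := by
  obtain ⟨w, h1, h2⟩ := h
  exact ⟨w, h1.trans hV, fun x => (h2 x).trans (by gcongr)⟩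

lemma IsProductMixture.sum {A : Type*} (s : Finset A) {V : A → ℝ} {c : A → ℝ}
    {f : A → (ι → ℝ) → ℝ} (h : ∀ a ∈ s, IsProductMixture K τ η γ (V a) (f a)) :
    IsProductMixture K τ η γ (∑ a ∈ s, |c a| * V a) fun y => ∑ a ∈ s, c a * f a y := by
  have h' : ∀ a, ∃ w : (ι → Fin n) → ℝ, a ∈ s → ∑ σ, |w σ| ≤ V a ∧
      ∀ y, |f a y - ∑ σ, w σ * ∏ j, K ((y j - γ (σ j)) / τ)| ≤ V a * η := fun a => by
    by_cases ha : a ∈ s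
    · obtain ⟨w, hw⟩ := h a ha
      exact ⟨w, fun _ => hw⟩
    · exact ⟨fun _ => 0, fun h => absurd h ha⟩
  choose w hw using h'
  refine ⟨fun σ => ∑ a ∈ s, c a * w a σ, ?_, fun y => ?_⟩
  · calc _ ≤ ∑ σ, ∑ a ∈ s, |c a| * |w a σ| := by
          refine Finset.sum_le_sum fun σ _ => (Finset.abs_sum_le_sum_abs _ _).trans (le_of_eq ?_)
          simp_rw [abs_mul]
      _ = ∑ a ∈ s, |c a| * ∑ σ, |w a σ| := by
          rw [Finset.sum_comm]; simp_rw [Finset.mul_sum]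
      _ ≤ _ := by gcongr with a ha; exact (hw a ha).1
  · have e : ∑ a ∈ s, c a * f a y - ∑ σ, (∑ a ∈ s, c a * w a σ) * ∏ j, K ((y j - γ (σ j)) / τ)
        = ∑ a ∈ s, c a * (f a y - ∑ σ, w a σ * ∏ j, K ((y j - γ (σ j)) / τ)) := by
      simp_rw [mul_sub, Finset.sum_sub_distrib, Finset.mul_sum, Finset.sum_mul]
      congr 1
      rw [Finset.sum_comm]
      simp_rw [mul_assoc]
    rw [e, Finset.sum_mul]
    refine (Finset.abs_sum_le_sum_abs _ _).trans (Finset.sum_le_sum fun a ha => ?_)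
    rw [abs_mul, mul_assoc]
    gcongr
    exact (hw a ha).2 y

/-- Expanding the product of the one-dimensional combinations gives the coefficients `∏ j, w j (σ
j)`. As `η ≤ 1`, both the factors and their approximants are at most `V * (MK + 1)`, and
`abs_prod_sub_prod_le` applies. -/
lemma IsMixture.prod {MK : ℝ} (hMK : ∀ x, |K x| ≤ MK) (hη : 0 ≤ η) (hη1 : η ≤ 1)
    {f : ι → ℝ → ℝ} (h : ∀ j, IsMixture K τ η γ V (f j)) :
    IsProductMixture K τ (Fintype.card ι * η * (MK + 1) ^ Fintype.card ι) γ
      (V ^ Fintype.card ι) fun y => ∏ j, f j (y j) := by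
  choose w hw1 hw2 using h
  have hMK0 : 0 ≤ MK := (abs_nonneg _).trans (hMK 0)
  refine ⟨fun σ => ∏ j, w j (σ j), ?_, fun y => ?_⟩
  · simp_rw [Finset.abs_prod]
    rw [← Fintype.prod_sum fun j i => |w j i|, ← Finset.card_univ, ← Finset.prod_const]
    exact Finset.prod_le_prod (fun j _ => Finset.sum_nonneg fun _ _ => abs_nonneg _)
      fun j _ => hw1 j
  · have e : ∑ σ : ι → Fin n, (∏ j, w j (σ j)) * ∏ j, K ((y j - γ (σ j)) / τ)
        = ∏ j, ∑ i, w j i * K ((y j - γ i) / τ) := by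
      rw [Fintype.prod_sum fun j i => w j i * K ((y j - γ i) / τ)]
      simp_rw [Finset.prod_mul_distrib]
    rw [e]
    have hb (j : ι) : |∑ i, w j i * K ((y j - γ i) / τ)| ≤ V * MK := by
      calc _ ≤ ∑ i, |w j i| * MK := by
            refine (Finset.abs_sum_le_sum_abs _ _).trans (Finset.sum_le_sum fun i _ => ?_)
            rw [abs_mul]
            gcongr
            exact hMK _
        _ = (∑ i, |w j i|) * MK := by rw [Finset.sum_mul]
        _ ≤ V * MK := by gcongr; exact hw1 j
    have key := abs_prod_sub_prod_le (Finset.univ : Finset ι) (a := fun j => f j (y j))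
      (b := fun j => ∑ i, w j i * K ((y j - γ i) / τ)) (A := fun _ => V * (MK + 1)) (e := η)
      (fun j _ => ?_) (fun j _ => ?_) (fun j _ => ?_)
    · refine key.trans (le_of_eq ?_)
      rw [Finset.prod_const, Finset.card_univ, mul_pow]
      ring
    · have hV0 : 0 ≤ V := (Finset.sum_nonneg fun _ _ => abs_nonneg _).trans (hw1 j)
      have h1 := hw2 j (y j)
      calc |f j (y j)| ≤ |∑ i, w j i * K ((y j - γ i) / τ)| +
            |f j (y j) - ∑ i, w j i * K ((y j - γ i) / τ)| := by
            have := abs_add_le (∑ i, w j i * K ((y j - γ i) / τ))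
              (f j (y j) - ∑ i, w j i * K ((y j - γ i) / τ))
            rwa [add_sub_cancel] at this
        _ ≤ V * MK + V * 1 := add_le_add (hb j) (h1.trans (by gcongr))
        _ = _ := by ring
    · have hV0 : 0 ≤ V := (Finset.sum_nonneg fun _ _ => abs_nonneg _).trans (hw1 j)
      exact (hb j).trans (by gcongr; linarith)
    · have hV0 : 0 ≤ V := (Finset.sum_nonneg fun _ _ => abs_nonneg _).trans (hw1 j)
      refine (hw2 j (y j)).trans ?_
      rw [mul_comm η]
      gcongr
      exact le_mul_of_one_le_right hV0 (by linarith)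

end

/-! ### Multilevel approximation of product functions -/

/-- The function vanishes near one of the ends of the unit interval. -/
def VanishesNearEnd (N : ℕ) (u : ℕ → ℝ → ℝ) : Prop :=
  (∀ m ≤ N, ∀ x, 5 / 6 < x → u m x = 0) ∨ ∀ m ≤ N, ∀ x, x < 1 / 6 → u m x = 0

lemma Controlled.mono {N : ℕ} {s s' B B' : ℝ} {w : ℝ → ℝ} {u : ℕ → ℝ → ℝ}
    (hu : Controlled N s B w u) (hs' : 0 < s') (hs : s' ≤ s) (hB : B ≤ B') (hw : ∀ x, 0 ≤ w x) :
    Controlled N s' B' w u where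
  chain := hu.chain
  bound m hm x := by
    have h := hu.bound m hm x
    have hwx := hw x
    calc |u m x| * s' ^ m ≤ |u m x| * s ^ m := by gcongr
      _ ≤ B * w x := h
      _ ≤ B' * w x := by gcongr

/-- One pass in one variable at the bandwidth `s * q`. The part `v` is resolved with relative error
`q ^ N`. The part `r` is left for a finer bandwidth, and it is of the good kind, vanishing outside
`[0,1]`. A function that is already good is resolved completely by deconvolution (`v = u`, `r = 0`);
otherwise the jet at an endpoint is matched. -/
theorem exists_level {K : ℝ → ℝ} (hK : IsKernel K) (N : ℕ) :
    ∃ D : ℝ, 1 ≤ D ∧ ∀ (u : ℕ → ℝ → ℝ) (B s q s₀ x₀ V η : ℝ) (n : ℕ) (γ : Fin n → ℝ)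
      (l : Fin n → ℝ → ℝ), 0 ≤ B → 0 < q → q ≤ 1 → 0 < s → s ≤ s₀ → s ≤ 1 → 1 ≤ V → 0 ≤ η →
      IsGrid K (s * q) V η γ l → Controlled N s B (peak x₀ s₀) u →
      (VanishesOff N u ∨ VanishesNearEnd N u) →
      ∃ (Φ : ℝ → ℝ) (v r : ℕ → ℝ → ℝ),
        IsMixture K (s * q) η γ (D * B * (V * (s₀ / (s * q)))) Φ ∧
        (∀ x ∈ Set.Icc (0 : ℝ) 1, u 0 x = r 0 x + v 0 x) ∧
        Controlled N (s * q) (D * B) (peak x₀ s₀) v ∧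
        Controlled N (s * q) (D * B) (peak x₀ s₀) r ∧ VanishesOff N r ∧
        (∀ x ∈ Set.Icc (0 : ℝ) 1, |v 0 x - Φ x| ≤ D * B * q ^ N * peak x₀ s₀ x) ∧
        (VanishesOff N v ∨ VanishesNearEnd N v) ∧
        (VanishesOff N u → VanishesOff N v ∧ ∀ x, r 0 x = 0) := by
  obtain ⟨Cg, hCg, hgood⟩ := exists_smear_approx hK N
  obtain ⟨CL, hCL, hleft⟩ := exists_left_split hK N
  obtain ⟨CR, hCR, hright⟩ := exists_right_split hK N
  set D := 1 + 4 * Cg + CL + CR with hD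
  refine ⟨D, by linarith, fun u B s q s₀ x₀ V η n γ l hB hq hq1 hs hss₀ hs1 hV hη hγ hu htype => ?_⟩
  have hτ : 0 < s * q := mul_pos hs hq
  have hτs : s * q ≤ s := mul_le_of_le_one_right hs.le hq1
  have hτq : s * q ≤ q := mul_le_of_le_one_left hq.le hs1
  have hτs₀ := hτs.trans hss₀
  have hs₀ : 0 < s₀ := hs.trans_le hss₀
  have hratio : 1 ≤ s₀ / (s * q) := (one_le_div hτ).2 hτs₀
  have hw (x : ℝ) : 0 ≤ peak x₀ s₀ x := peak_nonneg _ _ x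
  have hBD : B ≤ D * B := le_mul_of_one_le_left hB (by linarith)
  by_cases h0 : VanishesOff N u
  · obtain ⟨g, hg, hg0, hgb, hga⟩ := hgood u B s (s * q) s₀ x₀ hB hτ hτs hτs₀ hu h0
    refine ⟨smear K (s * q) g, u, fun _ _ => 0, ?_, fun x _ => (zero_add _).symm,
      hu.mono hτ hτs hBD hw, ⟨fun _ _ _ => hasDerivAt_const _ _, fun m hm x => ?_⟩,
      fun _ _ _ _ => rfl, fun x hx => ?_, Or.inl h0, fun _ => ⟨h0, fun _ => rfl⟩⟩
    · have hA : ∫ c, |g c| ≤ Cg * B * (s₀ * Real.pi) := by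
        obtain ⟨hi, he⟩ := integral_peak x₀ hs₀
        rw [← he, ← integral_const_mul]
        exact integral_mono (integrable_of_eq_zero_off_Icc hg hg0).abs (hi.const_mul _) hgb
      refine (hγ.isMixture_smear hK.continuous hτ hV hη hg hg0 hA).mono ?_ hη
      calc V * ((s * q)⁻¹ * (Cg * B * (s₀ * Real.pi)))
          = (Cg * Real.pi) * B * (V * (s₀ / (s * q))) := by ring
        _ ≤ (Cg * 4) * B * (V * (s₀ / (s * q))) := by gcongr; exact Real.pi_le_four
        _ ≤ _ := by gcongr; linarith
    · rw [abs_zero, zero_mul]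
      have := hw x
      positivity
    · have h1 := hga x
      rw [mul_div_cancel_left₀ _ hs.ne'] at h1
      refine h1.trans ?_
      have := hw x
      gcongr
      linarith
  · have hend := htype.resolve_left h0
    have main : ∃ E : ℝ, 0 ≤ E ∧ E ≤ D ∧ ∃ (I : Type) (_ : Fintype I) (a c : I → ℝ)
        (v r : ℕ → ℝ → ℝ), (∀ i, c i ∈ Set.Icc (0 : ℝ) 1) ∧ ∑ i, |a i| ≤ E * B ∧
        (∀ x ∈ Set.Icc (0 : ℝ) 1, u 0 x = v 0 x + r 0 x) ∧
        Controlled N (s * q) (E * B) (peak x₀ s₀) v ∧ VanishesNearEnd N v ∧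
        Controlled N (s * q) (E * B) (peak x₀ s₀) r ∧ VanishesOff N r ∧
        ∀ x ∈ Set.Icc (0 : ℝ) 1, |v 0 x - kernelSum K (s * q) a c x| ≤
          E * B * (s * q) ^ N * peak x₀ s₀ x := by
      rcases hend with hend | hend
      · obtain ⟨I, hI, a, c, v, r, h1, h2, h3, h4, h5, h6, h7, h8⟩ :=
          hleft u B s (s * q) s₀ x₀ hB hτ hτs hτs₀ (hτs.trans hs1) hu hend
        exact ⟨CL, hCL.le, by linarith, I, hI, a, c, v, r, h1, h2, h3, h4, Or.inl h5, h6, h7, h8⟩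
      · obtain ⟨I, hI, a, c, v, r, h1, h2, h3, h4, h5, h6, h7, h8⟩ :=
          hright u B s (s * q) s₀ x₀ hB hτ hτs hτs₀ (hτs.trans hs1) hu hend
        exact ⟨CR, hCR.le, by linarith, I, hI, a, c, v, r, h1, h2, h3, h4, Or.inr h5, h6, h7, h8⟩
    obtain ⟨E, hE0, hED, I, hI, a, c, v, r, h1, h2, h3, h4, h5, h6, h7, h8⟩ := main
    have hEB : E * B ≤ D * B := by gcongr
    refine ⟨kernelSum K (s * q) a c, v, r, ?_, fun x hx => by rw [h3 x hx, add_comm],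
      h4.mono hτ le_rfl hEB hw, h6.mono hτ le_rfl hEB hw, h7, fun x hx => ?_, Or.inr h5,
      fun h => absurd h h0⟩
    · refine (hγ.isMixture_kernelSum hV hη h1 h2).mono ?_ hη
      calc V * (E * B) = E * B * (V * 1) := by ring
        _ ≤ D * B * (V * (s₀ / (s * q))) := by gcongr
    · refine (h8 x hx).trans ?_
      have := hw x
      gcongr

/-- A product of controlled functions is approximated by mixtures at several bandwidths; `G` collects
the coordinates along which the function extends by zero. -/
theorem exists_multilevel {K : ℝ → ℝ} (hK : IsKernel K) {MK : ℝ} (hMK : ∀ x, |K x| ≤ MK) (N : ℕ)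
    (ι : Type) [Fintype ι] [DecidableEq ι] (b : ℕ) :
    ∀ B : ℝ, 0 ≤ B → ∃ C > 0, ∀ (s q s₀ V η : ℝ) (x₀ : ι → ℝ) (u : ι → ℕ → ℝ → ℝ) (G : Finset ι)
      (n : ℕ → ℕ) (γ : ∀ k, Fin (n k) → ℝ) (l : ∀ k, Fin (n k) → ℝ → ℝ),
      0 < q → q ≤ 1 → 0 < s → s ≤ s₀ → s ≤ 1 → 1 ≤ V → 0 ≤ η → η ≤ 1 →
      (∀ k < b, IsGrid K (s * q ^ (k + 1)) V η (γ k) (l k)) →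
      (∀ j, Controlled N s B (peak (x₀ j) s₀) (u j)) →
      (∀ j, VanishesOff N (u j) ∨ VanishesNearEnd N (u j)) → (∀ j ∈ G, VanishesOff N (u j)) →
      Gᶜ.card < b →
      ∃ P : ℕ → (ι → ℝ) → ℝ,
        (∀ k < b, IsProductMixture K (s * q ^ (k + 1))
          (Fintype.card ι * η * (MK + 1) ^ Fintype.card ι) (γ k)
          (C * (V * (s₀ / (s * q ^ (k + 1)))) ^ Fintype.card ι) (P k)) ∧
        ∀ y : ι → ℝ, (∀ j, y j ∈ Set.Icc (0 : ℝ) 1) →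
          |∏ j, u j 0 (y j) - ∑ k ∈ Finset.range b, P k y| ≤
            C * q ^ N * ∏ j, peak (x₀ j) s₀ (y j) := by
  obtain ⟨D, hD, hlevel⟩ := exists_level hK N
  have hMK0 : 0 ≤ MK := (abs_nonneg _).trans (hMK 0)
  set d := Fintype.card ι with hd
  induction b with
  | zero =>
    exact fun B _ => ⟨1, one_pos, fun _ _ _ _ _ _ _ _ _ _ _ _ _ _ _ _ _ _ _ _ _ _ _ h =>
      absurd h (Nat.not_lt_zero _)⟩
  | succ b ih =>
    intro B hB
    have hDB : 0 ≤ D * B := by positivity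
    obtain ⟨C', hC', ih⟩ := ih (D * B) hDB
    set C := 2 ^ d * C' + (D * B) ^ d + d * (2 * (D * B)) ^ d with hC
    refine ⟨C, by positivity, fun s q s₀ V η x₀ u G n γ l hq hq1 hs hss₀ hs1 hV hη hη1 hγ hu
      htype hG hcard => ?_⟩
    have hτ : 0 < s * q := mul_pos hs hq
    have hτs : s * q ≤ s := mul_le_of_le_one_right hs.le hq1
    have hs₀ : 0 < s₀ := hs.trans_le hss₀
    have hqN : q ^ N ≤ 1 := pow_le_one₀ hq.le hq1
    have hpeak (y : ι → ℝ) : 0 ≤ ∏ j, peak (x₀ j) s₀ (y j) :=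
      Finset.prod_nonneg fun j _ => peak_nonneg _ _ _
    have hγ0 : IsGrid K (s * q) V η (γ 0) (l 0) := by
      have := hγ 0 (Nat.succ_pos b)
      rwa [zero_add, pow_one] at this
    choose Φ v r hΦ huv hv hr hr0 hvΦ hvt hvG using fun j =>
      hlevel (u j) B s q s₀ (x₀ j) V η (n 0) (γ 0) (l 0) hB hq hq1 hs hss₀ hs1 hV hη hγ0 (hu j)
        (htype j)
    -- In the expansion of `∏ (r j + v j)`, `A` is the set of factors taken from `r`. For `A = ∅`
    -- the product is approximated at the present bandwidth by `∏ Φ j`. Sets meeting `G` contribute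
    -- nothing, since `r j = 0` there. Every other `A` enlarges the set of good coordinates to `G ∪
    -- A`, so the complement shrinks strictly and the induction on `b` applies with the scale `s *
    -- q`.
    set S := Gᶜ.powerset.erase ∅ with hS
    have hScard : (S.card : ℝ) ≤ 2 ^ d := by
      have h1 : S.card ≤ 2 ^ d := by
        calc S.card ≤ Gᶜ.powerset.card := Finset.card_erase_le
          _ = 2 ^ Gᶜ.card := Finset.card_powerset _
          _ ≤ 2 ^ d := Nat.pow_le_pow_right two_pos (Finset.card_le_univ _)
      exact_mod_cast h1
    set U : Finset ι → ι → ℕ → ℝ → ℝ := fun A j => if j ∈ A then r j else v j with hU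
    have hPA : ∀ A : Finset ι, ∃ P : ℕ → (ι → ℝ) → ℝ, A ∈ S →
        (∀ k < b, IsProductMixture K (s * q ^ (k + 1 + 1)) (d * η * (MK + 1) ^ d) (γ (k + 1))
          (C' * (V * (s₀ / (s * q ^ (k + 1 + 1)))) ^ d) (P k)) ∧
        ∀ y : ι → ℝ, (∀ j, y j ∈ Set.Icc (0 : ℝ) 1) →
          |∏ j, U A j 0 (y j) - ∑ k ∈ Finset.range b, P k y| ≤
            C' * q ^ N * ∏ j, peak (x₀ j) s₀ (y j) := by
      intro A
      by_cases hA : A ∈ S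
      swap
      · exact ⟨fun _ _ => 0, fun h => absurd h hA⟩
      obtain ⟨hA0, hAG⟩ := Finset.mem_erase.1 hA
      rw [Finset.mem_powerset] at hAG
      have hlev (k : ℕ) : s * q * q ^ (k + 1) = s * q ^ (k + 1 + 1) := by ring
      obtain ⟨P, hP1, hP2⟩ := ih (s * q) q s₀ V η x₀ (U A) (G ∪ A) (fun k => n (k + 1))
        (fun k => γ (k + 1)) (fun k => l (k + 1)) hq hq1 hτ (hτs.trans hss₀) (hτs.trans hs1) hV hη
        hη1 (fun k hk => by rw [hlev]; exact hγ (k + 1) (by omega))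
        (fun j => by simp only [hU]; split_ifs; exacts [hr j, hv j])
        (fun j => by simp only [hU]; split_ifs; exacts [Or.inl (hr0 j), hvt j])
        (fun j hj => by
          simp only [hU]
          split_ifs with h
          · exact hr0 j
          · exact (hvG j (hG j ((Finset.mem_union.1 hj).resolve_right h))).1)
        (by
          rw [Finset.compl_union, ← Finset.sdiff_eq_inter_compl]
          have h1 := Finset.card_sdiff_add_card_eq_card hAG
          have h2 : 0 < A.card := Finset.card_pos.2 (Finset.nonempty_iff_ne_empty.2 hA0)
          omega)
      simp_rw [hlev] at hP1
      exact ⟨P, fun _ => ⟨hP1, hP2⟩⟩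
    choose P hP using hPA
    refine ⟨fun k y => match k with
      | 0 => ∏ j, Φ j (y j)
      | k + 1 => ∑ A ∈ S, 1 * P A k y, fun k hk => ?_, fun y hy => ?_⟩
    · have hη' : 0 ≤ d * η * (MK + 1) ^ d := by positivity
      rcases k with _ | k
      · rw [zero_add, pow_one]
        refine (IsMixture.prod hMK hη hη1 hΦ).mono ?_ hη'
        rw [← hd, mul_pow]
        gcongr
        rw [hC]
        have : 0 ≤ (d : ℝ) * (2 * (D * B)) ^ d := by positivity
        have : 0 ≤ 2 ^ d * C' := by positivity
        linarith
      · refine (IsProductMixture.sum S (c := fun _ => 1) fun A hA =>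
          ((hP A hA).1 k (by omega))).mono ?_ hη'
        rw [abs_one, one_mul, Finset.sum_const, nsmul_eq_mul, ← mul_assoc]
        gcongr
        calc (S.card : ℝ) * C' ≤ 2 ^ d * C' := by gcongr
          _ ≤ C := by
            rw [hC, add_assoc]
            exact le_add_of_nonneg_right (by positivity)
    · have hexp : ∏ j, u j 0 (y j) = ∏ j, v j 0 (y j) + ∑ A ∈ S, ∏ j, U A j 0 (y j) := by
        have h1 : ∀ A : Finset ι, ∏ j, U A j 0 (y j) =
            (∏ j ∈ A, r j 0 (y j)) * ∏ j ∈ Finset.univ \ A, v j 0 (y j) := by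
          intro A
          have := Finset.prod_piecewise Finset.univ A (fun j => r j 0 (y j)) fun j => v j 0 (y j)
          rw [Finset.univ_inter] at this
          rw [← this]
          refine Finset.prod_congr rfl fun j _ => ?_
          by_cases h : j ∈ A <;> simp [hU, h, Finset.piecewise]
        have h2 : ∏ j, v j 0 (y j) = ∏ j, U ∅ j 0 (y j) := by simp [hU]
        rw [h2, hS, Finset.add_sum_erase _ (fun A => ∏ j, U A j 0 (y j))
          (Finset.empty_mem_powerset _)]
        rw [Finset.prod_congr rfl fun j _ => huv j (y j) (hy j), Finset.prod_add,
          Finset.powerset_univ]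
        simp_rw [h1]
        refine (Finset.sum_subset (Finset.subset_univ _) fun A _ hA => ?_).symm
        rw [Finset.mem_powerset, Finset.not_subset] at hA
        obtain ⟨j, hjA, hjG⟩ := hA
        rw [Finset.mem_compl, not_not] at hjG
        rw [Finset.prod_eq_zero hjA ((hvG j (hG j hjG)).2 _), zero_mul]
      have hmain : |∏ j, v j 0 (y j) - ∏ j, Φ j (y j)| ≤
          d * (2 * (D * B)) ^ d * q ^ N * ∏ j, peak (x₀ j) s₀ (y j) := by
        have hvb (j : ι) : |v j 0 (y j)| ≤ D * B * peak (x₀ j) s₀ (y j) := by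
          simpa using (hv j).bound 0 (Nat.zero_le _) (y j)
        refine (abs_prod_sub_prod_le Finset.univ (e := q ^ N)
          (A := fun j => 2 * (D * B) * peak (x₀ j) s₀ (y j)) (fun j _ => ?_) (fun j _ => ?_)
          fun j _ => ?_).trans (le_of_eq ?_)
        · have := peak_nonneg (x₀ j) s₀ (y j)
          have : 0 ≤ D * B * peak (x₀ j) s₀ (y j) := by positivity
          exact (hvb j).trans (by linarith)
        · have h3 := hvΦ j (y j) (hy j)
          have h4 := peak_nonneg (x₀ j) s₀ (y j)
          have h5 : D * B * q ^ N * peak (x₀ j) s₀ (y j) ≤ D * B * 1 * peak (x₀ j) s₀ (y j) := by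
            gcongr
          calc |Φ j (y j)| ≤ |v j 0 (y j)| + |v j 0 (y j) - Φ j (y j)| := by
                have := abs_sub (v j 0 (y j)) (v j 0 (y j) - Φ j (y j))
                rwa [sub_sub_cancel] at this
            _ ≤ _ := by linarith [hvb j]
        · refine (hvΦ j (y j) (hy j)).trans ?_
          have h4 := peak_nonneg (x₀ j) s₀ (y j)
          have h5 : 0 ≤ D * B * q ^ N * peak (x₀ j) s₀ (y j) := by positivity
          linarith
        · rw [Finset.prod_mul_distrib, Finset.prod_const, Finset.card_univ]
          ring
      have hrest : |∑ A ∈ S, (∏ j, U A j 0 (y j) - ∑ k ∈ Finset.range b, P A k y)| ≤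
          2 ^ d * C' * q ^ N * ∏ j, peak (x₀ j) s₀ (y j) := by
        have := hpeak y
        calc _ ≤ ∑ _A ∈ S, C' * q ^ N * ∏ j, peak (x₀ j) s₀ (y j) :=
              (Finset.abs_sum_le_sum_abs _ _).trans (Finset.sum_le_sum fun A hA =>
                (hP A hA).2 y hy)
          _ = S.card * (C' * q ^ N * ∏ j, peak (x₀ j) s₀ (y j)) := by
              rw [Finset.sum_const, nsmul_eq_mul]
          _ ≤ 2 ^ d * (C' * q ^ N * ∏ j, peak (x₀ j) s₀ (y j)) := by gcongr
          _ = _ := by ring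
      rw [Finset.sum_range_succ']
      simp only [one_mul]
      rw [Finset.sum_comm, hexp]
      have e : ∏ j, v j 0 (y j) + ∑ A ∈ S, ∏ j, U A j 0 (y j) -
            (∑ A ∈ S, ∑ k ∈ Finset.range b, P A k y + ∏ j, Φ j (y j))
          = (∏ j, v j 0 (y j) - ∏ j, Φ j (y j)) +
            ∑ A ∈ S, (∏ j, U A j 0 (y j) - ∑ k ∈ Finset.range b, P A k y) := by
        rw [Finset.sum_sub_distrib]; ring
      rw [e]
      have h6 : 0 ≤ (D * B) ^ d * q ^ N * ∏ j, peak (x₀ j) s₀ (y j) :=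
        mul_nonneg (by positivity) (hpeak y)
      calc _ ≤ _ := abs_add_le _ _
        _ ≤ _ := add_le_add hmain hrest
        _ ≤ _ := le_add_of_nonneg_right h6
        _ = _ := by rw [hC]; ring

/-! ### Tensor product interpolation -/

/-- Interpolation nodes in the unit interval, with the basis of interpolation polynomials. -/
structure IsInterpolation {n : ℕ} (x : Fin n → ℝ) (a : Fin n → Fin n → ℝ) : Prop where
  mem : ∀ i, x i ∈ Set.Icc (0 : ℝ) 1
  reproduces : ∀ t, ∀ j < n, ∑ i, polyVal (a i) t * x i ^ j = t ^ j

/-- The interpolation at the nodes `z j + h * x i` recovers the function `p`. -/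
def Reproduced {ι : Type} [Fintype ι] [DecidableEq ι] {n : ℕ} (x : Fin n → ℝ) (a : Fin n → Fin n → ℝ)
    (p : (ι → ℝ) → ℝ) : Prop :=
  ∀ (z y : ι → ℝ) (h : ℝ), h ≠ 0 →
    ∑ ν : ι → Fin n, p (fun j => z j + h * x (ν j)) * ∏ j, polyVal (a (ν j)) ((y j - z j) / h) = p y

section

variable {ι : Type} [Fintype ι] [DecidableEq ι] {n : ℕ} {x : Fin n → ℝ} {a : Fin n → Fin n → ℝ}

lemma Reproduced.sum {A : Type*} (s : Finset A) (c : A → ℝ) {p : A → (ι → ℝ) → ℝ}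
    (hp : ∀ i ∈ s, Reproduced x a (p i)) : Reproduced x a fun y => ∑ i ∈ s, c i * p i y := by
  intro z y h hh
  simp_rw [Finset.sum_mul]
  rw [Finset.sum_comm]
  refine Finset.sum_congr rfl fun i hi => ?_
  rw [← hp i hi z y h hh, Finset.mul_sum]
  simp_rw [mul_assoc]

lemma IsInterpolation.reproduces_pow (hx : IsInterpolation x a) {m : ℕ} (hm : m < n) (b z t h : ℝ)
    (hh : h ≠ 0) :
    ∑ i, (z + h * x i - b) ^ m * polyVal (a i) ((t - z) / h) = (t - b) ^ m := by
  have e (i : Fin n) : (z + h * x i - b) ^ m = ∑ k ∈ Finset.range (m + 1),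
      (h ^ k * (z - b) ^ (m - k) * (m.choose k)) * x i ^ k := by
    rw [show z + h * x i - b = h * x i + (z - b) by ring, add_pow]
    refine Finset.sum_congr rfl fun k _ => ?_
    rw [mul_pow]; ring
  simp_rw [e, Finset.sum_mul]
  rw [Finset.sum_comm]
  have e2 : (t - b) ^ m = ∑ k ∈ Finset.range (m + 1),
      (h ^ k * (z - b) ^ (m - k) * (m.choose k)) * ((t - z) / h) ^ k := by
    rw [show t - b = h * ((t - z) / h) + (z - b) by field_simp; ring, add_pow]
    refine Finset.sum_congr rfl fun k _ => ?_
    rw [mul_pow]; ring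
  rw [e2]
  refine Finset.sum_congr rfl fun k hk => ?_
  rw [← hx.reproduces ((t - z) / h) k (by have := Finset.mem_range.1 hk; omega), Finset.mul_sum]
  refine Finset.sum_congr rfl fun i _ => ?_
  ring

lemma reproduced_prod {p : ι → ℝ → ℝ}
    (hp : ∀ j z t h, h ≠ 0 →
      ∑ i, p j (z + h * x i) * polyVal (a i) ((t - z) / h) = p j t) :
    Reproduced x a fun y : ι → ℝ => ∏ j, p j (y j) := by
  intro z y h hh
  simp_rw [← Finset.prod_mul_distrib]
  rw [← Fintype.prod_sum fun j i => p j (z j + h * x i) * polyVal (a i) ((y j - z j) / h)]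
  exact Finset.prod_congr rfl fun j _ => hp j _ _ _ hh

/-- Collecting equal coordinates, each variable occurs with a power at most `m < n`, and tensor
interpolation is exact factor by factor. -/
lemma IsInterpolation.reproduced_monomial (hx : IsInterpolation x a) {m : ℕ}
    (hm : m < n) (i : Fin m → ι) (b : ι → ℝ) :
    Reproduced x a fun y : ι → ℝ => ∏ r, (y (i r) - b (i r)) := by
  have e (y : ι → ℝ) : ∏ r, (y (i r) - b (i r))
      = ∏ j, (y j - b j) ^ (Finset.univ.filter fun r => i r = j).card := by
    rw [← Finset.prod_fiberwise Finset.univ i fun r => y (i r) - b (i r)]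
    refine Finset.prod_congr rfl fun j _ => ?_
    rw [← Finset.prod_const]
    exact Finset.prod_congr rfl fun r hr => by rw [(Finset.mem_filter.1 hr).2]
  simp_rw [e]
  refine reproduced_prod (p := fun j t => (t - b j) ^
    (Finset.univ.filter fun r => i r = j).card) fun j z t h hh => hx.reproduces_pow ?_ _ _ _ _ hh
  calc _ ≤ (Finset.univ : Finset (Fin m)).card := Finset.card_filter_le _ _
    _ = m := by simp
    _ < n := hm

lemma IsInterpolation.reproduces_polyVal (hx : IsInterpolation x a) (c : Fin n → ℝ) (z t h e w : ℝ)
    (hh : h ≠ 0) :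
    ∑ i, polyVal c ((z + h * x i - w) * e) * polyVal (a i) ((t - z) / h)
      = polyVal c ((t - w) * e) := by
  have e1 (r : ℝ) : polyVal c r = ∑ j : Fin n, c j * r ^ (j : ℕ) := rfl
  simp_rw [e1, Finset.sum_mul]
  rw [Finset.sum_comm]
  refine Finset.sum_congr rfl fun j _ => ?_
  rw [mul_pow, ← hx.reproduces_pow j.2 w z t h hh, Finset.sum_mul, Finset.mul_sum]
  refine Finset.sum_congr rfl fun i _ => ?_
  rw [mul_pow]; ring

end

/-- Near every point of the unit cube `f` is approximated to order `α` by a function that the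
interpolation recovers. -/
def LocallyReproduced {ι : Type} [Fintype ι] [DecidableEq ι] {n : ℕ} (x : Fin n → ℝ) (a : Fin n → Fin n → ℝ)
    (α C : ℝ) (f : (ι → ℝ) → ℝ) : Prop :=
  ∀ z : ι → ℝ, (∀ j, z j ∈ Set.Icc (0 : ℝ) 1) → ∃ T, Reproduced x a T ∧
    ∀ y : ι → ℝ, (∀ j, y j ∈ Set.Icc (0 : ℝ) 1) → ∀ δ, (∀ j, |y j - z j| ≤ δ) → 0 ≤ δ →
      |f y - T y| ≤ C * δ ^ α

/-! ### Interpolation on dyadic cells -/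

/-- The left end of the dyadic cell at the dyadic point `i / 2 ^ k`, times `2 ^ k`. -/
def cellStart (k : ℕ) (i : ℤ) : ℤ := max 0 (min i (2 ^ k - 1))

lemma cellStart_nonneg (k : ℕ) (i : ℤ) : 0 ≤ cellStart k i := le_max_left _ _

/-- The clamp at `2 ^ k - 1` gives the dyadic point `1` the last cell, so that no interpolation node
leaves the cube. -/
lemma cellStart_lt (k : ℕ) (i : ℤ) : cellStart k i + 1 ≤ 2 ^ k := by
  have : (0 : ℤ) < 2 ^ k := by positivity
  unfold cellStart
  omega

/-- The interpolation node of index `ν` for the dyadic point `i / 2 ^ k`. -/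
noncomputable def dyadicNode {n : ℕ} (x : Fin n → ℝ) (k : ℕ) (i : ℤ) (ν : Fin n) : ℝ :=
  (cellStart k i + x ν) / 2 ^ k

/-- The interpolation of `f` on the dyadic cell at `i / 2 ^ k`. -/
noncomputable def interpolant {ι : Type} [Fintype ι] [DecidableEq ι] {n : ℕ} (x : Fin n → ℝ)
    (a : Fin n → Fin n → ℝ) (k : ℕ) (i : ι → ℤ) (f : (ι → ℝ) → ℝ) (y : ι → ℝ) : ℝ :=
  ∑ ν : ι → Fin n, f (fun j => dyadicNode x k (i j) (ν j)) *
    ∏ j, polyVal (a (ν j)) (2 ^ k * y j - cellStart k (i j))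

section

variable {ι : Type} [Fintype ι] [DecidableEq ι] {n : ℕ} {x : Fin n → ℝ} {a : Fin n → Fin n → ℝ}

lemma IsInterpolation.dyadicNode_mem (hx : IsInterpolation x a) (k : ℕ) (i : ℤ) (ν : Fin n) :
    dyadicNode x k i ν ∈ Set.Icc (0 : ℝ) 1 := by
  have h1 := hx.mem ν
  have h2 : (0 : ℝ) ≤ cellStart k i := by exact_mod_cast cellStart_nonneg k i
  have h3 : (cellStart k i : ℝ) + 1 ≤ 2 ^ k := by exact_mod_cast cellStart_lt k i
  exact ⟨div_nonneg (add_nonneg h2 h1.1) (by positivity),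
    (div_le_one (by positivity)).2 (by linarith [h1.2])⟩

lemma Reproduced.interpolant_eq {p : (ι → ℝ) → ℝ} (hp : Reproduced x a p) (k : ℕ) (i : ι → ℤ)
    (y : ι → ℝ) : interpolant x a k i p y = p y := by
  rw [← hp (fun j => cellStart k (i j) / 2 ^ k) y (1 / 2 ^ k) (by positivity)]
  refine Finset.sum_congr rfl fun ν _ => ?_
  congr 1
  · congr 1; funext j; unfold dyadicNode; ring
  · refine Finset.prod_congr rfl fun j _ => ?_
    congr 1
    field_simp

lemma interpolant_sub_eq (k : ℕ) (i : ι → ℤ) (f p : (ι → ℝ) → ℝ) (y : ι → ℝ) :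
    interpolant x a k i f y - interpolant x a k i p y =
      interpolant x a k i (fun y => f y - p y) y := by
  unfold interpolant
  rw [← Finset.sum_sub_distrib]
  exact Finset.sum_congr rfl fun ν _ => by ring

/-- An interpolant has degree less than `n` in each variable, so interpolation on any other cell, of
any level, recovers it. This makes consecutive levels comparable. -/
lemma IsInterpolation.reproduced_interpolant (hx : IsInterpolation x a) (k : ℕ) (i : ι → ℤ)
    (f : (ι → ℝ) → ℝ) : Reproduced x a (interpolant x a k i f) := by
  unfold interpolant
  refine Reproduced.sum _ _ fun ν _ => reproduced_prod
    (p := fun j t => polyVal (a (ν j)) (2 ^ k * t - cellStart k (i j))) fun j z t h hh => ?_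
  have e (t : ℝ) : 2 ^ k * t - (cellStart k (i j) : ℝ)
      = (t - cellStart k (i j) / 2 ^ k) * 2 ^ k := by field_simp
  simp_rw [e]
  exact hx.reproduces_polyVal _ _ _ _ _ _ hh

/-- The error of the interpolation on a dyadic cell, near that cell. -/
theorem LocallyReproduced.abs_sub_interpolant_le (hx : IsInterpolation x a) {α C L : ℝ}
    (hC : 0 ≤ C) (hL : ∀ ν, ∀ t ∈ Set.Icc (-6 : ℝ) 6, |polyVal (a ν) t| ≤ L) {f : (ι → ℝ) → ℝ}
    (hf : LocallyReproduced x a α C f) (k : ℕ) (i : ι → ℤ) {y : ι → ℝ}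
    (hy : ∀ j, y j ∈ Set.Icc (0 : ℝ) 1) (hyi : ∀ j, |2 ^ k * y j - cellStart k (i j)| ≤ 6) :
    |f y - interpolant x a k i f y| ≤
      C * 6 ^ α * (1 + n ^ Fintype.card ι * L ^ Fintype.card ι) * (2 ^ (-(k : ℝ))) ^ α := by
  -- `T` is the local model at the corner of the cell. Interpolation recovers `T` exactly, so the
  -- error at `y` is bounded through `f - T` at `y` and at the nodes, the latter multiplied by the
  -- sizes of the basis polynomials.
  obtain ⟨T, hT, hfT⟩ := hf (fun j => cellStart k (i j) / 2 ^ k) (fun j => by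
    have h2 : (0 : ℝ) ≤ cellStart k (i j) := by exact_mod_cast cellStart_nonneg k (i j)
    have h3 : (cellStart k (i j) : ℝ) + 1 ≤ 2 ^ k := by exact_mod_cast cellStart_lt k (i j)
    exact ⟨by positivity, (div_le_one (by positivity)).2 (by linarith)⟩)
  have hpow : (2 : ℝ) ^ (-(k : ℝ)) = 1 / 2 ^ k := by
    rw [Real.rpow_neg (by norm_num), Real.rpow_natCast, one_div]
  have hδ : (6 / 2 ^ k : ℝ) ^ α = 6 ^ α * (2 ^ (-(k : ℝ))) ^ α := by
    rw [hpow, ← Real.mul_rpow (by norm_num) (by positivity), mul_one_div]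
  have h1 : |f y - T y| ≤ C * 6 ^ α * (2 ^ (-(k : ℝ))) ^ α := by
    rw [mul_assoc, ← hδ]
    refine hfT y hy _ (fun j => ?_) (by positivity)
    have := hyi j
    rw [show y j - cellStart k (i j) / 2 ^ k = (2 ^ k * y j - cellStart k (i j)) / 2 ^ k by
      field_simp, abs_div, abs_of_pos (by positivity : (0 : ℝ) < 2 ^ k)]
    gcongr
  have h2 : |interpolant x a k i (fun y => f y - T y) y| ≤
      C * 6 ^ α * (2 ^ (-(k : ℝ))) ^ α * (n ^ Fintype.card ι * L ^ Fintype.card ι) := by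
    unfold interpolant
    calc _ ≤ ∑ _ν : ι → Fin n, C * 6 ^ α * (2 ^ (-(k : ℝ))) ^ α * L ^ Fintype.card ι := by
          refine (Finset.abs_sum_le_sum_abs _ _).trans (Finset.sum_le_sum fun ν _ => ?_)
          rw [abs_mul]
          refine mul_le_mul ?_ ?_ (abs_nonneg _) (by positivity)
          · rw [mul_assoc, ← hδ]
            refine hfT _ (fun j => hx.dyadicNode_mem _ _ _) _ (fun j => ?_) (by positivity)
            have := hx.mem (ν j)
            unfold dyadicNode
            rw [show (cellStart k (i j) + x (ν j)) / 2 ^ k - cellStart k (i j) / 2 ^ k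
              = x (ν j) / 2 ^ k by ring, abs_of_nonneg (div_nonneg this.1 (by positivity))]
            gcongr
            linarith [this.2]
          · rw [← Finset.card_univ]
            exact abs_prod_le_pow _ fun j _ => hL _ _ (abs_le.1 (hyi j))
      _ = _ := by
          rw [Finset.sum_const, Finset.card_univ, Fintype.card_fun, Fintype.card_fin, nsmul_eq_mul]
          push_cast; ring
  have e : f y - interpolant x a k i f y
      = (f y - T y) - interpolant x a k i (fun y => f y - T y) y := by
    rw [← interpolant_sub_eq, hT.interpolant_eq]; ring
  rw [e]
  calc _ ≤ _ := abs_sub _ _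
    _ ≤ _ := add_le_add h1 h2
    _ = _ := by ring

end

/-! ### A smooth partition of unity on dyadic points -/

/-- A smooth bump function whose integer translates sum to `1`. -/
noncomputable def bump (t : ℝ) : ℝ := Real.smoothTransition (t + 1) - Real.smoothTransition t

lemma bump_nonneg (t : ℝ) : 0 ≤ bump t :=
  sub_nonneg.2 (Real.smoothTransition.monotone (by linarith))

lemma bump_eq_zero {t : ℝ} (h : 1 ≤ |t|) : bump t = 0 := by
  unfold bump
  rcases le_abs.1 h with h | h
  · rw [Real.smoothTransition.one_of_one_le h, Real.smoothTransition.one_of_one_le (by linarith),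
      sub_self]
  · rw [Real.smoothTransition.zero_of_nonpos (by linarith),
      Real.smoothTransition.zero_of_nonpos (by linarith), sub_self]

lemma abs_lt_one_of_bump_ne_zero {t : ℝ} (h : bump t ≠ 0) : |t| < 1 := by
  by_contra! h'
  exact h (bump_eq_zero h')

lemma contDiff_bump {n : ℕ∞} : ContDiff ℝ n bump :=
  (Real.smoothTransition.contDiff.comp (contDiff_id.add contDiff_const)).sub
    Real.smoothTransition.contDiff

lemma sum_bump (t : ℝ) (a : ℤ) (m : ℕ) : ∑ i ∈ Finset.Icc a (a + m), bump (t - i) =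
    Real.smoothTransition (t - a + 1) - Real.smoothTransition (t - a - m) := by
  induction m with
  | zero => simp [bump]
  | succ m ih =>
    have e : Finset.Icc a (a + (m + 1 : ℕ)) = insert (a + (m + 1 : ℕ)) (Finset.Icc a (a + m)) := by
      ext i
      simp only [Finset.mem_Icc, Finset.mem_insert]
      push_cast
      omega
    rw [e, Finset.sum_insert (by simp), ih]
    unfold bump
    push_cast
    ring_nf

lemma sum_bump_eq_one {t : ℝ} {a b : ℤ} (h1 : a ≤ t) (h2 : t ≤ b) :
    ∑ i ∈ Finset.Icc a b, bump (t - i) = 1 := by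
  have hab : a ≤ b := by exact_mod_cast h1.trans h2
  obtain ⟨m, rfl⟩ := Int.le.dest hab
  push_cast at h2
  rw [sum_bump, Real.smoothTransition.one_of_one_le (by linarith),
    Real.smoothTransition.zero_of_nonpos (by linarith), sub_zero]

/-- The dyadic points of level `k` in the unit cube, times `2 ^ k`. -/
noncomputable def dyadicIndex (ι : Type) [Fintype ι] [DecidableEq ι] (k : ℕ) : Finset (ι → ℤ) :=
  Fintype.piFinset fun _ => Finset.Icc 0 (2 ^ k)

/-- The partition of unity of level `k`. -/
noncomputable def dyadicBump {ι : Type} [Fintype ι] (k : ℕ) (i : ι → ℤ) (y : ι → ℝ) : ℝ :=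
  ∏ j, bump (2 ^ k * y j - i j)

section

variable {ι : Type} [Fintype ι]

lemma dyadicBump_nonneg (k : ℕ) (i : ι → ℤ) (y : ι → ℝ) : 0 ≤ dyadicBump k i y :=
  Finset.prod_nonneg fun _ _ => bump_nonneg _

lemma abs_sub_lt_of_dyadicBump_ne_zero {k : ℕ} {i : ι → ℤ} {y : ι → ℝ} (h : dyadicBump k i y ≠ 0)
    (j : ι) : |2 ^ k * y j - i j| < 1 :=
  abs_lt_one_of_bump_ne_zero (Finset.prod_ne_zero_iff.1 h j (Finset.mem_univ _))

variable [DecidableEq ι]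

lemma sum_dyadicBump_eq_one (k : ℕ) {y : ι → ℝ} (hy : ∀ j, y j ∈ Set.Icc (0 : ℝ) 1) :
    ∑ i ∈ dyadicIndex ι k, dyadicBump k i y = 1 := by
  unfold dyadicIndex dyadicBump
  rw [← Finset.prod_univ_sum (fun _ => Finset.Icc (0 : ℤ) (2 ^ k))
    (fun j i => bump (2 ^ k * y j - i))]
  refine Finset.prod_eq_one fun j _ => sum_bump_eq_one ?_ ?_
  · have := (hy j).1
    push_cast; positivity
  · push_cast
    exact mul_le_of_le_one_right (by positivity) (hy j).2

lemma mem_dyadicIndex_of_dyadicBump_ne_zero {k : ℕ} {i : ι → ℤ} {y : ι → ℝ}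
    (hy : ∀ j, y j ∈ Set.Icc (0 : ℝ) 1) (h : dyadicBump k i y ≠ 0) : i ∈ dyadicIndex ι k := by
  refine Fintype.mem_piFinset.2 fun j => ?_
  have h1 := abs_lt.1 (abs_sub_lt_of_dyadicBump_ne_zero h j)
  have h2 : 0 ≤ 2 ^ k * y j := mul_nonneg (by positivity) (hy j).1
  have h3 : 2 ^ k * y j ≤ 2 ^ k := mul_le_of_le_one_right (by positivity) (hy j).2
  have h4 : (-1 : ℝ) < i j := by linarith
  have h5 : (i j : ℝ) < 2 ^ k + 1 := by linarith
  have h4' : -1 < i j := by exact_mod_cast h4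
  have h5' : i j < 2 ^ k + 1 := by exact_mod_cast h5
  exact Finset.mem_Icc.2 ⟨by omega, by omega⟩

/-- The displacements between neighbouring dyadic points of consecutive levels. -/
noncomputable def offsets (ι : Type) [Fintype ι] [DecidableEq ι] : Finset (ι → ℤ) :=
  Fintype.piFinset fun _ => Finset.Icc (-2) 2

/-- On the support of the coarse bump `|2 ^ (k + 1) * y j - 2 * i j| < 2`, so the fine bumps with
offsets from `-2` to `2` already sum to `1`. -/
lemma sum_offsets_dyadicBump {k : ℕ} {i : ι → ℤ} {y : ι → ℝ} (h : dyadicBump k i y ≠ 0) :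
    ∑ o ∈ offsets ι, dyadicBump (k + 1) (fun j => 2 * i j + o j) y = 1 := by
  unfold offsets dyadicBump
  have e (o : ι → ℤ) : ∏ j, bump (2 ^ (k + 1) * y j - (2 * i j + o j : ℤ))
      = ∏ j, bump ((2 ^ (k + 1) * y j - 2 * i j) - o j) := by
    refine Finset.prod_congr rfl fun j _ => ?_
    push_cast; ring_nf
  simp_rw [e]
  rw [← Finset.prod_univ_sum (fun _ => Finset.Icc (-2 : ℤ) 2)
    (fun j o => bump ((2 ^ (k + 1) * y j - 2 * i j) - o))]
  refine Finset.prod_eq_one fun j _ => ?_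
  have := abs_lt.1 (abs_sub_lt_of_dyadicBump_ne_zero h j)
  refine sum_bump_eq_one ?_ ?_ <;> push_cast <;> rw [pow_succ] <;> linarith

/-- The two sums differ only by zero terms. A fine point outside the cube has a bump that vanishes
at `y`, and so has a fine point that is not a neighbour of `2 i`. -/
lemma sum_offsets_eq {k : ℕ} {i : ι → ℤ} {y : ι → ℝ} (hy : ∀ j, y j ∈ Set.Icc (0 : ℝ) 1)
    (h : dyadicBump k i y ≠ 0) (g : (ι → ℤ) → ℝ) :
    ∑ o ∈ offsets ι, dyadicBump (k + 1) (fun j => 2 * i j + o j) y * g (fun j => 2 * i j + o j) =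
      ∑ i' ∈ dyadicIndex ι (k + 1), dyadicBump (k + 1) i' y * g i' := by
  have e : ∑ o ∈ offsets ι, dyadicBump (k + 1) (fun j => 2 * i j + o j) y *
      g (fun j => 2 * i j + o j) =
      ∑ i' ∈ (offsets ι).map (addLeftEmbedding fun j => 2 * i j), dyadicBump (k + 1) i' y * g i' :=
    (Finset.sum_map (offsets ι) (addLeftEmbedding fun j => 2 * i j)
      fun i' => dyadicBump (k + 1) i' y * g i').symm
  rw [e]
  refine Finset.sum_congr_of_eq_on_inter (fun i' _ h' => ?_) (fun i' _ h' => ?_) fun _ _ _ => rfl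
  · by_contra h0
    exact h' (mem_dyadicIndex_of_dyadicBump_ne_zero hy (left_ne_zero_of_mul h0))
  · by_contra h0
    refine h' (Finset.mem_map.2 ⟨fun j => i' j - 2 * i j, Fintype.mem_piFinset.2 fun j => ?_, ?_⟩)
    · have h1 := abs_lt.1 (abs_sub_lt_of_dyadicBump_ne_zero h j)
      have h2 := abs_lt.1 (abs_sub_lt_of_dyadicBump_ne_zero (left_ne_zero_of_mul h0) j)
      rw [pow_succ] at h2
      have h3 : (-3 : ℝ) < i' j - 2 * i j := by linarith
      have h4 : (i' j : ℝ) - 2 * i j < 3 := by linarith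
      have h3' : -3 < i' j - 2 * i j := by exact_mod_cast h3
      have h4' : i' j - 2 * i j < 3 := by exact_mod_cast h4
      exact Finset.mem_Icc.2 ⟨by omega, by omega⟩
    · funext j
      simp

end

/-! ### Multiscale decomposition -/

/-- The shape of the terms of the multiscale decomposition. -/
noncomputable def shape {n : ℕ} (a : Fin n → Fin n → ℝ) (o : ℤ) (ν : Fin n) (e : ℤ) (t : ℝ) : ℝ :=
  bump t * bump (2 * t - o) * polyVal (a ν) (t + e)

/-- `f` is a sum of rescaled shapes of level `k` with coefficients of size at most `c₀`. -/
def IsShapeSum {ι : Type} [Fintype ι] [DecidableEq ι] {n : ℕ} (a : Fin n → Fin n → ℝ) (k : ℕ)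
    (c₀ : ℝ) (f : (ι → ℝ) → ℝ) : Prop :=
  ∃ c : (ι → ℤ) → (ι → ℤ) × (ι → Fin n) → ℝ,
    (∀ i ∈ dyadicIndex ι k, ∀ e ∈ offsets ι ×ˢ Finset.univ, |c i e| ≤ c₀) ∧
    ∀ y : ι → ℝ, (∀ j, y j ∈ Set.Icc (0 : ℝ) 1) →
      f y = ∑ e ∈ offsets ι ×ˢ Finset.univ, ∑ i ∈ dyadicIndex ι k,
        c i e * ∏ j, shape a (e.1 j) (e.2 j) (i j - cellStart k (i j)) (2 ^ k * y j - i j)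

/-- The quasi-interpolation of level `k`. -/
noncomputable def quasiInterpolant {ι : Type} [Fintype ι] [DecidableEq ι] {n : ℕ} (x : Fin n → ℝ)
    (a : Fin n → Fin n → ℝ) (k : ℕ) (f : (ι → ℝ) → ℝ) (y : ι → ℝ) : ℝ :=
  ∑ i ∈ dyadicIndex ι k, dyadicBump k i y * interpolant x a k i f y

section

variable {ι : Type} [Fintype ι] [DecidableEq ι] {n : ℕ} {x : Fin n → ℝ} {a : Fin n → Fin n → ℝ}

/-- The coefficients are the values of `g i o` at the nodes of the cell. Shapes contain bumps of two
consecutive levels because differences of consecutive quasi-interpolants do; a single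
quasi-interpolant is brought to the same form by `quasiInterpolant_eq`. -/
lemma isShapeSum_of_forall {k : ℕ} {c₀ : ℝ} {f : (ι → ℝ) → ℝ}
    (g : (ι → ℤ) → (ι → ℤ) → (ι → ℝ) → ℝ)
    (hg : ∀ i ∈ dyadicIndex ι k, ∀ o ∈ offsets ι, ∀ ν : ι → Fin n,
      |g i o fun j => dyadicNode x k (i j) (ν j)| ≤ c₀)
    (hf : ∀ y : ι → ℝ, (∀ j, y j ∈ Set.Icc (0 : ℝ) 1) → f y =
      ∑ i ∈ dyadicIndex ι k, ∑ o ∈ offsets ι, dyadicBump k i y *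
        dyadicBump (k + 1) (fun j => 2 * i j + o j) y * interpolant x a k i (g i o) y) :
    IsShapeSum a k c₀ f := by
  refine ⟨fun i e => g i e.1 fun j => dyadicNode x k (i j) (e.2 j), fun i hi e he =>
    hg i hi _ (Finset.mem_product.1 he).1 _, fun y hy => ?_⟩
  rw [hf y hy, Finset.sum_comm, Finset.sum_product]
  refine Finset.sum_congr rfl fun o _ => ?_
  rw [Finset.sum_comm]
  refine Finset.sum_congr rfl fun i _ => ?_
  unfold interpolant
  rw [Finset.mul_sum]
  refine Finset.sum_congr rfl fun ν _ => ?_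
  unfold dyadicBump shape
  rw [Finset.prod_mul_distrib, Finset.prod_mul_distrib]
  have e1 : ∏ j, bump (2 ^ (k + 1) * y j - (2 * i j + o j : ℤ))
      = ∏ j, bump (2 * (2 ^ k * y j - i j) - o j) := by
    refine Finset.prod_congr rfl fun j _ => ?_
    push_cast; ring_nf
  have e2 : ∏ j, polyVal (a (ν j)) (2 ^ k * y j - cellStart k (i j))
      = ∏ j, polyVal (a (ν j)) (2 ^ k * y j - i j + (i j - cellStart k (i j) : ℤ)) := by
    refine Finset.prod_congr rfl fun j _ => ?_
    push_cast; ring_nf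
  rw [e1, e2]
  ring

lemma quasiInterpolant_eq (k : ℕ) (f : (ι → ℝ) → ℝ) {y : ι → ℝ} :
    quasiInterpolant x a k f y = ∑ i ∈ dyadicIndex ι k, ∑ o ∈ offsets ι, dyadicBump k i y *
      dyadicBump (k + 1) (fun j => 2 * i j + o j) y * interpolant x a k i f y := by
  refine Finset.sum_congr rfl fun i _ => ?_
  by_cases h : dyadicBump k i y = 0
  · simp [h]
  · simp_rw [mul_assoc]
    rw [← Finset.mul_sum, ← Finset.sum_mul, sum_offsets_dyadicBump h, one_mul]

/-- Multiplying by the coarse partition of unity indexes the fine level by the same pairs `(i, o)`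
as in `quasiInterpolant_eq`, so that the two levels can be subtracted term by term. -/
lemma quasiInterpolant_succ_eq (k : ℕ) (f : (ι → ℝ) → ℝ) {y : ι → ℝ}
    (hy : ∀ j, y j ∈ Set.Icc (0 : ℝ) 1) :
    quasiInterpolant x a (k + 1) f y = ∑ i ∈ dyadicIndex ι k, ∑ o ∈ offsets ι, dyadicBump k i y *
      dyadicBump (k + 1) (fun j => 2 * i j + o j) y *
        interpolant x a (k + 1) (fun j => 2 * i j + o j) f y := by
  have e : quasiInterpolant x a (k + 1) f y = ∑ i ∈ dyadicIndex ι k, dyadicBump k i y *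
      quasiInterpolant x a (k + 1) f y := by
    rw [← Finset.sum_mul, sum_dyadicBump_eq_one k hy, one_mul]
  rw [e]
  refine Finset.sum_congr rfl fun i _ => ?_
  by_cases h : dyadicBump k i y = 0
  · simp [h]
  · simp_rw [mul_assoc]
    rw [← Finset.mul_sum, sum_offsets_eq hy h fun i' => interpolant x a (k + 1) i' f y]
    rfl

lemma isShapeSum_quasiInterpolant (hx : IsInterpolation x a) (k : ℕ) {R : ℝ} {f : (ι → ℝ) → ℝ}
    (hf : ∀ y : ι → ℝ, (∀ j, y j ∈ Set.Icc (0 : ℝ) 1) → |f y| ≤ R) :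
    IsShapeSum a k R (quasiInterpolant x a k f) :=
  isShapeSum_of_forall (x := x) (fun _ _ => f)
    (fun _ _ _ _ _ => hf _ fun _ => hx.dyadicNode_mem _ _ _) fun _ _ => quasiInterpolant_eq k f

/-- Coarse nodes stay near the fine cell: the corners differ by at most `4` in fine units, and the
position of the node in its cell adds at most `2`. This is the source of the interval `[-6, 6]` on
which the basis polynomials are bounded. -/
lemma abs_node_sub_cellStart_le (hx : IsInterpolation x a) {k : ℕ} {i o : ι → ℤ}
    (hi : i ∈ dyadicIndex ι k) (ho : o ∈ offsets ι) (ν : ι → Fin n) (j : ι) :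
    |2 ^ (k + 1) * dyadicNode x k (i j) (ν j) - cellStart (k + 1) (2 * i j + o j)| ≤ 6 := by
  have h1 := Finset.mem_Icc.1 (Fintype.mem_piFinset.1 hi j)
  have h2 := Finset.mem_Icc.1 (Fintype.mem_piFinset.1 ho j)
  have h3 : cellStart (k + 1) (2 * i j + o j) ≤ 2 * cellStart k (i j) + 4 ∧
      2 * cellStart k (i j) ≤ cellStart (k + 1) (2 * i j + o j) + 4 := by
    have : (0 : ℤ) < 2 ^ k := by positivity
    unfold cellStart
    rw [pow_succ]
    omega
  have h4 : (cellStart (k + 1) (2 * i j + o j) : ℝ) ≤ 2 * cellStart k (i j) + 4 := by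
    exact_mod_cast h3.1
  have h5 : (2 * cellStart k (i j) : ℝ) ≤ cellStart (k + 1) (2 * i j + o j) + 4 := by
    exact_mod_cast h3.2
  have h6 := hx.mem (ν j)
  have h7 : 2 ^ (k + 1) * dyadicNode x k (i j) (ν j) = 2 * (cellStart k (i j) + x (ν j)) := by
    unfold dyadicNode
    rw [pow_succ]
    field_simp
  rw [h7, abs_le]
  constructor <;> linarith [h6.1, h6.2]

/-- The constant of the interpolation error. -/
noncomputable def interpConst (ι : Type) [Fintype ι] (n : ℕ) (α C L : ℝ) : ℝ :=
  C * 6 ^ α * (1 + n ^ Fintype.card ι * L ^ Fintype.card ι)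

/-- The coarse interpolation recovers the fine interpolant, so the difference of the two
interpolants is the coarse interpolant of minus the fine interpolation error. Its coefficients are
values of that error at coarse nodes, hence of order `2 ^ (-k α)`. -/
lemma isShapeSum_sub (hx : IsInterpolation x a) {α C L : ℝ} (hα : 0 ≤ α) (hC : 0 ≤ C) (hL0 : 0 ≤ L)
    (hL : ∀ ν, ∀ t ∈ Set.Icc (-6 : ℝ) 6, |polyVal (a ν) t| ≤ L) {f : (ι → ℝ) → ℝ}
    (hf : LocallyReproduced x a α C f) (k : ℕ) :
    IsShapeSum a k (interpConst ι n α C L * (2 ^ (-(k : ℝ))) ^ α)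
      fun y => quasiInterpolant x a (k + 1) f y - quasiInterpolant x a k f y := by
  refine isShapeSum_of_forall (x := x)
    (fun i o y => -(f y - interpolant x a (k + 1) (fun j => 2 * i j + o j) f y))
    (fun i hi o ho ν => ?_) fun y hy => ?_
  · rw [abs_neg]
    refine (hf.abs_sub_interpolant_le hx hC hL (k + 1) _ (fun j => hx.dyadicNode_mem _ _ _)
      (abs_node_sub_cellStart_le hx hi ho ν)).trans ?_
    unfold interpConst
    refine mul_le_mul_of_nonneg_left (Real.rpow_le_rpow (by positivity)
      (Real.rpow_le_rpow_of_exponent_le one_le_two ?_) hα) (by positivity)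
    push_cast
    linarith
  · rw [quasiInterpolant_eq k, quasiInterpolant_succ_eq k f hy, ← Finset.sum_sub_distrib]
    refine Finset.sum_congr rfl fun i _ => ?_
    rw [← Finset.sum_sub_distrib]
    refine Finset.sum_congr rfl fun o _ => ?_
    have e : interpolant x a k i
        (fun y => -(f y - interpolant x a (k + 1) (fun j => 2 * i j + o j) f y)) y =
        interpolant x a (k + 1) (fun j => 2 * i j + o j) f y - interpolant x a k i f y := by
      have := (hx.reproduced_interpolant (k + 1) (fun j => 2 * i j + o j) f).interpolant_eq k i y
      rw [← this, interpolant_sub_eq]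
      simp_rw [neg_sub]
    rw [e]
    ring

lemma abs_sub_quasiInterpolant_le (hx : IsInterpolation x a) {α C L : ℝ} (hC : 0 ≤ C)
    (hL : ∀ ν, ∀ t ∈ Set.Icc (-6 : ℝ) 6, |polyVal (a ν) t| ≤ L) {f : (ι → ℝ) → ℝ}
    (hf : LocallyReproduced x a α C f) (k : ℕ) {y : ι → ℝ} (hy : ∀ j, y j ∈ Set.Icc (0 : ℝ) 1) :
    |f y - quasiInterpolant x a k f y| ≤ interpConst ι n α C L * (2 ^ (-(k : ℝ))) ^ α := by
  have e : f y - quasiInterpolant x a k f y =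
      ∑ i ∈ dyadicIndex ι k, dyadicBump k i y * (f y - interpolant x a k i f y) := by
    simp_rw [mul_sub]
    rw [Finset.sum_sub_distrib, ← Finset.sum_mul, sum_dyadicBump_eq_one k hy, one_mul]
    rfl
  rw [e]
  calc _ ≤ ∑ i ∈ dyadicIndex ι k, dyadicBump k i y *
        (interpConst ι n α C L * (2 ^ (-(k : ℝ))) ^ α) := by
        refine (Finset.abs_sum_le_sum_abs _ _).trans (Finset.sum_le_sum fun i hi => ?_)
        rw [abs_mul, abs_of_nonneg (dyadicBump_nonneg k i y)]
        by_cases h : dyadicBump k i y = 0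
        · simp [h]
        · refine mul_le_mul_of_nonneg_left ?_ (dyadicBump_nonneg k i y)
          refine hf.abs_sub_interpolant_le hx hC hL k i hy fun j => ?_
          have h1 := abs_lt.1 (abs_sub_lt_of_dyadicBump_ne_zero h j)
          have h2 := Finset.mem_Icc.1 (Fintype.mem_piFinset.1 hi j)
          have h3 : cellStart k (i j) ≤ i j ∧ i j ≤ cellStart k (i j) + 1 := by
            have : (0 : ℤ) < 2 ^ k := by positivity
            unfold cellStart
            omega
          have h4 : (cellStart k (i j) : ℝ) ≤ i j := by exact_mod_cast h3.1
          have h5 : (i j : ℝ) ≤ cellStart k (i j) + 1 := by exact_mod_cast h3.2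
          rw [abs_le]
          constructor <;> linarith [h1.1, h1.2]
    _ = _ := by rw [← Finset.sum_mul, sum_dyadicBump_eq_one k hy, one_mul]

end

/-! ### Approximation of one level of the decomposition -/

/-- The terms are compared with a fixed convergent series after translating by `⌊t⌋`. The shift by
`1 / 2` keeps its denominators away from zero, and the factor `5` absorbs the distance between `t`
and `⌊t⌋ - 1 / 2`. -/
lemma exists_sum_peak_le : ∃ S > 0, ∀ (t : ℝ) (s : Finset ℤ),
    ∑ i ∈ s, (1 + (t - i) ^ 2)⁻¹ ≤ S := by
  have hsum : Summable fun z : ℤ => 5 * (1 / |(z : ℝ) + 1 / 2| ^ (2 : ℝ)) :=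
    ((Real.summable_one_div_int_add_rpow (1 / 2) 2).2 one_lt_two).mul_left 5
  have hnn (z : ℤ) : 0 ≤ 5 * (1 / |(z : ℝ) + 1 / 2| ^ (2 : ℝ)) := by positivity
  refine ⟨1 + ∑' z : ℤ, 5 * (1 / |(z : ℝ) + 1 / 2| ^ (2 : ℝ)),
    add_pos_of_pos_of_nonneg one_pos (tsum_nonneg hnn), fun t s => ?_⟩
  have h1 (i : ℤ) : (1 + (t - i) ^ 2)⁻¹ ≤ 5 * (1 / |((i - ⌊t⌋ : ℤ) : ℝ) + 1 / 2| ^ (2 : ℝ)) := by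
    have h0 : ((i - ⌊t⌋ : ℤ) : ℝ) + 1 / 2 ≠ 0 := by
      intro h
      have h' : (2 * (i - ⌊t⌋) + 1 : ℤ) = 0 := by
        have : (2 * ((i - ⌊t⌋ : ℤ) : ℝ) + 1) = 0 := by linarith
        exact_mod_cast this
      omega
    rw [show (2 : ℝ) = (2 : ℕ) by norm_num, Real.rpow_natCast, sq_abs, mul_one_div,
      inv_eq_one_div, div_le_div_iff₀ (by positivity) (by positivity)]
    have h2 := Int.floor_le t
    have h3 := Int.lt_floor_add_one t
    push_cast
    nlinarith [sq_nonneg (2 * (i - t) - (t - ⌊t⌋ + 1 / 2)), sq_nonneg (t - i)]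
  calc _ ≤ ∑ i ∈ s, 5 * (1 / |((i - ⌊t⌋ : ℤ) : ℝ) + 1 / 2| ^ (2 : ℝ)) :=
        Finset.sum_le_sum fun i _ => h1 i
    _ = ∑ z ∈ s.map (Equiv.subRight ⌊t⌋).toEmbedding, 5 * (1 / |(z : ℝ) + 1 / 2| ^ (2 : ℝ)) := by
        rw [Finset.sum_map]; rfl
    _ ≤ ∑' z : ℤ, 5 * (1 / |(z : ℝ) + 1 / 2| ^ (2 : ℝ)) := hsum.sum_le_tsum _ fun z _ => hnn z
    _ ≤ _ := by linarith

section

variable {n : ℕ} (a : Fin n → Fin n → ℝ)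

lemma contDiff_shape (o : ℤ) (ν : Fin n) (e : ℤ) {m : ℕ∞} : ContDiff ℝ m (shape a o ν e) := by
  unfold shape
  exact (contDiff_bump.mul (contDiff_bump.comp ((contDiff_const.mul contDiff_id).sub
    contDiff_const))).mul ((contDiff_polyVal _).comp (contDiff_id.add contDiff_const))

lemma iteratedDeriv_shape_eq_zero (o : ℤ) (ν : Fin n) (e : ℤ) (m : ℕ) {t : ℝ} (ht : 1 < |t|) :
    iteratedDeriv m (shape a o ν e) t = 0 := by
  have h : shape a o ν e =ᶠ[nhds t] fun _ => 0 := by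
    filter_upwards [continuous_abs.continuousAt.eventually (lt_mem_nhds ht)] with r hr
    unfold shape
    rw [bump_eq_zero hr.le, zero_mul, zero_mul]
  rw [h.iteratedDeriv_eq]
  simp

/-- Up to dilation and translation only finitely many shapes occur, whatever the level, and all are
supported in `[-1,1]`. One constant therefore serves all scales. -/
lemma exists_shape_bound (N : ℕ) : ∃ B ≥ 0, ∀ o ∈ Finset.Icc (-2 : ℤ) 2, ∀ ν,
    ∀ e ∈ Finset.Icc (0 : ℤ) 1, ∀ m ≤ N, ∀ t,
      |iteratedDeriv m (shape a o ν e) t| ≤ B * (1 + t ^ 2)⁻¹ := by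
  have h (p : ℤ × Fin n × ℤ × ℕ) : ∃ B, ∀ t ∈ Set.Icc (-1 : ℝ) 1,
      |iteratedDeriv p.2.2.2 (shape a p.1 p.2.1 p.2.2.1) t| ≤ B := by
    obtain ⟨B, hB⟩ := isCompact_Icc.exists_bound_of_continuousOn
      ((contDiff_shape a p.1 p.2.1 p.2.2.1 (m := ⊤)).continuous_iteratedDeriv p.2.2.2
        (by exact_mod_cast le_top)).continuousOn
    exact ⟨B, hB⟩
  choose B hB using h
  have hB0 (p) : 0 ≤ B p := (abs_nonneg _).trans (hB p 0 (by norm_num))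
  set I : Finset (ℤ × Fin n × ℤ × ℕ) :=
    Finset.Icc (-2) 2 ×ˢ Finset.univ ×ˢ Finset.Icc 0 1 ×ˢ Finset.range (N + 1)
  refine ⟨2 * ∑ p ∈ I, B p, mul_nonneg zero_le_two (Finset.sum_nonneg fun p _ => hB0 p),
    fun o ho ν e he m hm t => ?_⟩
  have hI : (o, ν, e, m) ∈ I :=
    Finset.mem_product.2 ⟨ho, Finset.mem_product.2 ⟨Finset.mem_univ _, Finset.mem_product.2
      ⟨he, Finset.mem_range.2 (by simp only; omega)⟩⟩⟩
  have h1 : B (o, ν, e, m) ≤ ∑ p ∈ I, B p := Finset.single_le_sum (fun p _ => hB0 p) hI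
  have h0 := hB0 (o, ν, e, m)
  by_cases ht : |t| ≤ 1
  · have h2 := hB (o, ν, e, m) t (abs_le.1 ht)
    rw [← div_eq_mul_inv, le_div_iff₀ (by positivity)]
    have h3 : t ^ 2 ≤ 1 := by rw [← sq_abs]; exact pow_le_one₀ (abs_nonneg _) ht
    calc _ ≤ (∑ p ∈ I, B p) * 2 := mul_le_mul (h2.trans h1) (by linarith) (by positivity)
          (h0.trans h1)
      _ = _ := mul_comm _ _
  · rw [iteratedDeriv_shape_eq_zero a o ν e m (not_le.1 ht), abs_zero]
    have := h0.trans h1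
    positivity

/-- The derivatives of `x ↦ w (2 ^ k * x - i)`. -/
noncomputable def dilate (w : ℝ → ℝ) (k : ℕ) (i : ℤ) (m : ℕ) (x : ℝ) : ℝ :=
  (2 ^ k) ^ m * iteratedDeriv m w (2 ^ k * x - i)

lemma controlled_dilate {w : ℝ → ℝ} {N : ℕ} {B : ℝ} (hw : ContDiff ℝ N w)
    (hB : ∀ m ≤ N, ∀ t, |iteratedDeriv m w t| ≤ B * (1 + t ^ 2)⁻¹) (k : ℕ) (i : ℤ) :
    Controlled N ((2 : ℝ) ^ k)⁻¹ B (peak (i * ((2 : ℝ) ^ k)⁻¹) ((2 : ℝ) ^ k)⁻¹) (dilate w k i) where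
  chain m hm x := by
    have h := isDerivChain_iteratedDeriv hw m hm (2 ^ k * x - i)
    have h2 : HasDerivAt (fun x : ℝ => 2 ^ k * x - i) (2 ^ k) x := by
      simpa using ((hasDerivAt_id x).const_mul ((2 : ℝ) ^ k)).sub_const (i : ℝ)
    refine ((h.comp x h2).const_mul ((2 ^ k) ^ m)).congr_deriv ?_
    unfold dilate
    ring
  bound m hm x := by
    have e : peak (i * ((2 : ℝ) ^ k)⁻¹) ((2 : ℝ) ^ k)⁻¹ x = (1 + (2 ^ k * x - i) ^ 2)⁻¹ := by
      unfold peak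
      congr 3
      field_simp
    rw [e]
    refine le_trans (le_of_eq ?_) (hB m hm _)
    unfold dilate
    rw [abs_mul, abs_of_pos (by positivity), inv_pow]
    field_simp

/-- The support has radius `2 ^ (-k) ≤ 1 / 4` around `i / 2 ^ k`. At an interior dyadic point it
lies in `[0,1]`, and at an endpoint it stays away from the other end. This is why levels start at
`2`. -/
lemma vanishes_dilate {w : ℝ → ℝ} {N : ℕ} (hw : ∀ m t, 1 < |t| → iteratedDeriv m w t = 0) {k : ℕ}
    (hk : 2 ≤ k) {i : ℤ} (hi : i ∈ Finset.Icc (0 : ℤ) (2 ^ k)) :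
    VanishesOff N (dilate w k i) ∨ VanishesNearEnd N (dilate w k i) := by
  have h4 : (4 : ℝ) ≤ 2 ^ k := by
    calc (4 : ℝ) = 2 ^ 2 := by norm_num
      _ ≤ _ := pow_le_pow_right₀ one_le_two hk
  have hz {m : ℕ} {x : ℝ} (h : 1 < |2 ^ k * x - i|) : dilate w k i m x = 0 := by
    unfold dilate; rw [hw m _ h, mul_zero]
  have hi' := Finset.mem_Icc.1 hi
  by_cases h0 : i = 0
  · refine Or.inr (Or.inl fun m _ x hx => hz ?_)
    rw [h0, lt_abs]
    left; push_cast; nlinarith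
  by_cases h1 : i = 2 ^ k
  · refine Or.inr (Or.inr fun m _ x hx => hz ?_)
    rw [h1, lt_abs]
    right; push_cast; nlinarith
  · refine Or.inl fun m _ x hx => hz ?_
    have h2 : (1 : ℤ) ≤ i := by omega
    have h3 : i + 1 ≤ 2 ^ k := by omega
    have h2' : (1 : ℝ) ≤ i := by exact_mod_cast h2
    have h3' : (i : ℝ) + 1 ≤ 2 ^ k := by exact_mod_cast h3
    rw [lt_abs]
    simp only [Set.mem_Icc, not_and_or, not_le] at hx
    rcases hx with hx | hx
    · right; nlinarith
    · left; nlinarith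

end

/-- A sum of shapes of level `k` is a sum of product mixtures of `b` finer bandwidths, up to an
error of high order in the ratio of the bandwidths. -/
theorem IsShapeSum.exists_mixtures {K : ℝ → ℝ} (hK : IsKernel K) {MK : ℝ} (hMK : ∀ x, |K x| ≤ MK)
    (N : ℕ) (ι : Type) [Fintype ι] [DecidableEq ι] {b : ℕ} (hb : Fintype.card ι < b) {n₀ : ℕ}
    (a : Fin n₀ → Fin n₀ → ℝ) :
    ∃ C > 0, ∀ (k : ℕ) (q V η c₀ : ℝ) (f : (ι → ℝ) → ℝ)
      (n : ℕ → ℕ) (γ : ∀ k, Fin (n k) → ℝ) (l : ∀ k, Fin (n k) → ℝ → ℝ),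
      2 ≤ k → 0 < q → q ≤ 1 → 1 ≤ V → 0 ≤ η → η ≤ 1 → 0 ≤ c₀ → IsShapeSum a k c₀ f →
      (∀ m < b, IsGrid K (((2 : ℝ) ^ k)⁻¹ * q ^ (m + 1)) V η (γ m) (l m)) →
      ∃ P : ℕ → (ι → ℝ) → ℝ,
        (∀ m < b, IsProductMixture K (((2 : ℝ) ^ k)⁻¹ * q ^ (m + 1))
          (Fintype.card ι * η * (MK + 1) ^ Fintype.card ι) (γ m)
          (C * c₀ * (V / (((2 : ℝ) ^ k)⁻¹ * q ^ (m + 1))) ^ Fintype.card ι) (P m)) ∧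
        ∀ y : ι → ℝ, (∀ j, y j ∈ Set.Icc (0 : ℝ) 1) →
          |f y - ∑ m ∈ Finset.range b, P m y| ≤ C * c₀ * q ^ N := by
  obtain ⟨B, hB0, hB⟩ := exists_shape_bound a N
  obtain ⟨C, hC, hmulti⟩ := exists_multilevel hK hMK N ι b B hB0
  obtain ⟨S, hS, hSum⟩ := exists_sum_peak_le
  have hMK0 : 0 ≤ MK := (abs_nonneg _).trans (hMK 0)
  set d := Fintype.card ι with hd
  set E : Finset ((ι → ℤ) × (ι → Fin n₀)) := offsets ι ×ˢ Finset.univ with hE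
  refine ⟨C * E.card * (2 ^ d + S ^ d) + 1, by positivity,
    fun k q V η c₀ f n γ l hk hq hq1 hV hη hη1 hc₀ ⟨c, hc, hf⟩ hγ => ?_⟩
  set s : ℝ := ((2 : ℝ) ^ k)⁻¹ with hs_def
  have hs : 0 < s := by positivity
  have hs1 : s ≤ 1 := inv_le_one_of_one_le₀ (one_le_pow₀ one_le_two)
  set sh : ((ι → ℤ) × (ι → Fin n₀)) × (ι → ℤ) → ι → ℝ → ℝ := fun p j =>
    shape a (p.1.1 j) (p.1.2 j) (p.2 j - cellStart k (p.2 j)) with hsh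
  have hP (p : ((ι → ℤ) × (ι → Fin n₀)) × (ι → ℤ)) : ∃ P : ℕ → (ι → ℝ) → ℝ,
      p ∈ E ×ˢ dyadicIndex ι k →
        (∀ m < b, IsProductMixture K (s * q ^ (m + 1)) (d * η * (MK + 1) ^ d) (γ m)
          (C * (V * (s / (s * q ^ (m + 1)))) ^ d) (P m)) ∧
        ∀ y : ι → ℝ, (∀ j, y j ∈ Set.Icc (0 : ℝ) 1) →
          |∏ j, sh p j (2 ^ k * y j - p.2 j) - ∑ m ∈ Finset.range b, P m y| ≤
            C * q ^ N * ∏ j, peak (p.2 j * s) s (y j) := by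
    by_cases hp : p ∈ E ×ˢ dyadicIndex ι k
    · obtain ⟨h1, h2⟩ := Finset.mem_product.1 hp
      have ho (j : ι) : p.1.1 j ∈ Finset.Icc (-2 : ℤ) 2 :=
        Fintype.mem_piFinset.1 (Finset.mem_product.1 h1).1 j
      have hi (j : ι) : p.2 j ∈ Finset.Icc (0 : ℤ) (2 ^ k) := Fintype.mem_piFinset.1 h2 j
      have he (j : ι) : p.2 j - cellStart k (p.2 j) ∈ Finset.Icc (0 : ℤ) 1 := by
        have h3 := Finset.mem_Icc.1 (hi j)
        have : (0 : ℤ) < 2 ^ k := by positivity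
        unfold cellStart
        exact Finset.mem_Icc.2 ⟨by omega, by omega⟩
      -- No coordinate is known to be good at the outset (`G = ∅`), so `b` must exceed the full
      -- dimension. The weights are as wide as the shape, `s₀ = s`.
      obtain ⟨P, hP1, hP2⟩ := hmulti s q s V η (fun j => p.2 j * s)
        (fun j => dilate (sh p j) k (p.2 j)) ∅ n γ l hq hq1 hs le_rfl hs1 hV hη hη1 hγ
        (fun j => controlled_dilate (contDiff_shape a _ _ _ (m := N))
          (hB _ (ho j) _ _ (he j)) k _)
        (fun j => vanishes_dilate (fun m t => iteratedDeriv_shape_eq_zero a _ _ _ m) hk (hi j))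
        (fun j hj => absurd hj (Finset.notMem_empty j)) (by simpa using hb)
      refine ⟨P, fun _ => ⟨hP1, fun y hy => ?_⟩⟩
      have := hP2 y hy
      simpa only [dilate, pow_zero, one_mul, iteratedDeriv_zero] using this
    · exact ⟨fun _ _ => 0, fun h => absurd h hp⟩
  choose P hP using hP
  have hcle (p) (hp : p ∈ E ×ˢ dyadicIndex ι k) : |c p.2 p.1| ≤ c₀ :=
    hc _ (Finset.mem_product.1 hp).2 _ (Finset.mem_product.1 hp).1
  have hcard : ((dyadicIndex ι k).card : ℝ) ≤ 2 ^ d * (s⁻¹) ^ d := by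
    unfold dyadicIndex
    rw [Fintype.card_piFinset, Finset.prod_const, Finset.card_univ, ← mul_pow]
    push_cast
    refine pow_le_pow_left₀ (by positivity) ?_ _
    have h1 : (1 : ℝ) ≤ 2 ^ k := one_le_pow₀ one_le_two
    have h2 : ((Finset.Icc (0 : ℤ) (2 ^ k)).card : ℝ) = 2 ^ k + 1 := by
      rw [Int.card_Icc]
      have : ((2 ^ k + 1 - 0 : ℤ).toNat : ℤ) = 2 ^ k + 1 := by
        have : (0 : ℤ) < 2 ^ k := by positivity
        omega
      exact_mod_cast this
    rw [h2, hs_def, inv_inv]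
    linarith
  refine ⟨fun m y => ∑ p ∈ E ×ˢ dyadicIndex ι k, c p.2 p.1 * P p m y, fun m hm => ?_,
    fun y hy => ?_⟩
  · refine (IsProductMixture.sum _ (c := fun p => c p.2 p.1)
      fun p hp => (hP p hp).1 m hm).mono ?_ (by positivity)
    have hτ : 0 < s * q ^ (m + 1) := by positivity
    have hX : 0 ≤ (V / (s * q ^ (m + 1))) ^ d := by positivity
    calc _ ≤ ∑ p ∈ E ×ˢ dyadicIndex ι k, c₀ * (C * (V * (s / (s * q ^ (m + 1)))) ^ d) :=
          Finset.sum_le_sum fun p hp => mul_le_mul_of_nonneg_right (hcle p hp) (by positivity)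
      _ = (dyadicIndex ι k).card * (E.card * (c₀ * (C * (V * (s / (s * q ^ (m + 1)))) ^ d))) := by
          rw [Finset.sum_const, Finset.card_product, nsmul_eq_mul]; push_cast; ring
      _ ≤ (2 ^ d * (s⁻¹) ^ d) * (E.card * (c₀ * (C * (V * (s / (s * q ^ (m + 1)))) ^ d))) :=
          mul_le_mul_of_nonneg_right hcard (by positivity)
      _ = (C * E.card * 2 ^ d) * c₀ * (V / (s * q ^ (m + 1))) ^ d := by
          rw [show V * (s / (s * q ^ (m + 1))) = s * (V / (s * q ^ (m + 1))) by ring, mul_pow s,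
            inv_pow]
          field_simp
      _ ≤ _ := by
          refine mul_le_mul_of_nonneg_right (mul_le_mul_of_nonneg_right ?_ hc₀) hX
          have : 0 ≤ C * E.card * S ^ d := by positivity
          nlinarith
  · have e1 : f y - ∑ m ∈ Finset.range b, ∑ p ∈ E ×ˢ dyadicIndex ι k, c p.2 p.1 * P p m y =
        ∑ p ∈ E ×ˢ dyadicIndex ι k, c p.2 p.1 * (∏ j, sh p j (2 ^ k * y j - p.2 j) -
          ∑ m ∈ Finset.range b, P p m y) := by
      rw [hf y hy, Finset.sum_comm (s := Finset.range b), ← Finset.sum_product',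
        ← Finset.sum_sub_distrib]
      refine Finset.sum_congr rfl fun p _ => ?_
      rw [mul_sub, Finset.mul_sum]
    -- At a fixed `y` the weights of all positions sum to a constant, so the errors of the roughly
    -- `2 ^ (k d)` shapes add up without a factor depending on `k`.
    have hsumpeak : ∑ i ∈ dyadicIndex ι k, ∏ j, peak (i j * s) s (y j) ≤ S ^ d := by
      unfold dyadicIndex
      rw [← Finset.prod_univ_sum (fun _ => Finset.Icc (0 : ℤ) (2 ^ k))
        (fun j i => peak (i * s) s (y j)), hd, ← Finset.card_univ, ← Finset.prod_const]
      refine Finset.prod_le_prod (fun j _ => Finset.sum_nonneg fun i _ => peak_nonneg _ _ _)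
        fun j _ => ?_
      refine le_trans (le_of_eq (Finset.sum_congr rfl fun i _ => ?_)) (hSum (y j / s) _)
      unfold peak
      rw [show (y j - i * s) / s = y j / s - i by field_simp]
    rw [e1]
    have hqN : 0 ≤ q ^ N := by positivity
    calc _ ≤ ∑ p ∈ E ×ˢ dyadicIndex ι k, c₀ * (C * q ^ N * ∏ j, peak (p.2 j * s) s (y j)) := by
          refine (Finset.abs_sum_le_sum_abs _ _).trans (Finset.sum_le_sum fun p hp => ?_)
          rw [abs_mul]
          exact mul_le_mul (hcle p hp) ((hP p hp).2 y hy) (abs_nonneg _) hc₀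
      _ = (C * E.card) * c₀ * q ^ N * ∑ i ∈ dyadicIndex ι k, ∏ j, peak (i j * s) s (y j) := by
          rw [Finset.sum_product]
          simp only [Finset.sum_const, nsmul_eq_mul, ← Finset.mul_sum]
          ring
      _ ≤ (C * E.card) * c₀ * q ^ N * S ^ d := mul_le_mul_of_nonneg_left hsumpeak (by positivity)
      _ = (C * E.card * S ^ d) * c₀ * q ^ N := by ring
      _ ≤ _ := by
          refine mul_le_mul_of_nonneg_right (mul_le_mul_of_nonneg_right ?_ hc₀) hqN
          have : 0 ≤ C * E.card * 2 ^ d := by positivity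
          nlinarith

/-! ### Finite sums of product kernels -/

/-- On the unit cube `f` is, up to `E`, a combination of at most `T` product kernels with centres in
the cube and bandwidths in `[τ₀, τ₁]`, with coefficients of total size at most `W`. -/
def IsKernelApprox {ι : Type} [Fintype ι] (K : ℝ → ℝ) (τ₀ τ₁ T W E : ℝ) (f : (ι → ℝ) → ℝ) : Prop :=
  ∃ (A : Type) (_ : Fintype A) (μ : A → ℝ) (c : A → ι → ℝ) (τ : A → ℝ),
    Fintype.card A ≤ T ∧ (∀ a j, c a j ∈ Set.Icc (0 : ℝ) 1) ∧ (∀ a, τ a ∈ Set.Icc τ₀ τ₁) ∧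
    ∑ a, |μ a| ≤ W ∧ ∀ y : ι → ℝ, (∀ j, y j ∈ Set.Icc (0 : ℝ) 1) →
      |f y - ∑ a, μ a * ∏ j, K ((y j - c a j) / τ a)| ≤ E

section

variable {ι : Type} [Fintype ι] {K : ℝ → ℝ} {τ₀ τ₁ T W E : ℝ} {f : (ι → ℝ) → ℝ}

lemma IsKernelApprox.zero : IsKernelApprox K τ₀ τ₁ 0 0 0 fun _ : ι → ℝ => 0 :=
  ⟨Empty, inferInstance, Empty.elim, fun a => a.elim, Empty.elim, by simp, fun a => a.elim,
    fun a => a.elim, by simp, by simp⟩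

lemma IsKernelApprox.mono (h : IsKernelApprox K τ₀ τ₁ T W E f) {τ₀' τ₁' T' W' E' : ℝ}
    (h0 : τ₀' ≤ τ₀) (h1 : τ₁ ≤ τ₁') (hT : T ≤ T') (hW : W ≤ W') (hE : E ≤ E') :
    IsKernelApprox K τ₀' τ₁' T' W' E' f := by
  obtain ⟨A, _, μ, c, τ, h2, h3, h4, h5, h6⟩ := h
  exact ⟨A, _, μ, c, τ, h2.trans hT, h3, fun a => ⟨h0.trans (h4 a).1, (h4 a).2.trans h1⟩,
    h5.trans hW, fun y hy => (h6 y hy).trans hE⟩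

lemma IsKernelApprox.add {T' W' E' : ℝ} {g : (ι → ℝ) → ℝ} (hf : IsKernelApprox K τ₀ τ₁ T W E f)
    (hg : IsKernelApprox K τ₀ τ₁ T' W' E' g) :
    IsKernelApprox K τ₀ τ₁ (T + T') (W + W') (E + E') fun y => f y + g y := by
  obtain ⟨A, _, μ, c, τ, h2, h3, h4, h5, h6⟩ := hf
  obtain ⟨A', _, μ', c', τ', h2', h3', h4', h5', h6'⟩ := hg
  refine ⟨A ⊕ A', inferInstance, Sum.elim μ μ', Sum.elim c c', Sum.elim τ τ', ?_, ?_, ?_, ?_,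
    fun y hy => ?_⟩
  · rw [Fintype.card_sum]
    push_cast
    exact add_le_add h2 h2'
  · rintro (a | a) j
    exacts [h3 a j, h3' a j]
  · rintro (a | a)
    exacts [h4 a, h4' a]
  · rw [Fintype.sum_sum_type]
    exact add_le_add h5 h5'
  · rw [Fintype.sum_sum_type]
    have e : f y + g y - (∑ a, μ a * ∏ j, K ((y j - c a j) / τ a) +
        ∑ a, μ' a * ∏ j, K ((y j - c' a j) / τ' a)) =
        (f y - ∑ a, μ a * ∏ j, K ((y j - c a j) / τ a)) +
          (g y - ∑ a, μ' a * ∏ j, K ((y j - c' a j) / τ' a)) := by ring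
    simp only [Sum.elim_inl, Sum.elim_inr]
    rw [e]
    exact (abs_add_le _ _).trans (add_le_add (h6 y hy) (h6' y hy))

lemma IsKernelApprox.sum {A : Type*} (s : Finset A) {T W E : A → ℝ} {f : A → (ι → ℝ) → ℝ}
    (h : ∀ a ∈ s, IsKernelApprox K τ₀ τ₁ (T a) (W a) (E a) (f a)) :
    IsKernelApprox K τ₀ τ₁ (∑ a ∈ s, T a) (∑ a ∈ s, W a) (∑ a ∈ s, E a)
      fun y => ∑ a ∈ s, f a y := by
  classical
  induction s using Finset.induction_on with
  | empty => simpa using IsKernelApprox.zero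
  | insert a s ha ih =>
    simp only [Finset.sum_insert ha]
    exact (h a (Finset.mem_insert_self _ _)).add
      (ih fun b hb => h b (Finset.mem_insert_of_mem hb))

lemma IsKernelApprox.of_abs_sub_le {E' : ℝ} {g : (ι → ℝ) → ℝ} (h : IsKernelApprox K τ₀ τ₁ T W E f)
    (hg : ∀ y : ι → ℝ, (∀ j, y j ∈ Set.Icc (0 : ℝ) 1) → |g y - f y| ≤ E') :
    IsKernelApprox K τ₀ τ₁ T W (E + E') g := by
  obtain ⟨A, _, μ, c, τ, h2, h3, h4, h5, h6⟩ := h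
  refine ⟨A, _, μ, c, τ, h2, h3, h4, h5, fun y hy => ?_⟩
  have := abs_add_le (f y - ∑ a, μ a * ∏ j, K ((y j - c a j) / τ a)) (g y - f y)
  rw [show f y - ∑ a, μ a * ∏ j, K ((y j - c a j) / τ a) + (g y - f y) =
    g y - ∑ a, μ a * ∏ j, K ((y j - c a j) / τ a) by ring] at this
  exact this.trans (add_le_add (h6 y hy) (hg y hy))

lemma IsProductMixture.isKernelApprox [DecidableEq ι] {τ η V : ℝ} {n : ℕ} {γ : Fin n → ℝ}
    (h : IsProductMixture K τ η γ V f) (hγ : ∀ i, γ i ∈ Set.Icc (0 : ℝ) 1) :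
    IsKernelApprox K τ τ ((n : ℝ) ^ Fintype.card ι) V (V * η) f := by
  obtain ⟨w, h1, h2⟩ := h
  refine ⟨ι → Fin n, inferInstance, w, fun σ j => γ (σ j), fun _ => τ, ?_, fun _ _ => hγ _,
    fun _ => ⟨le_rfl, le_rfl⟩, h1, fun y _ => h2 y⟩
  rw [Fintype.card_fun, Fintype.card_fin]
  push_cast
  exact le_rfl

end

lemma PolyApprox.nonneg {K : ℝ → ℝ} {M ρ : ℝ} (hρ : 0 < ρ) (h : PolyApprox K M ρ) : 0 ≤ M := by
  obtain ⟨a, ha⟩ := h 0 0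
  have := ha 0 (by simpa using hρ.le)
  simp only [pow_zero, mul_one] at this
  exact (abs_nonneg _).trans this

/-- All shapes of the level share the same `b` grids, one for each bandwidth. The number of kernels
is thus the number of points of the product grids and does not grow with the number of shapes. `V`
is both the number of nodes in a grid cell and the bound for the grid coefficients. -/
theorem IsShapeSum.isKernelApprox {K : ℝ → ℝ} (hK : IsKernel K) {M ρ : ℝ} (hρ : 0 < ρ)
    (hpoly : PolyApprox K M ρ) {MK : ℝ} (hMK : ∀ x, |K x| ≤ MK) (N : ℕ) (ι : Type) [Fintype ι]
    [DecidableEq ι] {b : ℕ} (hb : Fintype.card ι < b) {n₀ : ℕ} (a : Fin n₀ → Fin n₀ → ℝ) :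
    ∃ C > 0, ∀ (k V : ℕ) (q c₀ : ℝ) (f : (ι → ℝ) → ℝ),
      2 ≤ k → 0 < q → q ≤ 1 → 1 ≤ V → (V + 1) * (M * (1 / 2) ^ V) ≤ 1 → 0 ≤ c₀ →
      IsShapeSum a k c₀ f →
      IsKernelApprox K (((2 : ℝ) ^ k)⁻¹ * q ^ b) ((2 : ℝ) ^ k)⁻¹
        (C * (V / (((2 : ℝ) ^ k)⁻¹ * q ^ b)) ^ Fintype.card ι)
        (C * c₀ * (V / (((2 : ℝ) ^ k)⁻¹ * q ^ b)) ^ Fintype.card ι)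
        (C * c₀ * ((V / (((2 : ℝ) ^ k)⁻¹ * q ^ b)) ^ Fintype.card ι *
          ((V + 1) * (M * (1 / 2) ^ V)) + q ^ N)) f := by
  obtain ⟨C, hC, hmix⟩ := IsShapeSum.exists_mixtures hK hMK N ι hb a
  have hMK0 : 0 ≤ MK := (abs_nonneg _).trans (hMK 0)
  have hM := hpoly.nonneg hρ
  set d := Fintype.card ι with hd
  set C' := b * ((ρ⁻¹ + 1) ^ d) + b * C * (1 + d * (MK + 1) ^ d) + C with hC'
  have hC'0 : 0 < C' := by positivity
  refine ⟨C', hC'0, fun k V q c₀ f hk hq hq1 hV hη1 hc₀ hf => ?_⟩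
  set s : ℝ := ((2 : ℝ) ^ k)⁻¹ with hs_def
  set η : ℝ := (V + 1) * (M * (1 / 2) ^ V) with hη_def
  have hη : 0 ≤ η := by positivity
  have hs : 0 < s := by positivity
  have hs1 : s ≤ 1 := inv_le_one_of_one_le₀ (one_le_pow₀ one_le_two)
  have hV' : (1 : ℝ) ≤ V := by exact_mod_cast hV
  have hgrid (m : ℕ) := exists_grid hρ hpoly (τ := s * q ^ (m + 1)) (by positivity)
    (mul_le_one₀ hs1 (by positivity) (pow_le_one₀ hq.le hq1)) V
  choose n γ l hn hgrid using hgrid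
  obtain ⟨P, hP, hfP⟩ := hmix k q V η c₀ f n γ l hk hq hq1 hV' hη hη1 hc₀ hf fun m _ => hgrid m
  set X := (V / (s * q ^ b)) ^ d with hX
  have hX0 : 0 ≤ X := by positivity
  have hτ (m : ℕ) (hm : m ∈ Finset.range b) : s * q ^ b ≤ s * q ^ (m + 1) :=
    mul_le_mul_of_nonneg_left (pow_le_pow_of_le_one hq.le hq1 (Finset.mem_range.1 hm)) hs.le
  have hle (m : ℕ) (hm : m ∈ Finset.range b) : (V : ℝ) / (s * q ^ (m + 1)) ≤ V / (s * q ^ b) :=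
    div_le_div_of_nonneg_left (by positivity) (by positivity) (hτ m hm)
  have h1 : ∀ m ∈ Finset.range b, IsKernelApprox K (s * q ^ b) s ((ρ⁻¹ + 1) ^ d * X)
      (C * c₀ * X) (C * c₀ * X * (d * η * (MK + 1) ^ d)) (P m) := fun m hm => by
    refine ((hP m (Finset.mem_range.1 hm)).isKernelApprox (hgrid m).mem).mono (hτ m hm)
      (mul_le_of_le_one_right hs.le (pow_le_one₀ hq.le hq1)) ?_ ?_ ?_
    · rw [hX, ← mul_pow]
      refine pow_le_pow_left₀ (by positivity) ((hn m).trans ?_) _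
      exact mul_le_mul_of_nonneg_left (hle m hm) (by positivity)
    · exact mul_le_mul_of_nonneg_left (pow_le_pow_left₀ (by positivity) (hle m hm) _)
        (by positivity)
    · refine mul_le_mul_of_nonneg_right ?_ (by positivity)
      exact mul_le_mul_of_nonneg_left (pow_le_pow_left₀ (by positivity) (hle m hm) _)
        (by positivity)
  have h2 := (IsKernelApprox.sum _ h1).of_abs_sub_le hfP
  simp only [Finset.sum_const, Finset.card_range, nsmul_eq_mul] at h2
  have hqN : 0 ≤ q ^ N := by positivity
  have hD : 0 ≤ (d : ℝ) * (MK + 1) ^ d := by positivity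
  refine h2.mono le_rfl le_rfl ?_ ?_ ?_
  · rw [← mul_assoc]
    refine mul_le_mul_of_nonneg_right ?_ hX0
    have : 0 ≤ b * C * (1 + d * (MK + 1) ^ d) := by positivity
    linarith
  · have : b * (C * c₀ * X) = (b * C) * c₀ * X := by ring
    rw [this]
    refine mul_le_mul_of_nonneg_right (mul_le_mul_of_nonneg_right ?_ hc₀) hX0
    have h3 : 0 ≤ b * ((ρ⁻¹ + 1) ^ d) := by positivity
    have h4 : 0 ≤ b * C * (d * (MK + 1) ^ d) := by positivity
    nlinarith
  · have h3 : 0 ≤ b * ((ρ⁻¹ + 1) ^ d) := by positivity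
    have h4 : 0 ≤ b * C * (d * (MK + 1) ^ d) := by positivity
    have h5 : 0 ≤ b * C := by positivity
    calc b * (C * c₀ * X * (d * η * (MK + 1) ^ d)) + C * c₀ * q ^ N
        = (b * C * (d * (MK + 1) ^ d)) * (c₀ * (X * η)) + C * (c₀ * q ^ N) := by ring
      _ ≤ C' * (c₀ * (X * η)) + C' * (c₀ * q ^ N) :=
          add_le_add (mul_le_mul_of_nonneg_right (by nlinarith) (by positivity))
            (mul_le_mul_of_nonneg_right (by nlinarith) (by positivity))
      _ = _ := by ring

/-! ### Approximation of locally polynomial functions by product kernels -/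

lemma sum_pow_sub_le {r : ℝ} (h0 : 0 ≤ r) (h1 : r < 1) (n : ℕ) :
    ∑ i ∈ Finset.range n, r ^ (n - i) ≤ (1 - r)⁻¹ := by
  have h : ∑ i ∈ Finset.range n, r ^ (n - i) = ∑ i ∈ Finset.range n, r ^ (i + 1) := by
    rw [← Finset.sum_range_reflect]
    refine Finset.sum_congr rfl fun i hi => ?_
    have := Finset.mem_range.1 hi
    congr 1
    omega
  rw [h, ← tsum_geometric_of_lt_one h0 h1]
  refine le_trans (Finset.sum_le_sum fun i _ => pow_le_pow_of_le_one h0 h1.le (Nat.le_succ i)) ?_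
  exact (summable_geometric_of_lt_one h0 h1).sum_le_tsum _ fun i _ => by positivity

/-- Order `α` carries the error from level `k` to level `k + j`. The extra order leaves a factor `2
^ (-j)`, which makes the sum over levels converge. -/
lemma dyadic_rpow_mul_le {α : ℝ} {m : ℕ} (hm : α + 1 ≤ m) (k j : ℕ) :
    ((2 : ℝ) ^ (-(k : ℝ))) ^ α * (1 / 2) ^ (m * j) ≤
      (2 ^ (-((k + j : ℕ) : ℝ))) ^ α * (1 / 2) ^ j := by
  have e (i : ℕ) : (1 / 2 : ℝ) ^ i = 2 ^ (-(i : ℝ)) := by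
    rw [Real.rpow_neg zero_le_two, Real.rpow_natCast, one_div, inv_pow]
  rw [e, e, ← Real.rpow_mul zero_le_two, ← Real.rpow_mul zero_le_two, ← Real.rpow_add two_pos,
    ← Real.rpow_add two_pos]
  refine Real.rpow_le_rpow_of_exponent_le one_le_two ?_
  push_cast
  nlinarith [mul_le_mul_of_nonneg_right hm (Nat.cast_nonneg (α := ℝ) j)]

lemma dyadic_rpow_le_one {α : ℝ} (hα : 0 ≤ α) (k : ℕ) : ((2 : ℝ) ^ (-(k : ℝ))) ^ α ≤ 1 :=
  Real.rpow_le_one (by positivity)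
    (Real.rpow_le_one_of_one_le_of_nonpos one_le_two (by simp)) hα

-- Telescoping from level `k₀` to level `k₀ + J`. The level lying `j` steps above the finest one
-- uses the ratio `q = r ^ j`, whose smallest bandwidth is `2 ^ (-k) * ϱ ^ j` with `ϱ ^ 2 = 1 / 2`,
-- halfway on the logarithmic scale between its own scale and the finest. This is fine enough for an
-- error summable over levels and coarse enough that the kernel counts, at most a constant times `X
-- * ϱ ^ j`, form a geometric series. No further logarithm is lost.
set_option maxHeartbeats 1000000 in
theorem exists_isKernelApprox {K : ℝ → ℝ} (hK : IsKernel K) {M ρ : ℝ} (hρ : 0 < ρ)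
    (hpoly : PolyApprox K M ρ) {MK : ℝ} (hMK : ∀ x, |K x| ≤ MK) (ι : Type) [Fintype ι]
    [DecidableEq ι] [Nonempty ι] {n : ℕ} {x : Fin n → ℝ} {a : Fin n → Fin n → ℝ}
    (hx : IsInterpolation x a) {α C₁ R : ℝ} (hα : 0 ≤ α) (hC₁ : 0 ≤ C₁) (hR : 0 ≤ R) {k₀ : ℕ}
    (hk₀ : 2 ≤ k₀) :
    ∃ C > 0, ∀ (f : (ι → ℝ) → ℝ) (k₁ V : ℕ), LocallyReproduced x a α C₁ f →
      (∀ y : ι → ℝ, (∀ j, y j ∈ Set.Icc (0 : ℝ) 1) → |f y| ≤ R) → k₀ ≤ k₁ → 1 ≤ V →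
      (V + 1) * (M * (1 / 2) ^ V) ≤ 1 →
      IsKernelApprox K ((2 : ℝ) ^ k₁)⁻¹ ((2 : ℝ) ^ k₀)⁻¹
        (C * (V * 2 ^ k₁) ^ Fintype.card ι) (C * (V * 2 ^ k₁) ^ Fintype.card ι)
        (C * ((2 ^ (-(k₁ : ℝ))) ^ α +
          (V * 2 ^ k₁) ^ Fintype.card ι * ((V + 1) * (M * (1 / 2) ^ V)))) f := by
  set d := Fintype.card ι with hd
  have hd0 : d ≠ 0 := Fintype.card_ne_zero
  set b := d + 1 with hb
  obtain ⟨L, hL0, hL⟩ : ∃ L ≥ 0, ∀ ν, ∀ t ∈ Set.Icc (-6 : ℝ) 6, |polyVal (a ν) t| ≤ L := by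
    have h (ν : Fin n) : ∃ B, ∀ t ∈ Set.Icc (-6 : ℝ) 6, |polyVal (a ν) t| ≤ B :=
      isCompact_Icc.exists_bound_of_continuousOn (contDiff_polyVal (n := 0) (a ν)).continuous.continuousOn
    choose B hB using h
    have hB0 (ν) : 0 ≤ B ν := (abs_nonneg _).trans (hB ν 0 (by norm_num))
    exact ⟨∑ ν, B ν, Finset.sum_nonneg fun ν _ => hB0 ν, fun ν t ht => (hB ν t ht).trans
      (Finset.single_le_sum (fun ν _ => hB0 ν) (Finset.mem_univ ν))⟩
  -- Chosen so that `b` successive bandwidth ratios multiply to `ϱ = √(1 / 2)`.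
  set r : ℝ := (1 / 2 : ℝ) ^ (((2 * b : ℕ) : ℝ)⁻¹) with hr
  have hr0 : 0 < r := by positivity
  have hr1 : r ≤ 1 := Real.rpow_le_one (by norm_num) (by norm_num) (by positivity)
  have hr2 : r ^ (2 * b) = 1 / 2 := Real.rpow_inv_natCast_pow (by norm_num) (by omega)
  set ϱ := r ^ b with hϱ
  have hϱ0 : 0 < ϱ := by positivity
  have hϱ2 : ϱ * ϱ = 1 / 2 := by rw [hϱ, ← pow_add, ← two_mul, hr2]
  have hϱ1 : ϱ < 1 := by nlinarith
  have hϱ3 : 1 / 2 ≤ ϱ := by nlinarith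
  -- With order `N = 2 * b * m` the error `q ^ N` of a level with `q = r ^ j` is `(1 / 2) ^ (m *
  -- j)`.
  set m := ⌈α⌉₊ + 1 with hm
  have hm' : α + 1 ≤ m := by rw [hm]; push_cast; linarith [Nat.le_ceil α]
  obtain ⟨C₀, hC₀, hlevel⟩ :=
    IsShapeSum.isKernelApprox hK hρ hpoly hMK (2 * b * m) ι (show d < b by omega) a
  have hM := hpoly.nonneg hρ
  set Λ := interpConst ι n α C₁ L with hΛ
  have hΛ0 : 0 ≤ Λ := by rw [hΛ]; unfold interpConst; positivity
  set G := (1 - ϱ)⁻¹ with hG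
  have hG0 : 0 ≤ G := inv_nonneg.2 (by linarith)
  -- The coefficients of the coarsest level are only bounded by `R`; `e₀` compensates for the
  -- missing factor `2 ^ (-k₀ α)`.
  set e₀ := (((2 : ℝ) ^ (-(k₀ : ℝ))) ^ α)⁻¹ with he₀
  have he₀0 : 0 ≤ e₀ := by positivity
  set C := C₀ * (1 + Λ + R) * (G + 3 + e₀) + Λ with hC
  refine ⟨C, by positivity, fun f k₁ V hf hfR hk hV hη1 => ?_⟩
  set η : ℝ := (V + 1) * (M * (1 / 2) ^ V) with hη_def
  have hη : 0 ≤ η := by positivity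
  obtain ⟨J, rfl⟩ := Nat.exists_eq_add_of_le hk
  set X : ℝ := (V * 2 ^ (k₀ + J)) ^ d with hX
  have hX0 : 0 ≤ X := by positivity
  set ε : ℕ → ℝ := fun k => ((2 : ℝ) ^ (-(k : ℝ))) ^ α with hε
  have hε0 (k) : 0 ≤ ε k := by positivity
  -- the decomposition at one level
  have key (i : ℕ) (hi : i ≤ J) (c₀ : ℝ) (hc₀ : 0 ≤ c₀) (g : (ι → ℝ) → ℝ)
      (hg : IsShapeSum a (k₀ + i) c₀ g) :
      IsKernelApprox K ((2 : ℝ) ^ (k₀ + J))⁻¹ ((2 : ℝ) ^ k₀)⁻¹ (C₀ * (X * ϱ ^ (J - i)))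
        (C₀ * c₀ * (X * ϱ ^ (J - i)))
        (C₀ * c₀ * (X * ϱ ^ (J - i) * η + (1 / 2) ^ (m * (J - i)))) g := by
    obtain ⟨j, rfl⟩ := Nat.exists_eq_add_of_le hi
    rw [Nat.add_sub_cancel_left]
    have h := hlevel (k₀ + i) V (r ^ j) c₀ g (by omega) (by positivity)
      (pow_le_one₀ hr0.le hr1) hV hη1 hc₀ hg
    have e1 : (r ^ j) ^ b = ϱ ^ j := by rw [hϱ, ← pow_mul, ← pow_mul, mul_comm]
    have e2 : (r ^ j) ^ (2 * b * m) = (1 / 2) ^ (m * j) := by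
      rw [← hr2, ← pow_mul, ← pow_mul]; congr 1; ring
    have e3 : (V : ℝ) / (((2 : ℝ) ^ (k₀ + i))⁻¹ * ϱ ^ j) = V * 2 ^ (k₀ + (i + j)) * ϱ ^ j := by
      have : ϱ ^ j * ϱ ^ j * 2 ^ j = 1 := by
        rw [← mul_pow, hϱ2, ← mul_pow]; norm_num
      rw [← add_assoc, pow_add _ _ j, div_eq_iff (by positivity)]
      calc (V : ℝ) = V * (ϱ ^ j * ϱ ^ j * 2 ^ j) := by rw [this, mul_one]
        _ = _ := by field_simp
    -- Positive dimension is used here: without a variable the counts would not decay with `j`.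
    have e4 : (V * 2 ^ (k₀ + (i + j)) * ϱ ^ j) ^ d ≤ X * ϱ ^ j := by
      rw [mul_pow]
      exact mul_le_mul_of_nonneg_left
        (pow_le_of_le_one (by positivity) (pow_le_one₀ hϱ0.le hϱ1.le) hd0) hX0
    rw [e1, e2, e3] at h
    refine h.mono ?_ ?_ (mul_le_mul_of_nonneg_left e4 hC₀.le)
      (mul_le_mul_of_nonneg_left e4 (by positivity))
      (mul_le_mul_of_nonneg_left (by gcongr) (by positivity))
    · rw [← add_assoc, pow_add _ _ j, mul_inv]
      refine mul_le_mul_of_nonneg_left ?_ (by positivity)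
      rw [← inv_pow]
      exact pow_le_pow_left₀ (by norm_num) (by linarith) _
    · exact inv_anti₀ (by positivity) (pow_le_pow_right₀ one_le_two (by omega))
  set Q : ℕ → (ι → ℝ) → ℝ := fun k => quasiInterpolant x a k f with hQ
  have hbase := key 0 (Nat.zero_le _) R hR (Q k₀) (isShapeSum_quasiInterpolant hx k₀ hfR)
  have hdiff : ∀ i ∈ Finset.range J, _ := fun i hi =>
    key i (Finset.mem_range.1 hi).le _ (by positivity) _
      (isShapeSum_sub hx hα hC₁ hL0 hL hf (k₀ + i))
  have htotal := (hbase.add (IsKernelApprox.sum _ hdiff)).of_abs_sub_le (g := f)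
    (E' := Λ * ε (k₀ + J)) fun y hy => by
      have e : ∑ i ∈ Finset.range J, (quasiInterpolant x a (k₀ + i + 1) f y -
          quasiInterpolant x a (k₀ + i) f y) = Q (k₀ + J) y - Q k₀ y :=
        Finset.sum_range_sub (fun i => quasiInterpolant x a (k₀ + i) f y) J
      rw [e, add_sub_cancel]
      exact abs_sub_quasiInterpolant_le hx hC₁ hL hf _ hy
  simp only [Nat.sub_zero] at htotal
  have hs1 : ∑ i ∈ Finset.range J, ϱ ^ (J - i) ≤ G := sum_pow_sub_le hϱ0.le hϱ1 J
  have hs2 : ∑ i ∈ Finset.range J, (1 / 2 : ℝ) ^ (J - i) ≤ 2 :=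
    (sum_pow_sub_le (by norm_num) (by norm_num) J).trans (by norm_num)
  have hϱJ : ϱ ^ J ≤ 1 := pow_le_one₀ hϱ0.le hϱ1.le
  have hε1 (k) : ε k ≤ 1 := dyadic_rpow_le_one hα k
  refine htotal.mono le_rfl le_rfl ?_ ?_ ?_
  · rw [← Finset.mul_sum, ← Finset.mul_sum]
    calc C₀ * (X * ϱ ^ J) + C₀ * (X * ∑ i ∈ Finset.range J, ϱ ^ (J - i))
        ≤ C₀ * (X * 1) + C₀ * (X * G) := by gcongr
      _ = C₀ * 1 * (G + 1) * X := by ring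
      _ ≤ C * X := mul_le_mul_of_nonneg_right (by
          have : C₀ * 1 * (G + 1) ≤ C₀ * (1 + Λ + R) * (G + 3 + e₀) := by
            exact mul_le_mul (mul_le_mul_of_nonneg_left (by linarith) hC₀.le) (by linarith)
              (by positivity) (by positivity)
          linarith) hX0
  · calc C₀ * R * (X * ϱ ^ J) + ∑ i ∈ Finset.range J, C₀ * (Λ * ε (k₀ + i)) * (X * ϱ ^ (J - i))
        ≤ C₀ * R * (X * 1) + ∑ i ∈ Finset.range J, C₀ * (Λ * 1) * (X * ϱ ^ (J - i)) := by
          gcongr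
          exact hε1 _
      _ = C₀ * R * X + C₀ * Λ * X * ∑ i ∈ Finset.range J, ϱ ^ (J - i) := by
          rw [Finset.mul_sum]
          congr 1
          · ring
          · exact Finset.sum_congr rfl fun i _ => by ring
      _ ≤ C₀ * R * X + C₀ * Λ * X * G := by gcongr
      _ = (C₀ * (R * 1 + Λ * G)) * X := by ring
      _ ≤ C * X := mul_le_mul_of_nonneg_right (by
          have h1 : R * 1 + Λ * G ≤ (1 + Λ + R) * (G + 3 + e₀) := by
            have : 0 ≤ Λ * e₀ := by positivity
            have : 0 ≤ R * e₀ := by positivity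
            have : 0 ≤ R * G := by positivity
            nlinarith
          have h2 := mul_le_mul_of_nonneg_left h1 hC₀.le
          linarith) hX0
  · have hb1 : (1 / 2 : ℝ) ^ (m * J) ≤ e₀ * ε (k₀ + J) := by
      have h := dyadic_rpow_mul_le hm' k₀ J
      have h2 : (0 : ℝ) < (2 ^ (-(k₀ : ℝ))) ^ α := by positivity
      rw [he₀, ← div_eq_inv_mul, le_div_iff₀ h2, mul_comm]
      refine h.trans (mul_le_of_le_one_right (hε0 _) (pow_le_one₀ (by norm_num) (by norm_num)))
    have hb2 (i : ℕ) (hi : i ∈ Finset.range J) :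
        C₀ * (Λ * ε (k₀ + i)) * (X * ϱ ^ (J - i) * η + (1 / 2) ^ (m * (J - i))) ≤
          C₀ * Λ * (X * η) * ϱ ^ (J - i) + C₀ * Λ * ε (k₀ + J) * (1 / 2) ^ (J - i) := by
      have h := dyadic_rpow_mul_le hm' (k₀ + i) (J - i)
      rw [show k₀ + i + (J - i) = k₀ + J by have := Finset.mem_range.1 hi; omega] at h
      calc _ = C₀ * Λ * ((X * ϱ ^ (J - i) * η) * ε (k₀ + i)) +
            C₀ * Λ * (ε (k₀ + i) * (1 / 2) ^ (m * (J - i))) := by ring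
        _ ≤ C₀ * Λ * ((X * ϱ ^ (J - i) * η) * 1) +
            C₀ * Λ * (ε (k₀ + J) * (1 / 2) ^ (J - i)) := by
            gcongr
            exact hε1 _
        _ = _ := by ring
    have hεJ := hε0 (k₀ + J)
    calc C₀ * R * (X * ϱ ^ J * η + (1 / 2) ^ (m * J)) +
          ∑ i ∈ Finset.range J,
            C₀ * (Λ * ε (k₀ + i)) * (X * ϱ ^ (J - i) * η + (1 / 2) ^ (m * (J - i))) +
          Λ * ε (k₀ + J)
        ≤ C₀ * R * (X * 1 * η + e₀ * ε (k₀ + J)) +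
          (C₀ * Λ * (X * η) * ∑ i ∈ Finset.range J, ϱ ^ (J - i) +
            C₀ * Λ * ε (k₀ + J) * ∑ i ∈ Finset.range J, (1 / 2 : ℝ) ^ (J - i)) +
          Λ * ε (k₀ + J) := by
          rw [Finset.mul_sum, Finset.mul_sum, ← Finset.sum_add_distrib]
          exact add_le_add (add_le_add (by gcongr) (Finset.sum_le_sum hb2)) le_rfl
      _ ≤ C₀ * R * (X * 1 * η + e₀ * ε (k₀ + J)) +
          (C₀ * Λ * (X * η) * G + C₀ * Λ * ε (k₀ + J) * 2) + Λ * ε (k₀ + J) := by gcongr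
      _ = (C₀ * (R * e₀ + Λ * 2) + Λ) * ε (k₀ + J) + (C₀ * (R + Λ * G)) * (X * η) := by ring
      _ ≤ C * ε (k₀ + J) + C * (X * η) := by
          have h1 : 0 ≤ Λ * e₀ := by positivity
          have h2 : 0 ≤ R * e₀ := by positivity
          have h3 : 0 ≤ R * G := by positivity
          have h4 : 0 ≤ Λ * G := by positivity
          have h5 : R * e₀ + Λ * 2 ≤ (1 + Λ + R) * (G + 3 + e₀) := by nlinarith
          have h6 : R + Λ * G ≤ (1 + Λ + R) * (G + 3 + e₀) := by nlinarith
          have h7 := mul_le_mul_of_nonneg_left h5 hC₀.le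
          have h8 := mul_le_mul_of_nonneg_left h6 hC₀.le
          exact add_le_add (mul_le_mul_of_nonneg_right (by linarith) hεJ)
            (mul_le_mul_of_nonneg_right (by linarith) (by positivity))
      _ = _ := by rw [hε]; ring

/-! ### The effective kernel -/

/-- A real function with a bounded analytic extension to the strip `|Im z| ≤ ρ`. -/
def HasStripExtension (ρ M : ℝ) (f : ℝ → ℝ) : Prop :=
  ∃ F : ℂ → ℂ, AnalyticOnNhd ℂ F {z | |z.im| ≤ ρ} ∧ (∀ z : ℂ, |z.im| ≤ ρ → ‖F z‖ ≤ M) ∧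
    ∀ x : ℝ, F (x : ℂ) = (f x : ℂ)

section

variable {ρ M : ℝ} {f : ℝ → ℝ}

lemma closedBall_subset_strip (ρ x : ℝ) :
    Metric.closedBall (x : ℂ) ρ ⊆ {z | |z.im| ≤ ρ} := by
  intro z hz
  have h1 := Complex.abs_im_le_norm (z - x)
  rw [Complex.sub_im, Complex.ofReal_im, sub_zero] at h1
  exact h1.trans (mem_closedBall_iff_norm.1 hz)

lemma iteratedDeriv_eq_re {F : ℂ → ℂ} (hF : ∀ x : ℝ, AnalyticAt ℂ F x)
    (hFf : ∀ x : ℝ, F (x : ℂ) = (f x : ℂ)) (m : ℕ) :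
    iteratedDeriv m f = fun x : ℝ => (iteratedDeriv m F x).re := by
  induction m with
  | zero => funext x; simp [hFf]
  | succ m ih =>
    funext x
    rw [iteratedDeriv_succ, ih, iteratedDeriv_succ]
    have h : DifferentiableAt ℂ (iteratedDeriv m F) x := by
      have := ((hF x).iterated_deriv m).differentiableAt
      rwa [← iteratedDeriv_eq_iterate] at this
    exact h.hasDerivAt.real_of_complex.deriv

lemma HasStripExtension.norm_iteratedDeriv_le {F : ℂ → ℂ} (hρ : 0 < ρ)
    (hF : AnalyticOnNhd ℂ F {z | |z.im| ≤ ρ}) (hM : ∀ z : ℂ, |z.im| ≤ ρ → ‖F z‖ ≤ M) (m : ℕ)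
    (x : ℝ) : ‖iteratedDeriv m F x‖ ≤ m.factorial * M / ρ ^ m := by
  refine Complex.norm_iteratedDeriv_le_of_forall_mem_sphere_norm_le m hρ
    (hF.differentiableOn.diffContOnCl_ball (closedBall_subset_strip ρ x)) fun z hz => ?_
  exact hM z (closedBall_subset_strip ρ x (Metric.sphere_subset_closedBall hz))

lemma HasStripExtension.analyticOnNhd (hρ : 0 < ρ) (h : HasStripExtension ρ M f) :
    AnalyticOnNhd ℝ f Set.univ := by
  obtain ⟨F, hF, -, hFf⟩ := h
  intro x _
  have h1 : f = fun x : ℝ => (F x).re := by funext x; simp [hFf]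
  rw [h1]
  exact (hF x (by simpa using hρ.le)).re_ofReal

lemma HasStripExtension.abs_iteratedDeriv_le (hρ : 0 < ρ) (h : HasStripExtension ρ M f) (m : ℕ)
    (x : ℝ) : |iteratedDeriv m f x| ≤ m.factorial * M / ρ ^ m := by
  obtain ⟨F, hF, hM, hFf⟩ := h
  rw [iteratedDeriv_eq_re (fun x => hF x (by simpa using hρ.le)) hFf]
  exact (Complex.abs_re_le_norm _).trans (HasStripExtension.norm_iteratedDeriv_le hρ hF hM m x)

/-- By Cauchy's estimates on discs of radius `ρ` the Taylor coefficients are at most `M / ρ ^ n`.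
For `|y| ≤ ρ / 2` the series is dominated by a geometric one of ratio `1 / 2`, whose tail gives the
constant `2 * M`. -/
lemma HasStripExtension.polyApprox (hρ : 0 < ρ) (h : HasStripExtension ρ M f) :
    PolyApprox f (2 * M) (ρ / 2) := by
  obtain ⟨F, hF, hM, hFf⟩ := h
  intro N x
  refine ⟨fun j => (j.factorial : ℝ)⁻¹ * (-1) ^ j * (iteratedDeriv j F x).re, fun y hy => ?_⟩
  have hsub := closedBall_subset_strip ρ x
  have hz : ((x - y : ℝ) : ℂ) ∈ Metric.ball (x : ℂ) ρ := by
    rw [mem_ball_iff_norm, ← Complex.ofReal_sub, Complex.norm_real, Real.norm_eq_abs,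
      show x - y - x = -y by ring, abs_neg]
    linarith
  have h1 := Complex.hasSum_taylorSeries_on_ball
    ((hF.differentiableOn.mono hsub).mono Metric.ball_subset_closedBall) hz
  have h2 := Complex.reCLM.hasSum h1
  have e (n : ℕ) : Complex.reCLM ((n.factorial : ℂ)⁻¹ • (((x - y : ℝ) : ℂ) - x) ^ n •
      iteratedDeriv n F x) =
      (n.factorial : ℝ)⁻¹ * (-1) ^ n * (iteratedDeriv n F x).re * y ^ n := by
    have : (((n.factorial : ℂ)⁻¹ • (((x - y : ℝ) : ℂ) - x) ^ n • iteratedDeriv n F x)) =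
        (((n.factorial : ℝ)⁻¹ * (-y) ^ n : ℝ) : ℂ) * iteratedDeriv n F x := by
      push_cast
      rw [smul_eq_mul, smul_eq_mul, mul_assoc]
      ring_nf
    rw [this, Complex.reCLM_apply, Complex.re_ofReal_mul, neg_pow]
    ring
  simp only [e] at h2
  rw [Complex.reCLM_apply, hFf, Complex.ofReal_re] at h2
  have h3 := norm_sub_le_of_geometric_bound_of_hasSum (r := 1 / 2) (C := M) (by norm_num)
    (fun n => ?_) h2 N
  · rw [norm_sub_rev, Real.norm_eq_abs] at h3
    refine h3.trans (le_of_eq ?_)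
    ring
  · have h4 := HasStripExtension.norm_iteratedDeriv_le hρ hF hM n x
    have h5 := (Complex.abs_re_le_norm _).trans h4
    have hM0 : 0 ≤ M := (norm_nonneg _).trans (hM x (by simpa using hρ.le))
    rw [Real.norm_eq_abs, abs_mul, abs_mul, abs_mul, abs_pow, abs_pow, abs_neg, abs_one, one_pow,
      mul_one, abs_of_pos (by positivity : (0 : ℝ) < (n.factorial : ℝ)⁻¹)]
    calc _ ≤ (n.factorial : ℝ)⁻¹ * (n.factorial * M / ρ ^ n) * (ρ / 2) ^ n := by gcongr
      _ = _ := by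
        have : (n.factorial : ℝ) ≠ 0 := by positivity
        rw [div_pow, div_pow]
        field_simp
        simp

end

lemma one_add_sq_le {x y : ℝ} (h : |y - x| ≤ 1) : 1 + x ^ 2 ≤ 3 * (1 + y ^ 2) := by
  have := sq_le_one_iff_abs_le_one (a := y - x) |>.2 h
  nlinarith [sq_nonneg (2 * y - x), sq_nonneg y]

/-- A Lipschitz function with finite moments decays rapidly. -/
lemma exists_decay_of_moments {f : ℝ → ℝ} {B : ℝ} (hB : 0 < B)
    (hfB : ∀ x y, |f x - f y| ≤ B * |x - y|) (hf1 : ∀ x, |f x| ≤ B) (hf : Integrable f)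
    (hmom : ∀ m : ℕ, 0 < m → Integrable fun x => |x| ^ m * |f x|) (p : ℕ) :
    ∃ C > 0, ∀ x, |f x| * (1 + x ^ 2) ^ p ≤ C := by
  have hcont : Continuous f :=
    (LipschitzWith.of_dist_le_mul (K := B.toNNReal) fun x y => by
      rw [Real.dist_eq, Real.dist_eq, Real.coe_toNNReal _ hB.le]
      exact hfB x y).continuous
  have hint : Integrable fun y => (1 + y ^ 2) ^ (2 * p) * |f y| := by
    have h0 : Integrable fun y => (2 : ℝ) ^ (2 * p) * (|f y| + |y| ^ (2 * (2 * p) + 1) * |f y|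
        + |y| ^ (2 * (2 * p) + 1) * |f y|) + (2 : ℝ) ^ (2 * p) * |f y| :=
      (((hf.abs.add (hmom _ (by omega))).add (hmom _ (by omega))).const_mul _).add
        (hf.abs.const_mul _)
    refine h0.mono' (by fun_prop) (Filter.Eventually.of_forall fun y => ?_)
    rw [Real.norm_eq_abs, abs_of_nonneg (by positivity)]
    have h1 : (1 + y ^ 2) ^ (2 * p) ≤ 2 ^ (2 * p) * (1 + |y| ^ (2 * (2 * p) + 1)) := by
      rcases le_total |y| 1 with h | h
      · have h2 : 1 + y ^ 2 ≤ 2 := by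
          have := (sq_le_one_iff_abs_le_one (a := y)).2 h
          linarith
        calc (1 + y ^ 2) ^ (2 * p) ≤ 2 ^ (2 * p) * 1 := by
              rw [mul_one]; exact pow_le_pow_left₀ (by positivity) h2 _
          _ ≤ _ := by gcongr; linarith [pow_nonneg (abs_nonneg y) (2 * (2 * p) + 1)]
      · have h2 : 1 + y ^ 2 ≤ 2 * |y| ^ 2 := by
          rw [sq_abs]
          have := (one_le_sq_iff_one_le_abs y).2 h
          linarith
        calc (1 + y ^ 2) ^ (2 * p) ≤ (2 * |y| ^ 2) ^ (2 * p) :=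
              pow_le_pow_left₀ (by positivity) h2 _
          _ = 2 ^ (2 * p) * |y| ^ (2 * (2 * p)) := by rw [mul_pow, ← pow_mul]
          _ ≤ 2 ^ (2 * p) * |y| ^ (2 * (2 * p) + 1) := by
              exact mul_le_mul_of_nonneg_left (pow_le_pow_right₀ h (by omega)) (by positivity)
          _ ≤ _ := by gcongr; linarith
    have h3 := mul_le_mul_of_nonneg_right h1 (abs_nonneg (f y))
    refine h3.trans (le_of_sub_nonneg ?_)
    have : 0 ≤ 2 ^ (2 * p) * (|y| ^ (2 * (2 * p) + 1) * |f y|) + 2 ^ (2 * p) * |f y| := by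
      positivity
    linarith
  set I := ∫ y, (1 + y ^ 2) ^ (2 * p) * |f y| with hI
  have hI0 : 0 ≤ I := integral_nonneg fun y => by positivity
  refine ⟨4 * B * I * 3 ^ (2 * p) + 1, by positivity, fun x => ?_⟩
  -- On `[x, x + h]` the Lipschitz bound keeps `|f|` above `|f x| / 2`. The weighted integral over
  -- this interval is then at least a multiple of `(|f x| * (1 + x ^ 2) ^ p) ^ 2`, and the moments
  -- bound it. `h ≤ 1` makes the weights at `x` and `y` comparable.
  set h := |f x| / (2 * B) with hh
  have hh0 : 0 ≤ h := by positivity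
  have hh1 : h ≤ 1 := by
    rw [hh, div_le_one (by positivity)]
    linarith [hf1 x]
  have hlow : ∀ y ∈ Set.Icc x (x + h), ((1 + x ^ 2) / 3) ^ (2 * p) * (|f x| / 2) ≤
      (1 + y ^ 2) ^ (2 * p) * |f y| := fun y hy => by
    have h1 : |y - x| ≤ h := by
      rw [abs_of_nonneg (by linarith [hy.1])]
      linarith [hy.2]
    have h2 := one_add_sq_le (h1.trans hh1)
    have h3 : |f x| / 2 ≤ |f y| := by
      have h4 : |f x - f y| ≤ B * h :=
        (hfB x y).trans (mul_le_mul_of_nonneg_left (by rwa [abs_sub_comm]) hB.le)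
      rw [hh, show B * (|f x| / (2 * B)) = |f x| / 2 by field_simp] at h4
      linarith [abs_sub_abs_le_abs_sub (f x) (f y)]
    exact mul_le_mul (pow_le_pow_left₀ (by positivity) (by linarith) _) h3 (by positivity)
      (by positivity)
  have hle : ((1 + x ^ 2) / 3) ^ (2 * p) * (|f x| / 2) * h ≤ I := by
    calc _ = ∫ _y in Set.Icc x (x + h), ((1 + x ^ 2) / 3) ^ (2 * p) * (|f x| / 2) := by
          rw [setIntegral_const, Real.volume_real_Icc, add_sub_cancel_left, max_eq_left hh0,
            smul_eq_mul, mul_comm]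
      _ ≤ ∫ y in Set.Icc x (x + h), (1 + y ^ 2) ^ (2 * p) * |f y| :=
          setIntegral_mono_on (integrableOn_const (by simp)) hint.integrableOn measurableSet_Icc
            hlow
      _ ≤ I := setIntegral_le_integral hint (Filter.Eventually.of_forall fun y => by positivity)
  have hsq : (|f x| * (1 + x ^ 2) ^ p) ^ 2 ≤ 4 * B * I * 3 ^ (2 * p) := by
    have e : (|f x| * (1 + x ^ 2) ^ p) ^ 2 =
        ((1 + x ^ 2) / 3) ^ (2 * p) * (|f x| / 2) * h * (4 * B * 3 ^ (2 * p)) := by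
      rw [hh, div_pow, mul_pow, ← pow_mul, mul_comm p 2]
      field_simp
      ring
    rw [e]
    calc _ ≤ I * (4 * B * 3 ^ (2 * p)) := mul_le_mul_of_nonneg_right hle (by positivity)
      _ = _ := by ring
  nlinarith [sq_nonneg (|f x| * (1 + x ^ 2) ^ p - 1)]

/-- If a function with bounded second derivative decays rapidly, so does its derivative. -/
lemma exists_decay_deriv {u : ℕ → ℝ → ℝ} {B : ℝ} (hu : IsDerivChain 2 u) (hB : ∀ x, |u 2 x| ≤ B)
    (hdec : ∀ p : ℕ, ∃ C > 0, ∀ x, |u 0 x| * (1 + x ^ 2) ^ p ≤ C) (p : ℕ) :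
    ∃ C > 0, ∀ x, |u 1 x| * (1 + x ^ 2) ^ p ≤ C := by
  obtain ⟨C, hC, hdec⟩ := hdec (2 * p)
  have hB0 : 0 ≤ B := (abs_nonneg _).trans (hB 0)
  refine ⟨3 ^ (2 * p) * C + C + B, by positivity, fun x => ?_⟩
  -- The derivative is estimated by a difference quotient with this step. The values of `u 0` decay
  -- like `w ^ 2`, and the second order remainder is `B * w ^ 2`, so `u 1 x` is of order `w`.
  set w := ((1 + x ^ 2) ^ p)⁻¹ with hw
  have hX : (1 : ℝ) ≤ (1 + x ^ 2) ^ p := one_le_pow₀ (by nlinarith [sq_nonneg x])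
  have hw0 : 0 < w := by positivity
  have hw1 : w ≤ 1 := inv_le_one_of_one_le₀ hX
  have ht := abs_sub_taylor_le convex_univ 2 (u := u) (x := x) (y := x + w) (B := B) (c := 0)
    (fun m hm y _ => (hu m hm y).hasDerivWithinAt) (Set.mem_univ _)
    (fun y _ => by simpa using hB y) (Set.mem_univ _)
  simp only [Finset.sum_range_succ, Finset.sum_range_zero, add_sub_cancel_left, zero_mul, zero_div,
    sub_zero, pow_zero, Nat.factorial_zero, Nat.factorial_one, Nat.cast_one, pow_one, mul_one,
    div_one, zero_add, abs_of_pos hw0] at ht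
  have h1 : |u 1 x| * w ≤ |u 0 (x + w)| + |u 0 x| + B * w ^ 2 := by
    rw [← abs_of_pos hw0, ← abs_mul, abs_of_pos hw0]
    have e : u 1 x * w = u 0 (x + w) - u 0 x - (u 0 (x + w) - (u 0 x + u 1 x * w)) := by ring
    rw [e]
    exact (abs_sub _ _).trans (add_le_add (abs_sub _ _) ht)
  have h2 : |u 0 (x + w)| * (1 + x ^ 2) ^ (2 * p) ≤ 3 ^ (2 * p) * C := by
    have h3 : 1 + x ^ 2 ≤ 3 * (1 + (x + w) ^ 2) :=
      one_add_sq_le (by rwa [add_sub_cancel_left, abs_of_pos hw0])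
    calc _ ≤ |u 0 (x + w)| * (3 * (1 + (x + w) ^ 2)) ^ (2 * p) := by gcongr
      _ = 3 ^ (2 * p) * (|u 0 (x + w)| * (1 + (x + w) ^ 2) ^ (2 * p)) := by rw [mul_pow]; ring
      _ ≤ _ := mul_le_mul_of_nonneg_left (hdec _) (by positivity)
  have h4 := hdec x
  have e1 : (1 + x ^ 2) ^ p = w⁻¹ := by rw [hw, inv_inv]
  have e2 : (1 + x ^ 2) ^ (2 * p) = w⁻¹ ^ 2 := by rw [mul_comm, pow_mul, e1]
  rw [e2] at h2 h4
  rw [e1]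
  calc |u 1 x| * w⁻¹ = |u 1 x| * w * w⁻¹ ^ 2 := by field_simp
    _ ≤ (|u 0 (x + w)| + |u 0 x| + B * w ^ 2) * w⁻¹ ^ 2 :=
        mul_le_mul_of_nonneg_right h1 (by positivity)
    _ = |u 0 (x + w)| * w⁻¹ ^ 2 + |u 0 x| * w⁻¹ ^ 2 + B := by field_simp
    _ ≤ _ := by linarith

namespace AssumptionG

variable {ψ : ℝ → ℝ}

/-- The effective kernel. -/
def kernel (ψ : ℝ → ℝ) (x : ℝ) : ℝ := ψ x * (1 - ψ x)

lemma exists_hasStripExtension (h : AssumptionG ψ) :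
    ∃ ρ > 0, ∃ M > 0, HasStripExtension ρ M (kernel ψ) := by
  obtain ⟨ρ, hρ, F, hF, ⟨M, hM⟩, hFψ⟩ := h.analytic
  exact ⟨ρ, hρ, |M| + 1, by positivity, F, hF,
    fun z hz => (hM z hz).trans ((le_abs_self M).trans (by linarith)), hFψ⟩

/-- Cauchy's estimates bound every derivative. So the kernel is Lipschitz, and its moments give
rapid decay. Decay then passes from each derivative to the next because the second one after it is
bounded. -/
theorem isKernel (h : AssumptionG ψ) : IsKernel (kernel ψ) := by
  obtain ⟨ρ, hρ, M, hM, hext⟩ := h.exists_hasStripExtension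
  have han := hext.analyticOnNhd hρ
  have hcd {n : ℕ} : ContDiff ℝ n (kernel ψ) := han.contDiff
  refine ⟨han, fun m => ?_, h.integral_pos⟩
  induction m with
  | zero =>
    intro p
    have h1 (x : ℝ) : |deriv (kernel ψ) x| ≤ M / ρ := by
      simpa [iteratedDeriv_one] using hext.abs_iteratedDeriv_le hρ 1 x
    have h0 (x : ℝ) : |kernel ψ x| ≤ M := by simpa using hext.abs_iteratedDeriv_le hρ 0 x
    have hM' : 0 < M / ρ := by positivity
    simp only [iteratedDeriv_zero]
    refine exists_decay_of_moments (f := kernel ψ) (B := M + M / ρ) (by positivity) (fun x y => ?_)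
      (fun x => by linarith [h0 x]) h.integrable h.moments p
    have := Convex.norm_image_sub_le_of_norm_deriv_le (f := kernel ψ) (C := M + M / ρ)
      (fun x _ => (hcd (n := 1)).differentiable (by norm_num) x)
      (fun x _ => by rw [Real.norm_eq_abs]; linarith [h1 x]) convex_univ (Set.mem_univ y)
      (Set.mem_univ x)
    simpa using this
  | succ m ih =>
    have hch : IsDerivChain 2 fun i => iteratedDeriv (i + m) (kernel ψ) := by
      have := (isDerivChain_iteratedDeriv (hcd (n := m + 2))).shift m
      simpa using this
    have := exists_decay_deriv hch (fun x => hext.abs_iteratedDeriv_le hρ (2 + m) x)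
      (by simpa using ih)
    simpa [add_comm] using this

/-- Boundedness of `ψ` comes from that of the kernel, since `(ψ - 1 / 2) ^ 2 = 1 / 4 - ψ (1 - ψ)`.
-/
lemma abs_le (h : AssumptionG ψ) : ∃ M ≥ 1, ∀ x, |ψ x| ≤ M ∧ |1 - ψ x| ≤ M := by
  obtain ⟨ρ, hρ, M, hM, hext⟩ := h.exists_hasStripExtension
  have h0 (x : ℝ) : |ψ x * (1 - ψ x)| ≤ M := by
    have := hext.abs_iteratedDeriv_le hρ 0 x
    simp only [iteratedDeriv_zero, pow_zero, Nat.factorial_zero, Nat.cast_one, one_mul,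
      div_one] at this
    exact this
  refine ⟨M + 1, by linarith, fun x => ?_⟩
  have h1 := _root_.abs_le.1 (h0 x)
  have h2 : (ψ x - 1 / 2) ^ 2 ≤ (M + 1 / 2) ^ 2 := by nlinarith
  have h3 := abs_le_of_sq_le_sq' h2 (by linarith)
  constructor <;> rw [_root_.abs_le] <;> constructor <;> linarith [h3.1, h3.2]

lemma exists_lipschitz (h : AssumptionG ψ) : ∃ L ≥ 0, ∀ x y, |ψ x - ψ y| ≤ L * |x - y| := by
  obtain ⟨L, hL⟩ := h.deriv_bounded
  refine ⟨L, (abs_nonneg _).trans (hL 0), fun x y => ?_⟩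
  simpa using Convex.norm_image_sub_le_of_norm_deriv_le (f := ψ) (C := L)
    (fun x _ => h.differentiable x) (fun x _ => hL x) convex_univ (Set.mem_univ y) (Set.mem_univ x)

end AssumptionG

/-! ### Local polynomial approximation of Hölder functions -/

lemma uniqueDiffOn_cube (p : ℕ) : UniqueDiffOn ℝ (cube p) := by
  have h : UniqueDiffOn ℝ (Set.pi Set.univ fun _ : Fin p => Set.Icc (0 : ℝ) 1) :=
    UniqueDiffOn.univ_pi fun _ => uniqueDiffOn_Icc zero_lt_one
  have h2 := (EuclideanSpace.equiv (Fin p) ℝ).uniqueDiffOn_preimage_iff.2 h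
  have e : cube p = EuclideanSpace.equiv (Fin p) ℝ ⁻¹' Set.pi Set.univ fun _ => Set.Icc 0 1 := by
    ext x
    simp only [cube, Set.mem_preimage, Set.mem_pi, Set.mem_univ, true_implies]
    rfl
  rw [e]
  exact h2

/-- The point with coordinates `y i` at `σ i` and `0` elsewhere. -/
noncomputable def coordEmbed {ι : Type} [Fintype ι] {p : ℕ} (σ : ι → Fin p) (y : ι → ℝ) :
    EuclideanSpace ℝ (Fin p) := ∑ i, y i • EuclideanSpace.single (σ i) (1 : ℝ)

section

variable {ι : Type} [Fintype ι] {p : ℕ} {σ : ι → Fin p}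

lemma coordEmbed_apply (σ : ι → Fin p) (y : ι → ℝ) (j : Fin p) :
    coordEmbed σ y j = ∑ i, if σ i = j then y i else 0 := by
  unfold coordEmbed
  simp [Pi.single_apply, eq_comm]

lemma coordEmbed_apply_self (hσ : Function.Injective σ) (y : ι → ℝ) (i : ι) :
    coordEmbed σ y (σ i) = y i := by
  classical
  rw [coordEmbed_apply]
  simp [hσ.eq_iff]

lemma coordEmbed_mem_cube (hσ : Function.Injective σ) {y : ι → ℝ}
    (hy : ∀ i, y i ∈ Set.Icc (0 : ℝ) 1) : coordEmbed σ y ∈ cube p := by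
  intro j
  by_cases h : ∃ i, σ i = j
  · obtain ⟨i, rfl⟩ := h
    rw [coordEmbed_apply_self hσ]
    exact hy i
  · push Not at h
    rw [coordEmbed_apply]
    simp [h]

lemma norm_coordEmbed_le (σ : ι → Fin p) (y : ι → ℝ) {δ : ℝ} (hy : ∀ i, |y i| ≤ δ) :
    ‖coordEmbed σ y‖ ≤ Fintype.card ι * δ := by
  unfold coordEmbed
  refine (norm_sum_le _ _).trans ?_
  calc _ ≤ ∑ _i : ι, δ := Finset.sum_le_sum fun i _ => by
        rw [norm_smul, PiLp.norm_single, norm_one, mul_one]; exact hy i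
    _ = _ := by simp

lemma coordEmbed_add_smul (σ : ι → Fin p) (y z : ι → ℝ) (t : ℝ) :
    coordEmbed σ (fun i => z i + t * (y i - z i)) =
      coordEmbed σ z + t • coordEmbed σ (fun i => y i - z i) := by
  unfold coordEmbed
  rw [Finset.smul_sum, ← Finset.sum_add_distrib]
  exact Finset.sum_congr rfl fun i _ => by rw [smul_smul, ← add_smul]

lemma iteratedFDerivWithin_coordEmbed (f : EuclideanSpace ℝ (Fin p) → ℝ) (m : ℕ)
    (x : EuclideanSpace ℝ (Fin p)) (v : ι → ℝ) [DecidableEq ι] :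
    iteratedFDerivWithin ℝ m f (cube p) x (fun _ => coordEmbed σ v) =
      ∑ i : Fin m → ι, (∏ r, v (i r)) * partialDeriv f (fun r => σ (i r)) x := by
  unfold coordEmbed partialDeriv
  rw [ContinuousMultilinearMap.map_sum]
  refine Finset.sum_congr rfl fun i _ => ?_
  rw [ContinuousMultilinearMap.map_smul_univ, smul_eq_mul]

/-- The local model is the Taylor polynomial at `z` in the relevant coordinates, of total degree at
most `⌈α⌉₊ - 1`, so the interpolation with `⌈α⌉₊` nodes per variable recovers it. The remainder
follows from `abs_sub_taylor_le` along the segment from `z` to `y`, with `c` the top directional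
derivative at `z`; the segment stays in the cube, where the derivatives live. -/
theorem HolderBall.locallyReproduced [DecidableEq ι] {α R : ℝ} (hα : 0 < α)
    {f : EuclideanSpace ℝ (Fin p) → ℝ} (hf : f ∈ HolderBall p α R) (hσ : Function.Injective σ)
    {x : Fin ⌈α⌉₊ → ℝ} {a : Fin ⌈α⌉₊ → Fin ⌈α⌉₊ → ℝ} (hx : IsInterpolation x a) :
    LocallyReproduced x a α (R * Fintype.card ι ^ (⌈α⌉₊ - 1) *
      (Fintype.card ι : ℝ) ^ (α - (⌈α⌉₊ - 1 : ℕ))) fun y : ι → ℝ => f (coordEmbed σ y) := by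
  obtain ⟨hcd, M, L, hM, hL, hML, -, hH⟩ := hf
  set β := ⌈α⌉₊ - 1 with hβ
  have hceil : 0 < ⌈α⌉₊ := Nat.ceil_pos.2 hα
  have hβα : (β : ℝ) < α := Nat.lt_ceil.1 (by omega)
  intro z hz
  refine ⟨fun y => ∑ m ∈ Finset.range (β + 1), (m.factorial : ℝ)⁻¹ * ∑ i : Fin m → ι,
    partialDeriv f (fun r => σ (i r)) (coordEmbed σ z) * ∏ r, (y (i r) - z (i r)), ?_, ?_⟩
  · refine Reproduced.sum _ _ fun m hm => Reproduced.sum _ _ fun i _ =>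
      hx.reproduced_monomial ?_ i z
    have := Finset.mem_range.1 hm
    omega
  · intro y hy δ hδ hδ0
    set w := coordEmbed σ fun i => y i - z i with hw
    set g : ℝ → EuclideanSpace ℝ (Fin p) := fun t => coordEmbed σ z + t • w with hg
    have hgmem (t : ℝ) (ht : t ∈ Set.Icc (0 : ℝ) 1) : g t ∈ cube p := by
      rw [hg, hw]
      simp only
      rw [← coordEmbed_add_smul]
      refine coordEmbed_mem_cube hσ fun i => ?_
      have h1 := hy i
      have h2 := hz i
      constructor <;> nlinarith [h1.1, h1.2, h2.1, h2.2, ht.1, ht.2]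
    have hg' (t : ℝ) : HasDerivWithinAt g w (Set.Icc 0 1) t := by
      have := ((hasDerivAt_id t).smul_const w).const_add (coordEmbed σ z)
      rw [one_smul] at this
      exact this.hasDerivWithinAt
    set u : ℕ → ℝ → ℝ := fun m t => iteratedFDerivWithin ℝ m f (cube p) (g t) fun _ => w with hu
    have hchain (m : ℕ) (hm : m < β) (t : ℝ) (ht : t ∈ Set.Icc (0 : ℝ) 1) :
        HasDerivWithinAt (u m) (u (m + 1) t) (Set.Icc 0 1) t := by
      have h1 := (hcd.differentiableOn_iteratedFDerivWithin (m := m) (by exact_mod_cast hm)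
        (uniqueDiffOn_cube p) (g t) (hgmem t ht)).hasFDerivWithinAt
      have h2 := h1.comp_hasDerivWithinAt t (hg' t) fun r hr => hgmem r hr
      have h3 := (ContinuousMultilinearMap.apply ℝ (fun _ : Fin m => EuclideanSpace ℝ (Fin p)) ℝ
        fun _ => w).hasFDerivAt.comp_hasDerivWithinAt t h2
      exact h3
    have hbound (t : ℝ) (ht : t ∈ Set.Icc (0 : ℝ) 1) : |u β t - u β 0| ≤
        R * Fintype.card ι ^ β * (Fintype.card ι : ℝ) ^ (α - (β : ℕ)) * δ ^ α := by
      have hnorm : ‖g t - g 0‖ ≤ Fintype.card ι * δ := by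
        have h1 : g t - g 0 = t • w := by rw [hg]; simp
        rw [h1, norm_smul, Real.norm_eq_abs, abs_of_nonneg ht.1]
        exact (mul_le_of_le_one_left (norm_nonneg _) ht.2).trans (norm_coordEmbed_le _ _ hδ)
      rw [hu]
      simp only
      rw [iteratedFDerivWithin_coordEmbed, iteratedFDerivWithin_coordEmbed,
        ← Finset.sum_sub_distrib]
      calc _ ≤ ∑ _i : Fin β → ι, δ ^ β * (R * (Fintype.card ι * δ) ^ (α - (β : ℕ))) := by
            refine (Finset.abs_sum_le_sum_abs _ _).trans (Finset.sum_le_sum fun i _ => ?_)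
            rw [← mul_sub, abs_mul]
            refine mul_le_mul ?_ ?_ (abs_nonneg _) (by positivity)
            · have := abs_prod_le_pow (Finset.univ : Finset (Fin β))
                (a := fun r => y (i r) - z (i r)) fun r _ => hδ (i r)
              simpa using this
            · refine (hH _ _ (hgmem t ht) _ (hgmem 0 ⟨le_rfl, zero_le_one⟩)).trans ?_
              exact mul_le_mul (by linarith)
                (Real.rpow_le_rpow (norm_nonneg _) hnorm (by linarith)) (by positivity)
                (by linarith)
        _ = R * Fintype.card ι ^ β * (Fintype.card ι : ℝ) ^ (α - (β : ℕ)) *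
            (δ ^ (β : ℝ) * δ ^ (α - (β : ℕ))) := by
            rw [Finset.sum_const, Finset.card_univ, Fintype.card_fun, Fintype.card_fin,
              nsmul_eq_mul, Real.mul_rpow (by positivity) hδ0, Real.rpow_natCast]
            push_cast; ring
        _ = _ := by
            rw [← Real.rpow_add_of_nonneg hδ0 (by positivity) (by linarith), add_sub_cancel]
    have h := abs_sub_taylor_le (convex_Icc (0 : ℝ) 1) β (u := u) (x := 0) (y := 1) (c := u β 0)
      hchain ⟨le_rfl, zero_le_one⟩ hbound ⟨zero_le_one, le_rfl⟩
    simp only [sub_zero, one_pow, mul_one, abs_one] at h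
    have e0 : u 0 1 = f (coordEmbed σ y) := by
      rw [hu]
      simp only [iteratedFDerivWithin_zero_apply]
      rw [hg, hw]
      simp only
      rw [← coordEmbed_add_smul]
      congr 2
      funext i
      ring
    have e1 (m : ℕ) : u m 0 / m.factorial = (m.factorial : ℝ)⁻¹ * ∑ i : Fin m → ι,
        partialDeriv f (fun r => σ (i r)) (coordEmbed σ z) * ∏ r, (y (i r) - z (i r)) := by
      rw [hu]
      simp only
      rw [iteratedFDerivWithin_coordEmbed, div_eq_inv_mul]
      congr 1
      refine Finset.sum_congr rfl fun i _ => ?_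
      simp only [hg, zero_smul, add_zero]
      rw [mul_comm]
    simp only [Finset.sum_range_succ, ← e1, ← e0]
    rw [← sub_sub]
    exact h

lemma HolderBall.abs_le {α R : ℝ} {f : EuclideanSpace ℝ (Fin p) → ℝ} (hf : f ∈ HolderBall p α R)
    {x : EuclideanSpace ℝ (Fin p)} (hx : x ∈ cube p) : |f x| ≤ R := by
  obtain ⟨-, M, L, hM, hL, hML, hB, -⟩ := hf
  have := hB 0 (Nat.zero_le _) Fin.elim0 x hx
  unfold partialDeriv at this
  rw [iteratedFDerivWithin_zero_apply] at this
  linarith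

end

/-! ### The soft tree of a product kernel -/

/-- The path that goes left and right in turns, up to depth `2 * r`. -/
def spine : ℕ → Node
  | 0 => []
  | r + 1 => true :: false :: spine r

@[simp] lemma length_spine (r : ℕ) : (spine r).length = 2 * r := by
  induction r with
  | zero => rfl
  | succ r ih => simp [spine, ih]; ring

/-- The nodes of depth `k`. -/
noncomputable def nodesAt (k : ℕ) : Finset Node := (List.finite_length_eq Bool k).toFinset

@[simp] lemma mem_nodesAt {k : ℕ} {v : Node} : v ∈ nodesAt k ↔ v.length = k := by
  simp [nodesAt]

/-- The branch indicators `B` describe the full binary tree of depth `k`. -/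
def IsFull (B : Node → Bool) (k : ℕ) : Prop := ∀ u : Node, u.length ≤ k → B u = decide (u.length < k)

lemma IsFull.isNode_iff {B : Node → Bool} {k : ℕ} (h : IsFull B k) (v : Node) :
    IsNode B v ↔ v.length ≤ k := by
  induction v with
  | nil => simp [IsNode]
  | cons b u ih =>
    rw [IsNode, ih, List.length_cons]
    constructor
    · rintro ⟨h1, h2⟩
      rw [h u h1, decide_eq_true_eq] at h2
      omega
    · intro h1
      exact ⟨by omega, by rw [h u (by omega), decide_eq_true_eq]; omega⟩

lemma IsFull.isLeaf_iff {B : Node → Bool} {k : ℕ} (h : IsFull B k) (v : Node) :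
    IsLeaf B v ↔ v.length = k := by
  rw [IsLeaf, h.isNode_iff]
  constructor
  · rintro ⟨h1, h2⟩
    rw [h v h1, decide_eq_false_iff_not] at h2
    omega
  · intro h1
    exact ⟨h1.le, by rw [h v h1.le, decide_eq_false_iff_not]; omega⟩

section

variable {p : ℕ} {ψ : ℝ → ℝ} {J : Node → Fin p} {V : Node → unitInterval} {τ : ℝ}
  {x : EuclideanSpace ℝ (Fin p)}

lemma IsFull.softTree_eq {B : Node → Bool} {k : ℕ} (h : IsFull B k) (μ : Node → ℝ) :
    softTree ψ B J V μ τ x = ∑ v ∈ nodesAt k, μ v * weight ψ J V τ x v := by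
  have e : {v : Node | IsLeaf B v} = (nodesAt k : Set Node) := by
    ext v
    simp [h.isLeaf_iff]
  unfold softTree
  rw [e, finsum_mem_coe_finset]

lemma abs_weight_le {M : ℝ} (hM : ∀ x, |ψ x| ≤ M ∧ |1 - ψ x| ≤ M) (v : Node) :
    |weight ψ J V τ x v| ≤ M ^ v.length := by
  have hM0 : 0 ≤ M := (abs_nonneg _).trans (hM 0).1
  induction v with
  | nil => simp [weight]
  | cons b u ih =>
    rw [weight, abs_mul, List.length_cons, pow_succ]
    refine mul_le_mul ih ?_ (abs_nonneg _) (by positivity)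
    split
    exacts [(hM _).2, (hM _).1]

variable {σ : ℕ → Fin p} {d : ℕ}

/-- Only coordinates `σ i` with `i < r` have been cut above `spine r`, so the first cut along a new
coordinate ranges over all of `[0,1]`. -/
lemma cell_spine (hJ : ∀ u : Node, u.length < 2 * d → J u = σ (u.length / 2)) {r : ℕ} (hr : r ≤ d)
    {j : Fin p} (hj : ∀ i < r, σ i ≠ j) : cell J V (spine r) j = (0, 1) := by
  induction r with
  | zero => rfl
  | succ r ih =>
    have h1 : J (spine r) = σ r := by
      rw [hJ _ (by rw [length_spine]; omega), length_spine]; congr 1; omega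
    have h2 : J (false :: spine r) = σ r := by
      rw [hJ _ (by rw [List.length_cons, length_spine]; omega), List.length_cons, length_spine]
      congr 1; omega
    have hne : j ≠ σ r := (hj r (Nat.lt_succ_self r)).symm
    rw [spine, cell, h2, Function.update_of_ne hne, cell, h1, Function.update_of_ne hne]
    exact ih (by omega) fun i hi => hj i (by omega)

/-- The first cut along `σ i` is at `V (spine i)`. After the step to the left the side is `[0, V
(spine i)]`, so the second cut is at the fraction `V (false :: spine i)` of it. When this fraction
is near `1` the two cuts agree and the factor becomes `ψ (1 - ψ)`. Hence the depth `2 * d`. -/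
lemma weight_spine (hσ : Set.InjOn σ (Set.Iio d))
    (hJ : ∀ u : Node, u.length < 2 * d → J u = σ (u.length / 2)) {r : ℕ} (hr : r ≤ d) :
    weight ψ J V τ x (spine r) = ∏ i ∈ Finset.range r, (ψ ((x (σ i) - V (spine i)) / τ) *
      (1 - ψ ((x (σ i) - V (false :: spine i) * V (spine i)) / τ))) := by
  induction r with
  | zero => rfl
  | succ r ih =>
    have h1 : J (spine r) = σ r := by
      rw [hJ _ (by rw [length_spine]; omega), length_spine]; congr 1; omega
    have h2 : J (false :: spine r) = σ r := by
      rw [hJ _ (by rw [List.length_cons, length_spine]; omega), List.length_cons, length_spine]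
      congr 1; omega
    have hc : cell J V (spine r) (σ r) = (0, 1) := cell_spine hJ (by omega) fun i hi h =>
      hi.ne (hσ (show i < d by omega) (show r < d by omega) h)
    have hc1 : cutPoint J V (spine r) = V (spine r) := by
      rw [cutPoint, h1, hc]; simp
    have hc2 : cutPoint J V (false :: spine r) = V (false :: spine r) * V (spine r) := by
      rw [cutPoint, h2, cell, h1, hc]; simp
    rw [Finset.prod_range_succ, ← ih (by omega), spine, weight, weight, hc1, hc2, h1, h2]
    simp only [Bool.false_eq_true, if_false, if_true]
    ring

/-- The soft tree of a full binary tree whose parameters are `δ`-close to those of a multiple of a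
product kernel. -/
theorem IsFull.abs_softTree_sub_le {M L : ℝ} (hM1 : 1 ≤ M) (hM : ∀ x, |ψ x| ≤ M ∧ |1 - ψ x| ≤ M)
    (hL0 : 0 ≤ L) (hL : ∀ x y, |ψ x - ψ y| ≤ L * |x - y|) {B : Node → Bool} (hB : IsFull B (2 * d))
    (hσ : Set.InjOn σ (Set.Iio d))
    (hJ : ∀ u : Node, u.length < 2 * d → J u = σ (u.length / 2)) {δ : ℝ} (hδ : 0 ≤ δ)
    {τ₀ : ℝ} (hτ₀ : 0 < τ₀) (hτ : τ ∈ Set.Icc τ₀ (τ₀ * (1 + δ))) {c : ℕ → ℝ}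
    (hc : ∀ i < d, c i ∈ Set.Icc (0 : ℝ) 1) (hV : ∀ i < d, |(V (spine i) : ℝ) - c i| ≤ δ)
    (hV' : ∀ i < d, 1 - δ ≤ (V (false :: spine i) : ℝ)) {μ : Node → ℝ} {m : ℝ}
    (hμ : ∀ v : Node, v.length = 2 * d → |μ v - if v = spine d then m else 0| ≤ δ)
    (hx : x ∈ cube p) :
    |softTree ψ B J V μ τ x - m * ∏ i ∈ Finset.range d, (ψ ((x (σ i) - c i) / τ₀) *
        (1 - ψ ((x (σ i) - c i) / τ₀)))| ≤
      (nodesAt (2 * d)).card * M ^ (2 * d) * δ + |m| * (d * M ^ (2 * d) * (6 * L * δ / τ₀)) := by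
  have hM0 : 0 ≤ M := by linarith
  have hτpos : 0 < τ := hτ₀.trans_le hτ.1
  -- The second cut inherits the error `δ` of the first and adds its own, whence `2 * δ`; the
  -- bandwidth contributes the third `δ`.
  have hlip (i : ℕ) (hi : i < d) (C : ℝ) (hC : |C - c i| ≤ 2 * δ) :
      |ψ ((x (σ i) - C) / τ) - ψ ((x (σ i) - c i) / τ₀)| ≤ 3 * L * δ / τ₀ := by
    have hxi := hx (σ i)
    have hci := hc i hi
    have h1 : |(x (σ i) - C) / τ - (x (σ i) - c i) / τ₀| ≤ 3 * (δ / τ₀) := by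
      have e : (x (σ i) - C) / τ - (x (σ i) - c i) / τ₀ =
          -((C - c i) / τ) - (x (σ i) - c i) * (1 / τ₀ - 1 / τ) := by ring
      have h2 : |(C - c i) / τ| ≤ 2 * (δ / τ₀) := by
        rw [abs_div, abs_of_pos hτpos, ← mul_div_assoc]
        exact div_le_div₀ (by positivity) hC hτ₀ hτ.1
      have h3 : 0 ≤ 1 / τ₀ - 1 / τ := sub_nonneg.2 (one_div_le_one_div_of_le hτ₀ hτ.1)
      have h4 : 1 / τ₀ - 1 / τ ≤ δ / τ₀ := by
        rw [div_sub_div _ _ hτ₀.ne' hτpos.ne', div_le_div_iff₀ (by positivity) hτ₀]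
        have : τ - τ₀ ≤ τ₀ * δ := by linarith [hτ.2]
        have h5 : τ₀ * δ ≤ τ * δ := mul_le_mul_of_nonneg_right hτ.1 hδ
        nlinarith
      have h5 : |(x (σ i) - c i) * (1 / τ₀ - 1 / τ)| ≤ δ / τ₀ := by
        rw [abs_mul, abs_of_nonneg h3]
        have : |x (σ i) - c i| ≤ 1 := by
          rw [abs_le]; constructor <;> linarith [hxi.1, hxi.2, hci.1, hci.2]
        exact (mul_le_of_le_one_left h3 this).trans h4
      rw [e]
      refine (abs_sub _ _).trans ?_
      rw [abs_neg]
      linarith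
    refine (hL _ _).trans ((mul_le_mul_of_nonneg_left h1 hL0).trans (le_of_eq ?_))
    ring
  have hprod : |weight ψ J V τ x (spine d) - ∏ i ∈ Finset.range d, (ψ ((x (σ i) - c i) / τ₀) *
      (1 - ψ ((x (σ i) - c i) / τ₀)))| ≤ d * M ^ (2 * d) * (6 * L * δ / τ₀) := by
    rw [weight_spine hσ hJ le_rfl]
    have h := abs_prod_sub_prod_le (Finset.range d) (A := fun _ => M ^ 2) (e := 6 * L * δ / τ₀)
      (a := fun i => ψ ((x (σ i) - V (spine i)) / τ) *
        (1 - ψ ((x (σ i) - V (false :: spine i) * V (spine i)) / τ)))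
      (b := fun i => ψ ((x (σ i) - c i) / τ₀) * (1 - ψ ((x (σ i) - c i) / τ₀))) ?_ ?_ ?_
    · refine h.trans (le_of_eq ?_)
      rw [Finset.prod_const, Finset.card_range, ← pow_mul]
      ring
    · intro i _
      rw [abs_mul, sq]
      exact mul_le_mul (hM _).1 (hM _).2 (abs_nonneg _) hM0
    · intro i _
      rw [abs_mul, sq]
      exact mul_le_mul (hM _).1 (hM _).2 (abs_nonneg _) hM0
    · intro i hi
      have hi' := Finset.mem_range.1 hi
      have h1 := hlip i hi' (V (spine i)) ((hV i hi').trans (by linarith))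
      have h2 := hlip i hi' (V (false :: spine i) * V (spine i)) (by
        have e : (V (false :: spine i) * V (spine i) : ℝ) - c i =
            (V (spine i) - c i) - (1 - V (false :: spine i)) * V (spine i) := by ring
        have h3 : |(1 - V (false :: spine i) : ℝ) * V (spine i)| ≤ δ := by
          have h4 := (V (false :: spine i)).2
          have h5 := (V (spine i)).2
          rw [abs_of_nonneg (mul_nonneg (by linarith [h4.2]) h5.1)]
          exact (mul_le_of_le_one_right (by linarith [h4.2]) h5.2).trans (by linarith [hV' i hi'])
        rw [e]
        linarith [abs_sub ((V (spine i) : ℝ) - c i) ((1 - V (false :: spine i)) * V (spine i)),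
          hV i hi'])
      set a₁ := ψ ((x (σ i) - V (spine i)) / τ)
      set a₂ := ψ ((x (σ i) - V (false :: spine i) * V (spine i)) / τ)
      set a₀ := ψ ((x (σ i) - c i) / τ₀)
      have hδ' : 0 ≤ 3 * L * δ / τ₀ := by positivity
      calc |a₁ * (1 - a₂) - a₀ * (1 - a₀)| = |(a₁ - a₀) * (1 - a₂) - a₀ * (a₂ - a₀)| := by
            congr 1; ring
        _ ≤ |(a₁ - a₀) * (1 - a₂)| + |a₀ * (a₂ - a₀)| := abs_sub _ _
        _ ≤ 3 * L * δ / τ₀ * M + M * (3 * L * δ / τ₀) := by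
            rw [abs_mul, abs_mul]
            exact add_le_add (mul_le_mul h1 (hM _).2 (abs_nonneg _) hδ')
              (mul_le_mul (hM _).1 h2 (abs_nonneg _) hM0)
        _ = 6 * L * δ / τ₀ * M := by ring
        _ ≤ 6 * L * δ / τ₀ * M ^ 2 :=
            mul_le_mul_of_nonneg_left (by nlinarith) (by positivity)
  have hmem : spine d ∈ nodesAt (2 * d) := by simp
  -- The error comes from the coefficients, all of them `δ`-close to their targets `m` or `0`, and
  -- from the weight of the leaf `spine d`.
  have e : softTree ψ B J V μ τ x - m * ∏ i ∈ Finset.range d, (ψ ((x (σ i) - c i) / τ₀) *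
      (1 - ψ ((x (σ i) - c i) / τ₀))) =
      ∑ v ∈ nodesAt (2 * d), (μ v - if v = spine d then m else 0) * weight ψ J V τ x v +
      m * (weight ψ J V τ x (spine d) - ∏ i ∈ Finset.range d, (ψ ((x (σ i) - c i) / τ₀) *
        (1 - ψ ((x (σ i) - c i) / τ₀)))) := by
    rw [hB.softTree_eq]
    simp_rw [sub_mul]
    rw [Finset.sum_sub_distrib]
    simp only [ite_mul, zero_mul, Finset.sum_ite_eq', hmem, if_true]
    ring
  rw [e]
  refine (abs_add_le _ _).trans (add_le_add ?_ ?_)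
  · calc _ ≤ ∑ _v ∈ nodesAt (2 * d), δ * M ^ (2 * d) := by
          refine (Finset.abs_sum_le_sum_abs _ _).trans (Finset.sum_le_sum fun v hv => ?_)
          have hv' := mem_nodesAt.1 hv
          rw [abs_mul]
          refine mul_le_mul (hμ v hv') ?_ (abs_nonneg _) hδ
          rw [← hv']
          exact abs_weight_le hM v
      _ = _ := by rw [Finset.sum_const, nsmul_eq_mul]; ring
  · rw [abs_mul]
    exact mul_le_mul_of_nonneg_left hprod (abs_nonneg _)

end

/-! ### Selection of the relevant coordinates -/

section

variable {p : ℕ}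

/-- A partial sum of the weights nearly counts the relevant coordinates: the irrelevant ones
contribute at most `p * (η / p)` together. -/
lemma sum_weights_bounds {S : Finset (Fin p)} {g : Fin p → ℝ} {η : ℝ} (hη : 0 ≤ η)
    (h1 : ∀ j ∈ S, g j ∈ Set.Icc 1 (1 + η)) (h2 : ∀ j ∉ S, g j ∈ Set.Icc 0 (η / p))
    (U : Finset (Fin p)) :
    ((U ∩ S).card : ℝ) ≤ ∑ j ∈ U, g j ∧ ∑ j ∈ U, g j ≤ (U ∩ S).card * (1 + η) + η := by
  have e : ∑ j ∈ U, g j = ∑ j ∈ U ∩ S, g j + ∑ j ∈ U \ S, g j :=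
    (Finset.sum_inter_add_sum_sdiff U S g).symm
  have l1 : ((U ∩ S).card : ℝ) ≤ ∑ j ∈ U ∩ S, g j := by
    have := Finset.card_nsmul_le_sum (U ∩ S) g 1 fun j hj => (h1 j (Finset.mem_inter.1 hj).2).1
    simpa using this
  have l2 : ∑ j ∈ U ∩ S, g j ≤ (U ∩ S).card * (1 + η) := by
    have := Finset.sum_le_card_nsmul (U ∩ S) g (1 + η) fun j hj =>
      (h1 j (Finset.mem_inter.1 hj).2).2
    rwa [nsmul_eq_mul] at this
  have l3 : 0 ≤ ∑ j ∈ U \ S, g j :=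
    Finset.sum_nonneg fun j hj => (h2 j (Finset.mem_sdiff.1 hj).2).1
  have l4 : ∑ j ∈ U \ S, g j ≤ η := by
    have h3 := Finset.sum_le_card_nsmul (U \ S) g (η / p) fun j hj =>
      (h2 j (Finset.mem_sdiff.1 hj).2).2
    have h4 : ((U \ S).card : ℝ) ≤ p := by
      have := Finset.card_le_univ (U \ S)
      rw [Fintype.card_fin] at this
      exact_mod_cast this
    rw [nsmul_eq_mul] at h3
    refine h3.trans ?_
    rcases Nat.eq_zero_or_pos p with h0 | h0
    · subst h0; simpa using hη
    · have h0' : (0 : ℝ) < p := by exact_mod_cast h0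
      calc _ ≤ (p : ℝ) * (η / p) := mul_le_mul_of_nonneg_right h4 (by positivity)
        _ = η := by field_simp
  rw [e]
  constructor <;> linarith

/-- The rank of `j` in `S`. -/
def rank (S : Finset (Fin p)) (j : Fin p) : ℕ := (Finset.Iic j ∩ S).card

lemma rank_le (S : Finset (Fin p)) (j : Fin p) : rank S j ≤ S.card :=
  Finset.card_le_card Finset.inter_subset_right

lemma rank_pos {S : Finset (Fin p)} {j : Fin p} (hj : j ∈ S) : 1 ≤ rank S j :=
  Finset.card_pos.2 ⟨j, Finset.mem_inter.2 ⟨by simp, hj⟩⟩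

/-- At the relevant coordinate of rank `k` the cumulative proportion rises from about `(k - 1) /
|S|` to about `k / |S|`. The middle half of this interval stays clear of the perturbation, because
`hη'` keeps the total error of the weights below `1 / 4`. -/
lemma selectCoord_eq [NeZero p] {S : Finset (Fin p)} {g : Fin p → ℝ} {η : ℝ} (hη : 0 < η)
    (hη' : (S.card + 1) * η ≤ 1 / 4) (h1 : ∀ j ∈ S, g j ∈ Set.Icc 1 (1 + η))
    (h2 : ∀ j ∉ S, g j ∈ Set.Icc 0 (η / p)) {j : Fin p} (hj : j ∈ S) {w : unitInterval}
    (hw : (w : ℝ) ∈ Set.Icc (((rank S j : ℝ) - 3 / 4) / S.card)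
      (((rank S j : ℝ) - 1 / 4) / S.card)) :
    selectCoord (fun i => g i / ∑ i, g i) w = j := by
  have hb := sum_weights_bounds hη.le h1 h2
  have hG := hb Finset.univ
  rw [Finset.univ_inter] at hG
  set G := ∑ i, g i with hG_def
  have hk1 : (1 : ℝ) ≤ rank S j := by exact_mod_cast rank_pos hj
  have hkd : (rank S j : ℝ) ≤ S.card := by exact_mod_cast rank_le S j
  have hd : (0 : ℝ) < S.card := by linarith
  have hGpos : 0 < G := by linarith
  have hcum (i : Fin p) : ∑ l ∈ Finset.Iic i, g l / G = (∑ l ∈ Finset.Iic i, g l) / G :=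
    (Finset.sum_div _ _ _).symm
  have hA : (w : ℝ) ≤ ∑ l ∈ Finset.Iic j, g l / G := by
    rw [hcum]
    refine hw.2.trans ?_
    have h3 := (hb (Finset.Iic j)).1
    change (rank S j : ℝ) ≤ _ at h3
    rw [div_le_div_iff₀ hd hGpos]
    have h4 : G ≤ S.card + 1 / 4 := by linarith [hG.2]
    have h5 : ((rank S j : ℝ) - 1 / 4) * G ≤ ((rank S j : ℝ) - 1 / 4) * (S.card + 1 / 4) :=
      mul_le_mul_of_nonneg_left h4 (by linarith)
    have h6 := mul_le_mul_of_nonneg_right h3 hd.le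
    nlinarith
  have hB (i : Fin p) (hi : i < j) : ∑ l ∈ Finset.Iic i, g l / G < w := by
    rw [hcum]
    refine lt_of_lt_of_le ?_ hw.1
    have h3 := (hb (Finset.Iic i)).2
    have h4 : (Finset.Iic i ∩ S).card + 1 ≤ rank S j := by
      rw [← Finset.card_insert_of_notMem (a := j) (by simp [hi])]
      refine Finset.card_le_card fun l hl => ?_
      rcases Finset.mem_insert.1 hl with rfl | hl
      · exact Finset.mem_inter.2 ⟨by simp, hj⟩
      · obtain ⟨h5, h6⟩ := Finset.mem_inter.1 hl
        exact Finset.mem_inter.2 ⟨Finset.mem_Iic.2 ((Finset.mem_Iic.1 h5).trans hi.le), h6⟩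
    have h4' : ((Finset.Iic i ∩ S).card : ℝ) + 1 ≤ rank S j := by exact_mod_cast h4
    have h5 : ∑ l ∈ Finset.Iic i, g l < rank S j - 3 / 4 := by nlinarith
    rw [div_lt_div_iff₀ hGpos hd]
    calc _ < ((rank S j : ℝ) - 3 / 4) * S.card := mul_lt_mul_of_pos_right h5 hd
      _ ≤ _ := mul_le_mul_of_nonneg_left hG.1 (by linarith)
  have hne : (Finset.univ.filter fun i : Fin p =>
      (w : ℝ) ≤ ∑ l ∈ Finset.Iic i, g l / G).Nonempty := ⟨j, by simpa using hA⟩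
  unfold selectCoord
  rw [dif_pos (by convert hne)]
  refine le_antisymm (Finset.min'_le _ _ (by simpa using hA)) (Finset.le_min' _ _ _ fun i hi => ?_)
  by_contra! hlt
  have := (Finset.mem_filter.1 hi).2
  exact absurd this (not_le.2 (hB i hlt))

end

/-! ### Lower bounds for Gamma and Dirichlet probabilities -/

lemma gammaMeasure_real_eq {c : ℝ} (hc : 0 < c) {s : Set ℝ} (hs : MeasurableSet s) :
    IntegrableOn (gammaPDFReal c 1) s ∧
      (gammaMeasure c 1).real s = ∫ x in s, gammaPDFReal c 1 x := by
  have hnn : ∀ x, 0 ≤ gammaPDFReal c 1 x := gammaPDFReal_nonneg hc one_pos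
  have hint : Integrable (gammaPDFReal c 1) := by
    refine ⟨(measurable_gammaPDFReal c 1).aestronglyMeasurable, ?_⟩
    rw [hasFiniteIntegral_iff_ofReal (Filter.Eventually.of_forall hnn)]
    have := lintegral_gammaPDF_eq_one hc one_pos
    unfold gammaPDF at this
    rw [this]
    exact ENNReal.one_lt_top
  refine ⟨hint.integrableOn, ?_⟩
  rw [integral_eq_lintegral_of_nonneg_ae (Filter.Eventually.of_forall hnn)
    (measurable_gammaPDFReal c 1).aestronglyMeasurable, measureReal_def, gammaMeasure,
    withDensity_apply _ hs]
  rfl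

/-- Convexity of `Γ` between `1` and `a + 1`. The exponent is linear in `c`, so a product of `p`
such factors stays bounded as long as `c * p ≤ a`. -/
lemma Gamma_add_one_le {a c : ℝ} (ha : 0 < a) (hc : 0 < c) (hca : c ≤ a) :
    Real.Gamma (c + 1) ≤ Real.exp (c / a * Real.Gamma (a + 1)) := by
  have ht1 : c / a ≤ 1 := (div_le_one ha).2 hca
  have ht0 : 0 ≤ c / a := by positivity
  have h := Real.convexOn_Gamma.2 (Set.mem_Ioi.2 one_pos)
    (Set.mem_Ioi.2 (by linarith : (0 : ℝ) < a + 1)) (sub_nonneg.2 ht1) ht0 (sub_add_cancel 1 _)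
  simp only [smul_eq_mul, Real.Gamma_one, mul_one] at h
  rw [show 1 - c / a + c / a * (a + 1) = c + 1 by field_simp; ring] at h
  refine h.trans (le_trans ?_ (Real.add_one_le_exp _))
  linarith

/-- For a small shape parameter the Gamma law concentrates at `0`. On `(0, δ]` the density is at
least `exp (-δ) x ^ (c - 1) / Γ(c)`, which integrates to `exp (-δ) δ ^ c / Γ(c + 1)`. -/
lemma le_gammaMeasure_Icc_zero {a c δ : ℝ} (ha : 0 < a) (hc : 0 < c) (hca : c ≤ a) (hδ : 0 < δ) :
    δ ^ c * Real.exp (-δ - c / a * Real.Gamma (a + 1)) ≤ (gammaMeasure c 1).real (Set.Icc 0 δ) := by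
  have hΓ : 0 < Real.Gamma c := Real.Gamma_pos_of_pos hc
  have hΓ1 : Real.Gamma (c + 1) = c * Real.Gamma c := Real.Gamma_add_one hc.ne'
  obtain ⟨hint, heq⟩ := gammaMeasure_real_eq hc (measurableSet_Ioc (a := (0 : ℝ)) (b := δ))
  have hint2 : IntervalIntegrable (fun x : ℝ => x ^ (c - 1)) volume 0 δ :=
    intervalIntegral.intervalIntegrable_rpow' (by linarith)
  have hle : ∫ x in Set.Ioc 0 δ, Real.exp (-δ) / Real.Gamma c * x ^ (c - 1) ≤
      ∫ x in Set.Ioc 0 δ, gammaPDFReal c 1 x := by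
    refine setIntegral_mono_on (hint2.1.const_mul _) hint measurableSet_Ioc fun x hx => ?_
    unfold gammaPDFReal
    rw [if_pos hx.1.le, Real.one_rpow, one_mul]
    have : Real.exp (-δ) ≤ Real.exp (-x) := Real.exp_le_exp.2 (by linarith [hx.2])
    have h0 : 0 ≤ x ^ (c - 1) := Real.rpow_nonneg hx.1.le _
    calc _ = 1 / Real.Gamma c * x ^ (c - 1) * Real.exp (-δ) := by ring
      _ ≤ _ := mul_le_mul_of_nonneg_left this (by positivity)
  have hval : ∫ x in Set.Ioc 0 δ, Real.exp (-δ) / Real.Gamma c * x ^ (c - 1) =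
      Real.exp (-δ) * δ ^ c / Real.Gamma (c + 1) := by
    rw [integral_const_mul, ← intervalIntegral.integral_of_le hδ.le,
      integral_rpow (Or.inl (by linarith)), sub_add_cancel, Real.zero_rpow hc.ne', sub_zero, hΓ1]
    field_simp
  have := isProbabilityMeasure_gammaMeasure hc one_pos
  calc _ = Real.exp (-δ) * δ ^ c / Real.exp (c / a * Real.Gamma (a + 1)) := by
        rw [Real.exp_sub]; ring
    _ ≤ Real.exp (-δ) * δ ^ c / Real.Gamma (c + 1) :=
        div_le_div_of_nonneg_left (by positivity) (Real.Gamma_pos_of_pos (by linarith))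
          (Gamma_add_one_le ha hc hca)
    _ ≤ (gammaMeasure c 1).real (Set.Ioc 0 δ) := by rw [heq, ← hval]; exact hle
    _ ≤ _ := measureReal_mono Set.Ioc_subset_Icc_self

/-- The bound is only linear in `c` because `1 / Γ(c) = c / Γ(c + 1)`. With `c = a / p ^ ξ` its
logarithm costs `ξ log p` for each relevant coordinate. -/
lemma exists_le_gammaMeasure_Icc_one {a η : ℝ} (ha : 0 < a) (hη : 0 < η) (hη1 : η ≤ 1) :
    ∃ κ > 0, ∀ c, 0 < c → c ≤ a → κ * c ≤ (gammaMeasure c 1).real (Set.Icc 1 (1 + η)) := by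
  refine ⟨η * (Real.exp (-Real.Gamma (a + 1)) * (1 / 2) * Real.exp (-2)), by positivity,
    fun c hc hca => ?_⟩
  have hΓ : 0 < Real.Gamma c := Real.Gamma_pos_of_pos hc
  have hΓ1 : Real.Gamma (c + 1) = c * Real.Gamma c := Real.Gamma_add_one hc.ne'
  have hΓa : 0 < Real.Gamma (a + 1) := Real.Gamma_pos_of_pos (by linarith)
  obtain ⟨hint, heq⟩ := gammaMeasure_real_eq hc (measurableSet_Icc (a := (1 : ℝ)) (b := 1 + η))
  have hlow : c * Real.exp (-Real.Gamma (a + 1)) ≤ 1 / Real.Gamma c := by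
    have h1 : Real.Gamma (c + 1) ≤ Real.exp (Real.Gamma (a + 1)) :=
      (Gamma_add_one_le ha hc hca).trans (Real.exp_le_exp.2
        (mul_le_of_le_one_left hΓa.le ((div_le_one ha).2 hca)))
    rw [Real.exp_neg, le_div_iff₀ hΓ, mul_right_comm, ← hΓ1, ← div_eq_mul_inv,
      div_le_one (Real.exp_pos _)]
    exact h1
  rw [heq]
  calc _ = ∫ _x in Set.Icc 1 (1 + η),
        c * Real.exp (-Real.Gamma (a + 1)) * (1 / 2) * Real.exp (-2) := by
        rw [setIntegral_const, Real.volume_real_Icc, add_sub_cancel_left, max_eq_left hη.le,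
          smul_eq_mul]
        ring
    _ ≤ _ := by
      refine setIntegral_mono_on (integrableOn_const (by simp)) hint measurableSet_Icc
        fun x hx => ?_
      have hx0 : 0 < x := by linarith [hx.1]
      have hx2 : x ≤ 2 := by linarith [hx.2]
      unfold gammaPDFReal
      rw [if_pos hx0.le, Real.one_rpow, one_mul]
      have h1 : 1 / 2 ≤ x ^ (c - 1) := by
        calc (1 / 2 : ℝ) ≤ x ^ (-1 : ℝ) := by
              rw [Real.rpow_neg_one, one_div]
              exact inv_anti₀ hx0 hx2
          _ ≤ x ^ (c - 1) := Real.rpow_le_rpow_of_exponent_le hx.1 (by linarith)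
      exact mul_le_mul (mul_le_mul hlow h1 (by norm_num) (by positivity))
        (Real.exp_le_exp.2 (by linarith)) (Real.exp_pos _).le (by positivity)

/-- The event that the relevant coordinates have nearly equal proportions and the other ones are
negligible. -/
def goodSplit {p : ℕ} (S : Finset (Fin p)) (η : ℝ) : Set (Fin p → ℝ) :=
  (fun (g : Fin p → ℝ) j => g j / ∑ i, g i) '' {g : Fin p → ℝ | (∀ j ∈ S, g j ∈ Set.Icc 1 (1 + η)) ∧
    ∀ j ∉ S, g j ∈ Set.Icc 0 (η / p)}

/-- The event is read off from the independent Gamma variables: `d` of them near `1`, at cost `log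
p` each, the rest below `η / p`. The joint cost of the rest is of order `c p log (p / η)`, apart
from bounded terms. -/
theorem exists_le_dirichlet_goodSplit {a ξ η : ℝ} (ha : 0 < a) (hξ : 1 < ξ) (hη : 0 < η)
    (hη1 : η ≤ 1) (d : ℕ) :
    ∃ C > 0, ∀ (p : ℕ) [NeZero p] (S : Finset (Fin p)), S.card = d →
      Real.exp (-C * (1 + d * Real.log p)) ≤
        (dirichlet fun _ : Fin p => a / (p : ℝ) ^ ξ).real (goodSplit S η) := by
  obtain ⟨κ, hκ, hgam⟩ := exists_le_gammaMeasure_Icc_one ha hη hη1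
  have hΓa : 0 < Real.Gamma (a + 1) := Real.Gamma_pos_of_pos (by linarith)
  have hlogη : Real.log η ≤ 0 := Real.log_nonpos hη.le hη1
  set A := d * |Real.log (κ * a)| + a / (ξ - 1) + a * (-Real.log η) + η + Real.Gamma (a + 1)
    with hA
  have hA0 : 0 < A := by
    have h1 : 0 ≤ d * |Real.log (κ * a)| := by positivity
    have h2 : 0 ≤ a / (ξ - 1) := div_nonneg ha.le (by linarith)
    have h3 : 0 ≤ a * (-Real.log η) := mul_nonneg ha.le (by linarith)
    linarith
  refine ⟨A + ξ, by linarith, fun p _ S hS => ?_⟩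
  have hp : (1 : ℝ) ≤ p := by exact_mod_cast NeZero.one_le
  have hp0 : (0 : ℝ) < p := by linarith
  have hlogp : 0 ≤ Real.log p := Real.log_nonneg hp
  set c := a / (p : ℝ) ^ ξ with hc_def
  have hc : 0 < c := by positivity
  have hca : c ≤ a := div_le_self ha.le (Real.one_le_rpow hp (by linarith))
  have hprob := isProbabilityMeasure_gammaMeasure hc one_pos
  set q := (η / p) ^ c * Real.exp (-(η / p) - c / a * Real.Gamma (a + 1)) with hq
  have hq0 : 0 < q := by positivity
  have hqle : q ≤ (gammaMeasure c 1).real (Set.Icc 0 (η / p)) :=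
    le_gammaMeasure_Icc_zero ha hc hca (by positivity)
  have hq1 : q ≤ 1 := hqle.trans measureReal_le_one
  have hcp : c * p = a * (p : ℝ) ^ (1 - ξ) := by
    rw [hc_def, Real.rpow_sub hp0, Real.rpow_one]
    ring
  have hcpa : c * p ≤ a := by
    rw [hcp]
    exact mul_le_of_le_one_right ha.le (Real.rpow_le_one_of_one_le_of_nonpos hp (by linarith))
  -- Here `ξ > 1` is essential: `c * p = a * p ^ (1 - ξ)` beats `log p`.
  have hcplog : c * p * Real.log p ≤ a / (ξ - 1) := by
    rw [hcp, mul_assoc, div_eq_mul_inv]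
    refine mul_le_mul_of_nonneg_left ?_ ha.le
    have h1 := Real.log_le_rpow_div hp0.le (show 0 < ξ - 1 by linarith)
    calc _ ≤ (p : ℝ) ^ (1 - ξ) * ((p : ℝ) ^ (ξ - 1) / (ξ - 1)) :=
          mul_le_mul_of_nonneg_left h1 (by positivity)
      _ = ((p : ℝ) ^ (1 - ξ) * (p : ℝ) ^ (ξ - 1)) * (ξ - 1)⁻¹ := by ring
      _ = (ξ - 1)⁻¹ := by
          rw [← Real.rpow_add hp0, show 1 - ξ + (ξ - 1) = 0 by ring, Real.rpow_zero, one_mul]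
  -- the probability of the event for the Gamma variables
  set E : Fin p → Set ℝ := fun j => if j ∈ S then Set.Icc 1 (1 + η) else Set.Icc 0 (η / p) with hE
  have hpi : (Measure.pi fun _ : Fin p => gammaMeasure c 1).real (Set.pi Set.univ E) =
      ∏ j, (gammaMeasure c 1).real (E j) := by
    rw [measureReal_def, Measure.pi_pi, ENNReal.toReal_prod]
    rfl
  have hsub : Set.pi Set.univ E ⊆ (fun (g : Fin p → ℝ) j => g j / ∑ i, g i) ⁻¹' goodSplit S η := by
    intro g hg
    refine ⟨g, ⟨fun j hj => ?_, fun j hj => ?_⟩, rfl⟩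
    · have := hg j (Set.mem_univ j)
      simp only [hE, if_pos hj] at this
      exact this
    · have := hg j (Set.mem_univ j)
      simp only [hE, if_neg hj] at this
      exact this
  have hge : ∏ j, (gammaMeasure c 1).real (E j) ≤
      (dirichlet fun _ : Fin p => c).real (goodSplit S η) := by
    rw [← hpi]
    have hmeas : AEMeasurable (fun (g : Fin p → ℝ) j => g j / ∑ i, g i)
        (Measure.pi fun _ : Fin p => gammaMeasure c 1) := by fun_prop
    have : IsProbabilityMeasure (dirichlet fun _ : Fin p => c) :=
      Measure.isProbabilityMeasure_map hmeas
    -- `goodSplit` is an image; the inequality `le_map_apply` needs no measurability of it.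
    exact ENNReal.toReal_mono (measure_ne_top _ _)
      ((measure_mono hsub).trans (Measure.le_map_apply hmeas _))
  refine le_trans ?_ hge
  have hprod : (κ * c) ^ d * q ^ p ≤ ∏ j, (gammaMeasure c 1).real (E j) := by
    have h1 : ∏ j, (if j ∈ S then κ * c else q) ≤ ∏ j, (gammaMeasure c 1).real (E j) := by
      refine Finset.prod_le_prod (fun j _ => by split <;> positivity) fun j _ => ?_
      by_cases hj : j ∈ S
      · rw [if_pos hj, hE]; simp only [if_pos hj]; exact hgam c hc hca
      · rw [if_neg hj, hE]; simp only [if_neg hj]; exact hqle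
    refine le_trans ?_ h1
    rw [Finset.prod_ite, Finset.prod_const, Finset.prod_const]
    have e1 : (Finset.univ.filter fun j => j ∈ S) = S := by ext; simp
    rw [e1, hS]
    refine mul_le_mul_of_nonneg_left (pow_le_pow_of_le_one hq0.le hq1 ?_) (by positivity)
    exact (Finset.card_le_univ _).trans (by simp)
  refine le_trans ?_ hprod
  have e1 : (κ * c) ^ d = Real.exp (d * (Real.log (κ * a) - ξ * Real.log p)) := by
    rw [← Real.log_rpow hp0, ← Real.log_div (by positivity) (by positivity), mul_comm (d : ℝ),
      Real.exp_mul, Real.exp_log (by positivity), Real.rpow_natCast, hc_def, mul_div_assoc]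
  have e2 : q ^ p = Real.exp (c * p * (Real.log η - Real.log p) - η - c * p / a *
      Real.Gamma (a + 1)) := by
    rw [hq, Real.rpow_def_of_pos (by positivity), ← Real.exp_add, ← Real.exp_nat_mul,
      Real.log_div hη.ne' hp0.ne']
    congr 1
    field_simp
    ring
  rw [e1, e2, ← Real.exp_add]
  refine Real.exp_le_exp.2 ?_
  have h1 : -(d * |Real.log (κ * a)|) ≤ d * Real.log (κ * a) := by
    rw [← mul_neg]
    exact mul_le_mul_of_nonneg_left (neg_abs_le _) (Nat.cast_nonneg d)
  have h2 : c * p * (-Real.log η) ≤ a * (-Real.log η) :=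
    mul_le_mul_of_nonneg_right hcpa (by linarith)
  have h3 : c * p / a * Real.Gamma (a + 1) ≤ Real.Gamma (a + 1) :=
    mul_le_of_le_one_left hΓa.le ((div_le_one ha).2 hcpa)
  have h4 : 0 ≤ A * (d * Real.log p) := by positivity
  nlinarith

/-! ### Lower bounds for the probability of a tree -/

lemma infinitePi_real_pi {ι : Type*} {X : ι → Type*} [∀ i, MeasurableSpace (X i)]
    (μ : ∀ i, Measure (X i)) [∀ i, IsProbabilityMeasure (μ i)] {s : Finset ι} {t : ∀ i, Set (X i)}
    (ht : ∀ i ∈ s, MeasurableSet (t i)) :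
    (Measure.infinitePi μ).real (Set.pi s t) = ∏ i ∈ s, (μ i).real (t i) := by
  rw [measureReal_def, Measure.infinitePi_pi _ ht, ENNReal.toReal_prod]
  rfl

lemma pow_le_infinitePi_real_pi {ι : Type*} {X : ι → Type*} [∀ i, MeasurableSpace (X i)]
    (μ : ∀ i, Measure (X i)) [∀ i, IsProbabilityMeasure (μ i)] {s : Finset ι} {t : ∀ i, Set (X i)}
    (ht : ∀ i ∈ s, MeasurableSet (t i)) {b : ℝ} (hb : 0 ≤ b) (h : ∀ i ∈ s, b ≤ (μ i).real (t i)) :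
    b ^ s.card ≤ (Measure.infinitePi μ).real (Set.pi s t) := by
  rw [infinitePi_real_pi μ ht, ← Finset.prod_const]
  exact Finset.prod_le_prod (fun _ _ => hb) h

lemma le_withDensity_real_Icc {f : ℝ → ℝ} [IsFiniteMeasure (volume.withDensity fun x =>
    ENNReal.ofReal (f x))] {b u v : ℝ} (huv : u ≤ v)
    (h : ∀ x ∈ Set.Icc u v, b ≤ f x) :
    b * (v - u) ≤ (volume.withDensity fun x => ENNReal.ofReal (f x)).real (Set.Icc u v) := by
  rw [measureReal_def, ← ENNReal.ofReal_le_iff_le_toReal (measure_ne_top _ _),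
    withDensity_apply _ measurableSet_Icc]
  calc ENNReal.ofReal (b * (v - u)) ≤ ENNReal.ofReal b * ENNReal.ofReal (v - u) := by
        rw [ENNReal.ofReal_mul' (by linarith)]
    _ = ∫⁻ _x in Set.Icc u v, ENNReal.ofReal b := by
        rw [setLIntegral_const, Real.volume_Icc]
    _ ≤ _ := setLIntegral_mono' measurableSet_Icc fun x hx => ENNReal.ofReal_le_ofReal (h x hx)

lemma unitInterval_volume_real {u v : ℝ} (h0 : 0 ≤ u) (huv : u ≤ v) (h1 : v ≤ 1) :
    (volume : Measure unitInterval).real {w | (w : ℝ) ∈ Set.Icc u v} = v - u := by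
  have e : {w : unitInterval | (w : ℝ) ∈ Set.Icc u v} =
      Set.Icc ⟨u, h0, huv.trans h1⟩ ⟨v, h0.trans huv, h1⟩ := by
    ext w
    simp [Set.mem_Icc, ← Subtype.coe_le_coe]
  rw [e, measureReal_def, unitInterval.volume_Icc, ENNReal.toReal_ofReal (by simpa using huv)]

lemma measurableSet_unitInterval_Icc (u v : ℝ) :
    MeasurableSet {w : unitInterval | (w : ℝ) ∈ Set.Icc u v} :=
  measurable_subtype_coe measurableSet_Icc

/-- The nodes of depth less than `k`. -/
noncomputable def nodesBelow (k : ℕ) : Finset Node := (Finset.range k).biUnion nodesAt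

@[simp] lemma mem_nodesBelow {k : ℕ} {v : Node} : v ∈ nodesBelow k ↔ v.length < k := by
  simp [nodesBelow]

section

variable {B : Node → Bool}

lemma treeDepth_le_of_forall {k : ℕ} (h : ∀ v : Node, v.length = k → B v = false) :
    treeDepth B ≤ k := by
  have key (v : Node) (hv : IsNode B v) : v.length ≤ k := by
    induction v with
    | nil => simp
    | cons b u ih =>
      have h1 := ih hv.1
      rcases h1.lt_or_eq with h2 | h2
      · simpa using h2
      · have := h u h2
        rw [hv.2] at this
        exact absurd this (by simp)
  exact iSup_le fun v => by exact_mod_cast key v.1 v.2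

lemma treeDepth_ne_of_forall {k : ℕ} (h : ∀ v : Node, v.length = k → B v = true) :
    treeDepth B ≠ k := by
  intro hk
  have hle (v : Node) (hv : IsNode B v) : v.length ≤ k := by
    have := le_iSup (fun v : {v : Node // IsNode B v} => (v.1.length : ℕ∞)) ⟨v, hv⟩
    change _ ≤ treeDepth B at this
    rw [hk] at this
    exact_mod_cast this
  have hex : ∃ v, IsNode B v ∧ v.length = k := by
    by_contra! hne
    rcases Nat.eq_zero_or_pos k with h0 | h0
    · exact hne [] trivial (by simp [h0])
    · have h1 : treeDepth B ≤ (k - 1 : ℕ) := iSup_le fun v => by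
        have h2 := hle v.1 v.2
        have h3 := hne v.1 v.2
        exact_mod_cast (show v.1.length ≤ k - 1 by omega)
      rw [hk] at h1
      have : k ≤ k - 1 := by exact_mod_cast h1
      omega
  obtain ⟨v, hv, hvk⟩ := hex
  have := hle (true :: v) ⟨hv, h v hvk⟩
  simp only [List.length_cons] at this
  omega

end

variable {P : PriorSpec} {d : ℕ}

lemma PriorSpec.branchLaw_eq_one {k : ℕ} {b : Bool}
    (h : ∀ v : Node, v.length = k →
      (bernoulliMeasure true false (P.splitProb v.length)).real {b} = 1) :
    P.branchLaw (Set.pi (nodesAt k) fun _ => {b}) = 1 := by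
  have h1 : P.branchLaw.real (Set.pi (nodesAt k) fun _ => {b}) = 1 := by
    unfold PriorSpec.branchLaw
    rw [infinitePi_real_pi _ fun _ _ => measurableSet_singleton _]
    exact Finset.prod_eq_one fun v hv => h v (mem_nodesAt.1 hv)
  rw [measureReal_def] at h1
  rw [← ENNReal.toReal_eq_one_iff]
  exact h1

/-- If this probability were `0`, almost surely no node of depth `k` would branch, and depth `k + 1`
would have probability `0`. -/
lemma AssumptionP.splitProb_pos (hP : AssumptionP P d) {k : ℕ} (hk : k < 2 * d) :
    0 < (P.splitProb k : ℝ) := by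
  refine lt_of_le_of_ne (P.splitProb k).2.1 fun h0 => ?_
  have h1 : P.branchLaw (Set.pi (nodesAt k) fun _ => {false}) = 1 :=
    P.branchLaw_eq_one fun v hv => by
      rw [bernoulliMeasure_real_apply_of_notMem_of_mem _ (measurableSet_singleton _) (by simp)
        (by simp), hv, ← h0, sub_zero]
  have hmeas : MeasurableSet (Set.pi (nodesAt k : Set Node) fun _ => ({false} : Set Bool)) :=
    MeasurableSet.pi (nodesAt k).countable_toSet fun _ _ => measurableSet_singleton _
  have h2 := (prob_compl_eq_zero_iff hmeas).2 h1
  have h3 := hP.depth (k + 1) (by omega)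
  refine h3.ne' (measure_mono_null (t := (Set.pi (nodesAt k : Set Node) fun _ => {false})ᶜ)
    (fun B hB hB' => ?_) h2)
  have h4 : treeDepth B ≤ k := treeDepth_le_of_forall fun v hv =>
    hB' v (by simpa using hv)
  rw [Set.mem_ofPred.1 hB] at h4
  have : k + 1 ≤ k := by exact_mod_cast h4
  omega

/-- If this probability were `1`, almost surely every node of depth `k` would branch, and no tree
could have depth exactly `k`. -/
lemma AssumptionP.splitProb_lt_one (hP : AssumptionP P d) {k : ℕ} (hk : k ≤ 2 * d) :
    (P.splitProb k : ℝ) < 1 := by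
  refine lt_of_le_of_ne (P.splitProb k).2.2 fun h0 => ?_
  have h1 : P.branchLaw (Set.pi (nodesAt k) fun _ => {true}) = 1 :=
    P.branchLaw_eq_one fun v hv => by
      rw [bernoulliMeasure_real_apply_of_mem_of_notMem _ (measurableSet_singleton _) (by simp)
        (by simp), hv, h0]
  have hmeas : MeasurableSet (Set.pi (nodesAt k : Set Node) fun _ => ({true} : Set Bool)) :=
    MeasurableSet.pi (nodesAt k).countable_toSet fun _ _ => measurableSet_singleton _
  have h2 := (prob_compl_eq_zero_iff hmeas).2 h1
  refine (hP.depth k hk).ne' (measure_mono_null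
    (t := (Set.pi (nodesAt k : Set Node) fun _ => {true})ᶜ) (fun B hB hB' => ?_) h2)
  exact treeDepth_ne_of_forall (fun v hv => hB' v (by simpa using hv)) hB

/-- The branch indicators of a full tree of depth `k` have positive probability. -/
lemma AssumptionP.branchLaw_pos (hP : AssumptionP P d) {k : ℕ} (hk : k ≤ 2 * d) :
    0 < P.branchLaw.real (Set.pi (nodesBelow (k + 1)) fun u => {decide (u.length < k)}) := by
  unfold PriorSpec.branchLaw
  rw [infinitePi_real_pi _ fun _ _ => measurableSet_singleton _]
  refine Finset.prod_pos fun u hu => ?_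
  have hu' := mem_nodesBelow.1 hu
  by_cases h : u.length < k
  · rw [decide_eq_true h, bernoulliMeasure_real_apply_of_mem_of_notMem _ (measurableSet_singleton _)
      (by simp) (by simp)]
    exact hP.splitProb_pos (by omega)
  · rw [decide_eq_false h, bernoulliMeasure_real_apply_of_notMem_of_mem _
      (measurableSet_singleton _) (by simp) (by simp)]
    linarith [hP.splitProb_lt_one (show u.length ≤ 2 * d by omega)]

/-- The lower end of the interval for the relative position of the cut point of a node of
depth `k`, for a kernel with centre `c`. -/
noncomputable def cutLower (c : ℕ → ℝ) (δ : ℝ) (k : ℕ) : ℝ :=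
  if Even k then min (c (k / 2)) (1 - δ) else 1 - δ

/-- The event that a tree is `δ`-close to the multiple `m` of the product kernel with centre `c` and
bandwidth `τ`. The variables that select the coordinates at the depths `2 * r` and `2 * r + 1` are
in the interval `[lo r, hi r]`. -/
def treeEvent (d : ℕ) (lo hi : ℕ → ℝ) (δ τ : ℝ) (c : ℕ → ℝ) (m : ℝ) : Set TreeDraw :=
  Set.Icc τ (τ * (1 + δ)) ×ˢ
    (Set.pi (nodesBelow (2 * d + 1)) fun u => {decide (u.length < 2 * d)}) ×ˢ
    (Set.pi (nodesBelow (2 * d)) fun u => {w : unitInterval | (w : ℝ) ∈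
      Set.Icc (lo (u.length / 2)) (hi (u.length / 2))}) ×ˢ
    (Set.pi (nodesBelow (2 * d)) fun u => {w : unitInterval | (w : ℝ) ∈
      Set.Icc (cutLower c δ u.length) (cutLower c δ u.length + δ)}) ×ˢ
    Set.pi (nodesAt (2 * d)) fun v =>
      Set.Icc ((if v = spine d then m else 0) - δ) ((if v = spine d then m else 0) + δ)

lemma measurableSet_treeEvent (d : ℕ) (lo hi : ℕ → ℝ) (δ τ : ℝ) (c : ℕ → ℝ) (m : ℝ) :
    MeasurableSet (treeEvent d lo hi δ τ c m) := by
  refine measurableSet_Icc.prod (MeasurableSet.prod ?_ (MeasurableSet.prod ?_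
    (MeasurableSet.prod ?_ ?_)))
  · exact MeasurableSet.pi (Finset.countable_toSet _) fun _ _ => measurableSet_singleton _
  · exact MeasurableSet.pi (Finset.countable_toSet _) fun _ _ => measurableSet_unitInterval_Icc _ _
  · exact MeasurableSet.pi (Finset.countable_toSet _) fun _ _ => measurableSet_unitInterval_Icc _ _
  · exact MeasurableSet.pi (Finset.countable_toSet _) fun _ _ => measurableSet_Icc

lemma exp_neg_mul_le {a C X : ℝ} (h : -(C * X) ≤ a) : Real.exp (-C * X) ≤ Real.exp a :=
  Real.exp_le_exp.2 (by linarith)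

/-- The event is a product over independent ingredients and constrains a number of nodes that
depends on `d₀` only. Intervals of length `δ` or `τ * δ`, the density `τ ^ a₂` and the tail `exp
(-B₂ |m|)` each cost at most a constant times `1 - log δ - log τ + |m|`. -/
theorem AssumptionP.exists_le_treeLaw (hP : AssumptionP P d) {d₀ : ℕ} (hd : d₀ ≤ d) {κ : ℝ}
    (hκ : 0 < κ) :
    ∃ C > 0, ∃ τ₁ > 0, τ₁ ≤ 1 ∧ ∀ (lo hi : ℕ → ℝ) (δ τ : ℝ) (c : ℕ → ℝ) (m : ℝ),
      (∀ r < d₀, 0 ≤ lo r ∧ hi r ≤ 1 ∧ lo r + κ ≤ hi r) → 0 < δ → δ ≤ 1 / 2 → 0 < τ → τ ≤ τ₁ →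
      (∀ i < d₀, c i ∈ Set.Icc (0 : ℝ) 1) →
      Real.exp (-C * (1 - Real.log δ - Real.log τ + |m|)) ≤
        P.treeLaw.real (treeEvent d₀ lo hi δ τ c m) := by
  -- The exponent `a₂` is a natural number; a real exponent may be rounded up for small `τ`, so this
  -- loses nothing.
  obtain ⟨a₁, ha₁, a₂, ha₂, τ₀, hτ₀, hband⟩ := hP.bandwidth
  obtain ⟨B₁, hB₁, B₂, hB₂, hleaf⟩ := hP.leaf
  set b₀ := P.branchLaw.real (Set.pi (nodesBelow (2 * d₀ + 1)) fun u =>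
    {decide (u.length < 2 * d₀)}) with hb₀_def
  have hb₀ : 0 < b₀ := hP.branchLaw_pos (by omega)
  set n₁ := (nodesBelow (2 * d₀)).card with hn₁
  set n₂ := (nodesAt (2 * d₀)).card with hn₂
  set C := (|Real.log a₁| + a₂ + 1) + |Real.log b₀| + n₁ * |Real.log κ| + n₁ +
    n₂ * (|Real.log (2 * B₁ * Real.exp (-B₂))| + 1 + B₂) with hC
  refine ⟨C, by positivity, min (τ₀ / 4) 1, by positivity, min_le_right _ _,
    fun lo hi δ τ c m hW hδ hδ2 hτ hτ1 hc => ?_⟩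
  have hτ1' : τ ≤ 1 := hτ1.trans (min_le_right _ _)
  have hτ0' : τ ≤ τ₀ / 4 := hτ1.trans (min_le_left _ _)
  have hlogδ : Real.log δ ≤ 0 := Real.log_nonpos hδ.le (by linarith)
  have hlogτ : Real.log τ ≤ 0 := Real.log_nonpos hτ.le hτ1'
  set X := 1 - Real.log δ - Real.log τ + |m| with hX
  have hm0 := abs_nonneg m
  have hX1 : 1 ≤ X := by linarith
  -- the bandwidth
  have h1 : Real.exp (-(|Real.log a₁| + a₂ + 1) * X) ≤
      P.bandwidthLaw.real (Set.Icc τ (τ * (1 + δ))) := by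
    have : IsFiniteMeasure (volume.withDensity fun x => ENNReal.ofReal (P.bandwidthPDF x)) :=
      inferInstanceAs (IsFiniteMeasure P.bandwidthLaw)
    have h := le_withDensity_real_Icc (f := P.bandwidthPDF) (b := a₁ * τ ^ a₂) (u := τ)
      (v := τ * (1 + δ)) (by nlinarith) fun x hx => by
        refine le_trans ?_ (hband x (hτ.trans_le hx.1) (by nlinarith [hx.2]))
        exact mul_le_mul_of_nonneg_left (pow_le_pow_left₀ hτ.le hx.1 _) ha₁.le
    refine le_trans ?_ h
    have e : a₁ * τ ^ a₂ * (τ * (1 + δ) - τ) =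
        Real.exp (Real.log a₁ + a₂ * Real.log τ + (Real.log τ + Real.log δ)) := by
      rw [Real.exp_add, Real.exp_add, Real.exp_add, Real.exp_log ha₁, Real.exp_log hτ,
        Real.exp_log hδ, Real.exp_nat_mul, Real.exp_log hτ]
      ring
    rw [e]
    refine exp_neg_mul_le ?_
    have h2 : -|Real.log a₁| ≤ Real.log a₁ := neg_abs_le _
    have h3 : |Real.log a₁| * 1 ≤ |Real.log a₁| * X :=
      mul_le_mul_of_nonneg_left hX1 (abs_nonneg _)
    have h4 : a₂ * (-Real.log τ) ≤ a₂ * X := 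
      mul_le_mul_of_nonneg_left (by linarith) (Nat.cast_nonneg _)
    nlinarith
  -- the topology
  have h2 : Real.exp (-|Real.log b₀| * X) ≤ b₀ := by
    conv_rhs => rw [← Real.exp_log hb₀]
    refine exp_neg_mul_le ?_
    have h3 : |Real.log b₀| * 1 ≤ |Real.log b₀| * X :=
      mul_le_mul_of_nonneg_left hX1 (abs_nonneg _)
    linarith [neg_abs_le (Real.log b₀)]
  -- the coordinates
  have h3 : Real.exp (-(n₁ * |Real.log κ|) * X) ≤
      (Measure.infinitePi fun _ : Node => (volume : Measure unitInterval)).real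
        (Set.pi (nodesBelow (2 * d₀)) fun u => {w : unitInterval | (w : ℝ) ∈
          Set.Icc (lo (u.length / 2)) (hi (u.length / 2))}) := by
    refine le_trans ?_ (pow_le_infinitePi_real_pi _
      (fun _ _ => measurableSet_unitInterval_Icc _ _) hκ.le fun u hu => ?_)
    · rw [← Real.exp_log hκ, ← Real.exp_nat_mul, Real.exp_log hκ]
      refine exp_neg_mul_le ?_
      have h4 : n₁ * |Real.log κ| * 1 ≤ n₁ * |Real.log κ| * X :=
        mul_le_mul_of_nonneg_left hX1 (by positivity)
      have h5 := mul_le_mul_of_nonneg_left (neg_abs_le (Real.log κ)) (Nat.cast_nonneg (α := ℝ) n₁)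
      linarith
    · have hu' := mem_nodesBelow.1 hu
      obtain ⟨h4, h5, h6⟩ := hW (u.length / 2) (by omega)
      rw [unitInterval_volume_real h4 (by linarith) h5]
      linarith
  -- the cut points
  have h4 : Real.exp (-n₁ * X) ≤
      (Measure.infinitePi fun _ : Node => (volume : Measure unitInterval)).real
        (Set.pi (nodesBelow (2 * d₀)) fun u => {w : unitInterval | (w : ℝ) ∈
          Set.Icc (cutLower c δ u.length) (cutLower c δ u.length + δ)}) := by
    refine le_trans ?_ (pow_le_infinitePi_real_pi _
      (fun _ _ => measurableSet_unitInterval_Icc _ _) hδ.le fun u hu => ?_)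
    · rw [← Real.exp_log hδ, ← Real.exp_nat_mul]
      refine exp_neg_mul_le ?_
      have h5 := mul_le_mul_of_nonneg_left (show -Real.log δ ≤ X by linarith)
        (Nat.cast_nonneg (α := ℝ) n₁)
      linarith
    · have hu' := mem_nodesBelow.1 hu
      have h5 := hc (u.length / 2) (by omega)
      -- The minimum with `1 - δ` keeps the whole interval of length `δ` inside `[0,1]`, even for a
      -- centre near `1`.
      have h6 : 0 ≤ cutLower c δ u.length ∧ cutLower c δ u.length ≤ 1 - δ := by
        unfold cutLower
        split
        · exact ⟨le_min h5.1 (by linarith), min_le_right _ _⟩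
        · exact ⟨by linarith, le_rfl⟩
      rw [unitInterval_volume_real h6.1 (by linarith) (by linarith)]
      linarith
  -- the leaf coefficients
  have h5 : Real.exp (-(n₂ * (|Real.log (2 * B₁ * Real.exp (-B₂))| + 1 + B₂)) * X) ≤
      (Measure.infinitePi fun _ : Node => P.leafLaw).real (Set.pi (nodesAt (2 * d₀)) fun v =>
        Set.Icc ((if v = spine d₀ then m else 0) - δ) ((if v = spine d₀ then m else 0) + δ)) := by
    set b := 2 * B₁ * Real.exp (-B₂) with hb
    have hb0 : 0 < b := by positivity
    refine le_trans ?_ (pow_le_infinitePi_real_pi (b := b * δ * Real.exp (-B₂ * |m|)) _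
      (fun _ _ => measurableSet_Icc) (by positivity) fun v hv => ?_)
    · rw [← Real.exp_log hδ, ← Real.exp_log hb0, ← Real.exp_add, ← Real.exp_add,
        ← Real.exp_nat_mul, Real.exp_log hb0]
      refine exp_neg_mul_le ?_
      have h6 : |Real.log b| * 1 ≤ |Real.log b| * X :=
        mul_le_mul_of_nonneg_left hX1 (abs_nonneg _)
      have h7 : B₂ * |m| ≤ B₂ * X := mul_le_mul_of_nonneg_left (by linarith) hB₂.le
      have h8 : -((|Real.log b| + 1 + B₂) * X) ≤ Real.log b + Real.log δ + -B₂ * |m| := by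
        linarith [neg_abs_le (Real.log b)]
      have h9 := mul_le_mul_of_nonneg_left h8 (Nat.cast_nonneg (α := ℝ) n₂)
      linarith
    · set m' := if v = spine d₀ then m else 0 with hm'
      have hm'' : |m'| ≤ |m| := by
        rw [hm']; split
        · exact le_rfl
        · simp
      have : IsFiniteMeasure (volume.withDensity fun x => ENNReal.ofReal (P.leafPDF x)) :=
        inferInstanceAs (IsFiniteMeasure P.leafLaw)
      have h := le_withDensity_real_Icc (f := P.leafPDF) (b := B₁ * Real.exp (-B₂ * (|m| + 1)))
        (u := m' - δ) (v := m' + δ) (by linarith) fun x hx => by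
          refine le_trans ?_ (hleaf x)
          refine mul_le_mul_of_nonneg_left (Real.exp_le_exp.2 ?_) hB₁.le
          have h6 : |x| ≤ |m| + 1 := by
            have h7 := abs_add_le (x - m') m'
            rw [sub_add_cancel] at h7
            have h8 : |x - m'| ≤ δ := abs_le.2 ⟨by linarith [hx.1], by linarith [hx.2]⟩
            linarith
          nlinarith
      refine le_trans (le_of_eq ?_) h
      rw [hb, show -B₂ * (|m| + 1) = -B₂ + -B₂ * |m| by ring, Real.exp_add]
      ring
  unfold PriorSpec.treeLaw treeEvent
  rw [measureReal_prod_prod, measureReal_prod_prod, measureReal_prod_prod, measureReal_prod_prod]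
  have e : -C * X = -(|Real.log a₁| + a₂ + 1) * X + (-|Real.log b₀| * X +
      (-(n₁ * |Real.log κ|) * X + (-n₁ * X +
        -(n₂ * (|Real.log (2 * B₁ * Real.exp (-B₂))| + 1 + B₂)) * X))) := by
    rw [hC]; ring
  rw [e, Real.exp_add, Real.exp_add, Real.exp_add, Real.exp_add]
  exact mul_le_mul h1 (mul_le_mul h2 (mul_le_mul h3 (mul_le_mul h4 h5 (Real.exp_pos _).le
    measureReal_nonneg) (by positivity) measureReal_nonneg) (by positivity) measureReal_nonneg)
    (by positivity) measureReal_nonneg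

/-! ### Lower bounds for the prior -/

lemma abs_softTree_sub_le_of_mem_treeEvent {ψ : ℝ → ℝ} {M L : ℝ} (hM1 : 1 ≤ M)
    (hM : ∀ x, |ψ x| ≤ M ∧ |1 - ψ x| ≤ M) (hL0 : 0 ≤ L)
    (hL : ∀ x y, |ψ x - ψ y| ≤ L * |x - y|) {p : ℕ} [NeZero p] {d : ℕ} {σ : ℕ → Fin p}
    (hσ : Set.InjOn σ (Set.Iio d)) {lo hi : ℕ → ℝ} {s : Fin p → ℝ}
    (hs : ∀ r < d, ∀ w : unitInterval, (w : ℝ) ∈ Set.Icc (lo r) (hi r) → selectCoord s w = σ r)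
    {δ τ₀ m : ℝ} {c : ℕ → ℝ} (hδ : 0 ≤ δ) (hτ₀ : 0 < τ₀) (hc : ∀ i < d, c i ∈ Set.Icc (0 : ℝ) 1)
    {D : TreeDraw} (hD : D ∈ treeEvent d lo hi δ τ₀ c m) {x : EuclideanSpace ℝ (Fin p)}
    (hx : x ∈ cube p) :
    |softTree ψ D.2.1 (fun u => selectCoord s (D.2.2.1 u)) D.2.2.2.1 D.2.2.2.2 D.1 x -
        m * ∏ i ∈ Finset.range d, AssumptionG.kernel ψ ((x (σ i) - c i) / τ₀)| ≤
      (nodesAt (2 * d)).card * M ^ (2 * d) * δ + |m| * (d * M ^ (2 * d) * (6 * L * δ / τ₀)) := by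
  obtain ⟨hτ, hB, hW, hV, hμ⟩ := hD
  have hcut {u : Node} (hu : u.length < 2 * d) :
      (D.2.2.2.1 u : ℝ) ∈ Set.Icc (cutLower c δ u.length) (cutLower c δ u.length + δ) :=
    hV u (by simpa using hu)
  refine IsFull.abs_softTree_sub_le hM1 hM hL0 hL (B := D.2.1)
    (fun u hu => hB u (by simpa using Nat.lt_succ_of_le hu)) hσ (fun u hu => ?_) hδ hτ₀ hτ hc
    (fun i hi => ?_) (fun i hi => ?_) (fun v hv => ?_) hx
  · exact hs _ (by omega) _ (hW u (by simpa using hu))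
  · have h1 := hcut (u := spine i) (by rw [length_spine]; omega)
    have h2 := hc i hi
    rw [length_spine, cutLower, if_pos (even_two_mul i), Nat.mul_div_cancel_left i two_pos] at h1
    rw [abs_le]
    rcases min_cases (c i) (1 - δ) with h | h
    · rw [h.1] at h1
      constructor <;> linarith [h1.1, h1.2]
    · rw [h.1] at h1
      constructor <;> linarith [h1.1, h1.2, h2.2]
  · have h1 := hcut (u := false :: spine i) (by rw [List.length_cons, length_spine]; omega)
    rw [List.length_cons, length_spine, cutLower, if_neg (by simp)] at h1
    exact h1.1
  · have h1 : D.2.2.2.2 v ∈ Set.Icc _ _ := hμ v (by simpa using hv)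
    rw [abs_le]
    constructor <;> linarith [h1.1, h1.2]

/-- The number of trees, the proportions and the trees are independent, so the costs of the exact
value `T`, of `goodSplit` and of the `T` events `treeEvent` add up. The deviation has a part `T * δ`
from the leaf coefficients and a part `W * δ / τ₀` from cuts and bandwidths. -/
theorem exists_le_prior {ψ : ℝ → ℝ} (hG : AssumptionG ψ) {P : PriorSpec} {d : ℕ}
    (hP : AssumptionP P d) {d₀ : ℕ} (hd : d₀ ≤ d) :
    ∃ C > 0, ∃ τ₁ > 0, ∀ (p : ℕ) [NeZero p] (σ : ℕ → Fin p) (T : ℕ) (μ : ℕ → ℝ) (c : ℕ → ℕ → ℝ)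
      (τ : ℕ → ℝ) (τ₀ W δ : ℝ), Set.InjOn σ (Set.Iio d₀) → 0 < τ₀ → 0 < δ → δ ≤ 1 / 2 →
      (∀ t < T, τ t ∈ Set.Icc τ₀ τ₁) → (∀ t < T, ∀ i < d₀, c t i ∈ Set.Icc (0 : ℝ) 1) →
      ∑ t ∈ Finset.range T, |μ t| ≤ W →
      Real.exp (-C * (1 + d₀ * Real.log p + T * (1 - Real.log δ - Real.log τ₀) + W)) ≤
        (P.prior p).real {ω | ∀ x ∈ cube p, |ω.toFun ψ x - ∑ t ∈ Finset.range T, μ t *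
          ∏ i ∈ Finset.range d₀, AssumptionG.kernel ψ ((x (σ i) - c t i) / τ t)| ≤
            C * ((T + W / τ₀) * δ)} := by
  obtain ⟨M, hM1, hM⟩ := hG.abs_le
  obtain ⟨L, hL0, hL⟩ := hG.exists_lipschitz
  obtain ⟨c₁, hc₁, c₂, hc₂, hnum⟩ := hP.numTrees
  -- The largest tolerance that `selectCoord_eq` accepts.
  set η : ℝ := 1 / (4 * (d₀ + 1)) with hη
  have hη0 : 0 < η := by positivity
  have hη1 : η ≤ 1 := by
    rw [hη, div_le_one (by positivity)]
    linarith [Nat.cast_nonneg (α := ℝ) d₀]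
  obtain ⟨C₁, hC₁, hdir⟩ := exists_le_dirichlet_goodSplit P.a_pos hP.dirichlet hη0 hη1 d₀
  -- The selecting intervals have length `1 / (2 * d₀)`; the slightly smaller `κ` also makes sense
  -- for `d₀ = 0`.
  obtain ⟨C₂, hC₂, τ₁, hτ₁, hτ₁1, htree⟩ :=
    hP.exists_le_treeLaw hd (κ := 1 / (2 * d₀ + 1)) (by positivity)
  set A₁ := (nodesAt (2 * d₀)).card * M ^ (2 * d₀) with hA₁
  set A₂ := d₀ * M ^ (2 * d₀) * (6 * L) with hA₂
  have hA₁0 : 0 ≤ A₁ := by positivity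
  have hA₂0 : 0 ≤ A₂ := by positivity
  set C := |Real.log c₁| + c₂ + C₁ + C₂ + A₁ + A₂ with hC
  refine ⟨C, by positivity, τ₁, hτ₁, fun p _ σ T μ c τ τ₀ W δ hσ hτ₀ hδ hδ2 hτ hc hW => ?_⟩
  have hp : (1 : ℝ) ≤ p := by exact_mod_cast NeZero.one_le
  have hlogp : 0 ≤ Real.log p := Real.log_nonneg hp
  have hW0 : 0 ≤ W := (Finset.sum_nonneg fun _ _ => abs_nonneg _).trans hW
  set S : Finset (Fin p) := (Finset.range d₀).image σ with hS
  have hScard : S.card = d₀ := by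
    rw [hS, Finset.card_image_of_injOn (by simpa [Set.InjOn] using hσ), Finset.card_range]
  have hmemS (r : ℕ) (hr : r < d₀) : σ r ∈ S := Finset.mem_image_of_mem σ (Finset.mem_range.2 hr)
  set lo : ℕ → ℝ := fun r => ((rank S (σ r) : ℝ) - 3 / 4) / S.card with hlo
  set hi : ℕ → ℝ := fun r => ((rank S (σ r) : ℝ) - 1 / 4) / S.card with hhi
  have hlohi (r : ℕ) (hr : r < d₀) : 0 ≤ lo r ∧ hi r ≤ 1 ∧ lo r + 1 / (2 * d₀ + 1) ≤ hi r := by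
    have h1 : (1 : ℝ) ≤ rank S (σ r) := by exact_mod_cast rank_pos (hmemS r hr)
    have h2 : (rank S (σ r) : ℝ) ≤ d₀ := by exact_mod_cast hScard ▸ rank_le S (σ r)
    have h3 : (0 : ℝ) < d₀ := by linarith
    simp only [hlo, hhi, hScard]
    refine ⟨div_nonneg (by linarith) h3.le, (div_le_one h3).2 (by linarith), ?_⟩
    have h4 : 1 / (2 * d₀ + 1 : ℝ) ≤ (1 / 2) / d₀ := by
      rw [div_le_div_iff₀ (by positivity) h3]; linarith
    calc _ ≤ ((rank S (σ r) : ℝ) - 3 / 4) / d₀ + (1 / 2) / d₀ := by linarith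
      _ = _ := by ring
  set E : ℕ → Set TreeDraw := fun t => treeEvent d₀ lo hi δ (τ t) (c t) (μ t) with hE
  set Q : Set (Draw p) := {T} ×ˢ goodSplit S η ×ˢ Set.pi (Finset.range T) E with hQ
  have hsub : Q ⊆ {ω | ∀ x ∈ cube p, |ω.toFun ψ x - ∑ t ∈ Finset.range T, μ t *
      ∏ i ∈ Finset.range d₀, AssumptionG.kernel ψ ((x (σ i) - c t i) / τ t)| ≤
        C * ((T + W / τ₀) * δ)} := by
    rintro ⟨T', s, D⟩ ⟨hT, ⟨g, ⟨hg1, hg2⟩, hgs⟩, hD⟩ x hx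
    obtain rfl : T' = T := hT
    have hsel (r : ℕ) (hr : r < d₀) (w : unitInterval) (hw : (w : ℝ) ∈ Set.Icc (lo r) (hi r)) :
        selectCoord s w = σ r := by
      have hgs' : (fun j => g j / ∑ i, g i) = s := hgs
      rw [← hgs']
      refine selectCoord_eq hη0 (le_of_eq ?_) hg1 hg2 (hmemS r hr) hw
      rw [hScard, hη]
      field_simp
    unfold Draw.toFun
    rw [← Finset.sum_sub_distrib]
    calc _ ≤ ∑ t ∈ Finset.range T', (A₁ * δ + |μ t| * (A₂ * (δ / τ₀))) := by
          refine (Finset.abs_sum_le_sum_abs _ _).trans (Finset.sum_le_sum fun t ht => ?_)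
          have ht' := Finset.mem_range.1 ht
          have hτt := hτ t ht'
          have hτpos : 0 < τ t := hτ₀.trans_le hτt.1
          refine (abs_softTree_sub_le_of_mem_treeEvent hM1 hM hL0 hL hσ hsel hδ.le
            hτpos (hc t ht') (hD t ht) hx).trans ?_
          refine add_le_add le_rfl (mul_le_mul_of_nonneg_left ?_ (abs_nonneg _))
          calc _ = A₂ * (δ / τ t) := by rw [hA₂]; ring
            _ ≤ _ := mul_le_mul_of_nonneg_left
              (div_le_div_of_nonneg_left hδ.le hτ₀ hτt.1) hA₂0
      _ = T' * (A₁ * δ) + (∑ t ∈ Finset.range T', |μ t|) * (A₂ * (δ / τ₀)) := by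
          rw [Finset.sum_add_distrib, Finset.sum_const, Finset.card_range, nsmul_eq_mul,
            Finset.sum_mul]
      _ ≤ T' * (A₁ * δ) + W * (A₂ * (δ / τ₀)) := by gcongr
      _ = A₁ * (T' * δ) + A₂ * (W / τ₀ * δ) := by ring
      _ ≤ C * (T' * δ) + C * (W / τ₀ * δ) := by
          have h0 := abs_nonneg (Real.log c₁)
          refine add_le_add (mul_le_mul_of_nonneg_right ?_ (by positivity))
            (mul_le_mul_of_nonneg_right ?_ (by positivity)) <;> linarith
      _ = _ := by ring
  refine le_trans ?_ (measureReal_mono hsub)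
  have hp0 : (0 : ℝ) < p := by linarith
  have hγ (j : Fin p) : IsProbabilityMeasure (gammaMeasure (P.a / (p : ℝ) ^ P.ξ) 1) :=
    isProbabilityMeasure_gammaMeasure (div_pos P.a_pos (Real.rpow_pos_of_pos hp0 _)) one_pos
  have hdirprob : IsProbabilityMeasure (dirichlet fun _ : Fin p => P.a / (p : ℝ) ^ P.ξ) :=
    have : IsProbabilityMeasure
        (Measure.pi fun _ : Fin p => gammaMeasure (P.a / (p : ℝ) ^ P.ξ) 1) :=
      @Measure.pi.instIsProbabilityMeasure _ _ _ _ _ hγ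
    Measure.isProbabilityMeasure_map (by fun_prop)
  have h1 : Real.exp (-(|Real.log c₁| + c₂ * T)) ≤ P.numTrees.toMeasure.real {T} := by
    rw [measureReal_def, PMF.toMeasure_apply_singleton _ _ (measurableSet_singleton _)]
    refine le_trans ?_ (hnum T)
    rw [neg_add, Real.exp_add, ← neg_mul]
    refine mul_le_mul_of_nonneg_right ?_ (Real.exp_pos _).le
    conv_rhs => rw [← Real.exp_log hc₁]
    exact Real.exp_le_exp.2 (neg_abs_le _)
  have h2 := hdir p S hScard
  have hτ₀log (t : ℕ) (ht : t < T) : Real.log τ₀ ≤ Real.log (τ t) :=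
    Real.log_le_log hτ₀ (hτ t ht).1
  have h3 : Real.exp (-C₂ * (T * (1 - Real.log δ - Real.log τ₀) + W)) ≤
      (Measure.infinitePi fun _ : ℕ => P.treeLaw).real (Set.pi (Finset.range T) E) := by
    rw [infinitePi_real_pi _ fun t _ => measurableSet_treeEvent _ _ _ _ _ _ _]
    calc _ ≤ Real.exp (∑ t ∈ Finset.range T,
          -C₂ * (1 - Real.log δ - Real.log (τ t) + |μ t|)) := by
          refine Real.exp_le_exp.2 ?_
          rw [← Finset.mul_sum, neg_mul, neg_mul, neg_le_neg_iff]
          refine mul_le_mul_of_nonneg_left ?_ hC₂.le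
          rw [Finset.sum_add_distrib]
          refine add_le_add ?_ hW
          calc _ ≤ ∑ _t ∈ Finset.range T, (1 - Real.log δ - Real.log τ₀) :=
                Finset.sum_le_sum fun t ht => by linarith [hτ₀log t (Finset.mem_range.1 ht)]
            _ = _ := by rw [Finset.sum_const, Finset.card_range, nsmul_eq_mul]
      _ = ∏ t ∈ Finset.range T, Real.exp (-C₂ * (1 - Real.log δ - Real.log (τ t) + |μ t|)) :=
          Real.exp_sum _ _
      _ ≤ _ := Finset.prod_le_prod (fun _ _ => (Real.exp_pos _).le) fun t ht => by
          have ht' := Finset.mem_range.1 ht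
          exact htree lo hi δ (τ t) (c t) (μ t) hlohi hδ hδ2 (hτ₀.trans_le (hτ t ht').1)
            (hτ t ht').2 (hc t ht')
  rw [hQ]
  unfold PriorSpec.prior
  rw [measureReal_prod_prod, measureReal_prod_prod]
  refine le_trans ?_ (mul_le_mul h1 (mul_le_mul h2 h3 (Real.exp_pos _).le measureReal_nonneg)
    (by positivity) measureReal_nonneg)
  rw [← Real.exp_add, ← Real.exp_add]
  refine Real.exp_le_exp.2 ?_
  set Y : ℝ := T * (1 - Real.log δ - Real.log τ₀) with hY
  -- `τ₀ ≤ 1` is known only if there is a tree whose bandwidth lies in `[τ₀, τ₁]`, so `T = 0` is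
  -- separate.
  have hTY : (T : ℝ) ≤ Y := by
    rcases Nat.eq_zero_or_pos T with h0 | h0
    · rw [hY, h0]; simp
    · have h4 : Real.log τ₀ ≤ 0 := (hτ₀log 0 h0).trans
        (Real.log_nonpos (hτ₀.trans_le (hτ 0 h0).1).le ((hτ 0 h0).2.trans hτ₁1))
      have h5 : Real.log δ ≤ 0 := Real.log_nonpos hδ.le (by linarith)
      rw [hY]
      exact le_mul_of_one_le_right (Nat.cast_nonneg _) (by linarith)
  have hT0 : (0 : ℝ) ≤ T := Nat.cast_nonneg T
  have hZ : 0 ≤ (d₀ : ℝ) * Real.log p := by positivity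
  have hl := abs_nonneg (Real.log c₁)
  set Z : ℝ := 1 + d₀ * Real.log p + Y + W with hZ_def
  have i1 : |Real.log c₁| * 1 ≤ |Real.log c₁| * Z := mul_le_mul_of_nonneg_left (by linarith) hl
  have i2 : c₂ * T ≤ c₂ * Z := mul_le_mul_of_nonneg_left (by linarith) hc₂.le
  have i3 : C₁ * (1 + d₀ * Real.log p) ≤ C₁ * Z := mul_le_mul_of_nonneg_left (by linarith) hC₁.le
  have i4 : C₂ * (Y + W) ≤ C₂ * Z := mul_le_mul_of_nonneg_left (by linarith) hC₂.le
  have i5 : 0 ≤ (A₁ + A₂) * Z := mul_nonneg (by linarith) (by linarith)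
  have i6 : C * Z = |Real.log c₁| * Z + c₂ * Z + C₁ * Z + C₂ * Z + (A₁ + A₂) * Z := by
    rw [hC]; ring
  linarith

/-! ### The rate -/

lemma IsKernelApprox.exists_nat {K : ℝ → ℝ} {τ₀ τ₁ T' W E : ℝ} {d : ℕ} {f : (Fin d → ℝ) → ℝ}
    (h : IsKernelApprox K τ₀ τ₁ T' W E f) :
    ∃ (T : ℕ) (μ : ℕ → ℝ) (c : ℕ → ℕ → ℝ) (τ : ℕ → ℝ), (T : ℝ) ≤ T' ∧
      (∀ t < T, ∀ i < d, c t i ∈ Set.Icc (0 : ℝ) 1) ∧ (∀ t < T, τ t ∈ Set.Icc τ₀ τ₁) ∧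
      ∑ t ∈ Finset.range T, |μ t| ≤ W ∧ ∀ z : ℕ → ℝ, (∀ i < d, z i ∈ Set.Icc (0 : ℝ) 1) →
        |f (fun i => z i) - ∑ t ∈ Finset.range T, μ t * ∏ i ∈ Finset.range d,
          K ((z i - c t i) / τ t)| ≤ E := by
  obtain ⟨A, _, μ, c, τ, h1, h2, h3, h4, h5⟩ := h
  set e := (Fintype.equivFin A).symm with he
  refine ⟨Fintype.card A, fun t => if ht : t < Fintype.card A then μ (e ⟨t, ht⟩) else 0,
    fun t i => if h : t < Fintype.card A ∧ i < d then c (e ⟨t, h.1⟩) ⟨i, h.2⟩ else 0,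
    fun t => if ht : t < Fintype.card A then τ (e ⟨t, ht⟩) else 0, h1, fun t ht i hi => ?_,
    fun t ht => ?_, ?_, fun z hz => ?_⟩
  · simp only [ht, hi, and_self, dif_pos]
    exact h2 _ _
  · simp only [ht, dif_pos]
    exact h3 _
  · rw [← Fin.sum_univ_eq_sum_range]
    simp only [Fin.is_lt, dif_pos, Fin.eta]
    rw [e.sum_comp fun a => |μ a|]
    exact h4
  · rw [← Fin.sum_univ_eq_sum_range]
    simp only [← Fin.prod_univ_eq_prod_range, Fin.is_lt, dif_pos, Fin.eta, and_self]
    rw [e.sum_comp fun a => μ a * ∏ i : Fin d, K ((z i - c a i) / τ a)]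
    exact h5 _ fun i => hz i i.2

/-- Adds dimension zero to `exists_isKernelApprox`: a constant is one multiple of the empty product.
-/
theorem exists_isKernelApprox_of_locallyReproduced {K : ℝ → ℝ} (hK : IsKernel K) {M ρ : ℝ}
    (hρ : 0 < ρ) (hpoly : PolyApprox K M ρ) {MK : ℝ} (hMK : ∀ x, |K x| ≤ MK) (ι : Type) [Fintype ι]
    [DecidableEq ι] {n : ℕ} {x : Fin n → ℝ} {a : Fin n → Fin n → ℝ}
    (hx : IsInterpolation x a) {α C₁ R : ℝ} (hα : 0 ≤ α) (hC₁ : 0 ≤ C₁) (hR : 0 ≤ R) {k₀ : ℕ}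
    (hk₀ : 2 ≤ k₀) :
    ∃ C > 0, ∀ (f : (ι → ℝ) → ℝ) (k₁ V : ℕ), LocallyReproduced x a α C₁ f →
      (∀ y : ι → ℝ, (∀ j, y j ∈ Set.Icc (0 : ℝ) 1) → |f y| ≤ R) → k₀ ≤ k₁ → 1 ≤ V →
      (V + 1) * (M * (1 / 2) ^ V) ≤ 1 →
      IsKernelApprox K ((2 : ℝ) ^ k₁)⁻¹ ((2 : ℝ) ^ k₀)⁻¹
        (C * (V * 2 ^ k₁) ^ Fintype.card ι) (C * (V * 2 ^ k₁) ^ Fintype.card ι)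
        (C * ((2 ^ (-(k₁ : ℝ))) ^ α +
          (V * 2 ^ k₁) ^ Fintype.card ι * ((V + 1) * (M * (1 / 2) ^ V)))) f := by
  rcases isEmpty_or_nonempty ι with hι | hι
  · have hM := hpoly.nonneg hρ
    refine ⟨1 + R, by positivity, fun f k₁ V _ hfR hk _ _ => ?_⟩
    rw [Fintype.card_eq_zero, pow_zero]
    refine ⟨Unit, inferInstance, fun _ => f isEmptyElim, fun _ => isEmptyElim,
      fun _ => ((2 : ℝ) ^ k₁)⁻¹, by simpa using hR, fun _ j => isEmptyElim j,
      fun _ => ⟨le_rfl, inv_anti₀ (by positivity) (pow_le_pow_right₀ one_le_two hk)⟩, ?_,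
      fun y _ => ?_⟩
    · have := hfR isEmptyElim fun j => isEmptyElim j
      simp only [Finset.univ_unique, Finset.sum_singleton]
      linarith
    · rw [Subsingleton.elim y isEmptyElim]
      simp only [Finset.univ_unique, Finset.sum_singleton, Finset.univ_eq_empty,
        Finset.prod_empty, mul_one, sub_self, abs_zero]
      positivity
  · exact exists_isKernelApprox hK hρ hpoly hMK ι hx hα hC₁ hR hk₀

lemma exists_isInterpolation (n : ℕ) :
    ∃ (x : Fin n → ℝ) (a : Fin n → Fin n → ℝ), IsInterpolation x a := by
  obtain ⟨x, a, h1, -, h2⟩ := exists_stable_nodes n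
  exact ⟨x, a, h1, h2⟩

/-- The bandwidth at which bias and complexity balance. -/
noncomputable def balance (α : ℝ) (d n : ℕ) : ℝ :=
  (n : ℝ) ^ (-(1 / (2 * α + d))) * Real.log n ^ ((d + 1) / (2 * α + d))

section

variable {α : ℝ} {d n : ℕ}

lemma one_le_of_one_le_log (hn : 1 ≤ Real.log n) : (1 : ℝ) ≤ n := by
  by_contra! h
  have : Real.log n ≤ 0 := Real.log_nonpos (Nat.cast_nonneg n) h.le
  linarith

lemma balance_pos (hn : 1 ≤ Real.log n) : 0 < balance α d n := by
  have := one_le_of_one_le_log hn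
  unfold balance
  positivity

lemma balance_rpow (hn : 1 ≤ Real.log n) : balance α d n ^ α =
    (n : ℝ) ^ (-α / (2 * α + d)) * Real.log n ^ (α * (d + 1) / (2 * α + d)) := by
  have h1 := one_le_of_one_le_log hn
  unfold balance
  rw [Real.mul_rpow (by positivity) (by positivity), ← Real.rpow_mul (by positivity),
    ← Real.rpow_mul (by positivity)]
  congr 2 <;> ring

/-- The equation that defines the scale: `n` times the squared bias equals the complexity, namely
about `(log n / h) ^ d` trees at a cost `log n` each. -/
lemma mul_balance_rpow_sq (hα : 0 < α) (hn : 1 ≤ Real.log n) :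
    n * (balance α d n ^ α) ^ 2 = Real.log n ^ (d + 1) * (balance α d n)⁻¹ ^ d := by
  have h1 := one_le_of_one_le_log hn
  have hb := balance_pos (α := α) (d := d) hn
  have hν : 0 < 2 * α + d := by positivity
  have h2 : balance α d n ^ (2 * α + d) = (n : ℝ)⁻¹ * Real.log n ^ (d + 1) := by
    unfold balance
    rw [Real.mul_rpow (by positivity) (by positivity), ← Real.rpow_mul (by positivity),
      ← Real.rpow_mul (by positivity), neg_mul, one_div, inv_mul_cancel₀ hν.ne', Real.rpow_neg_one,
      div_mul_cancel₀ _ hν.ne', ← Real.rpow_natCast]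
    push_cast; rfl
  have h3 : (balance α d n ^ α) ^ 2 * balance α d n ^ d = balance α d n ^ (2 * α + d) := by
    rw [Real.rpow_add hb, Real.rpow_natCast, ← Real.rpow_natCast, ← Real.rpow_mul hb.le, mul_comm α]
    norm_num
  rw [h2] at h3
  rw [inv_pow, ← div_eq_mul_inv, eq_div_iff (by positivity), mul_assoc, h3]
  field_simp

lemma inv_balance_le (hα : 0 < α) (hn : 1 ≤ Real.log n) :
    (balance α d n)⁻¹ ≤ (n : ℝ) ^ (1 / (2 * α + d)) := by
  have h1 := one_le_of_one_le_log hn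
  have hν : 0 < 2 * α + d := by positivity
  have h2 : 1 ≤ Real.log n ^ ((d + 1) / (2 * α + d)) := Real.one_le_rpow hn (by positivity)
  unfold balance
  rw [mul_inv, Real.rpow_neg (by positivity), inv_inv]
  exact mul_le_of_le_one_right (by positivity) (inv_le_one_of_one_le₀ h2)

/-- Errors that are the number of grid cells times a negative power of `n` are thereby dominated by
the bias. -/
lemma inv_balance_pow_le (hα : 0 < α) (hn : 1 ≤ Real.log n) :
    (balance α d n)⁻¹ ^ d / n ≤ balance α d n ^ α := by
  have h1 := one_le_of_one_le_log hn
  have hb := balance_pos (α := α) (d := d) hn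
  have hν : 0 < 2 * α + d := by positivity
  have h2 : (balance α d n)⁻¹ ^ d / balance α d n ^ α = (balance α d n)⁻¹ ^ (d + α) := by
    rw [Real.rpow_add (by positivity), Real.rpow_natCast, Real.inv_rpow hb.le]
    rfl
  have h3 : (balance α d n)⁻¹ ^ (d + α) ≤ n := by
    calc _ ≤ ((n : ℝ) ^ (1 / (2 * α + d))) ^ (d + α) :=
          Real.rpow_le_rpow (by positivity) (inv_balance_le hα hn) (by positivity)
      _ = (n : ℝ) ^ ((d + α) / (2 * α + d)) := by
          rw [← Real.rpow_mul (by positivity)]; congr 1; ring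
      _ ≤ (n : ℝ) ^ (1 : ℝ) := Real.rpow_le_rpow_of_exponent_le h1
          ((div_le_one hν).2 (by linarith))
      _ = n := Real.rpow_one _
  rw [div_le_iff₀ (by positivity)]
  rw [← h2, div_le_iff₀ (by positivity)] at h3
  linarith

lemma tendsto_balance (hα : 0 < α) :
    Filter.Tendsto (balance α d) Filter.atTop (nhds 0) := by
  have hν : 0 < 2 * α + d := by positivity
  have h := (isLittleO_log_rpow_rpow_atTop ((d + 1) / (2 * α + d))
    (show 0 < 1 / (2 * α + d) by positivity)).tendsto_div_nhds_zero.comp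
      tendsto_natCast_atTop_atTop
  refine h.congr fun n => ?_
  unfold balance
  rw [Real.rpow_neg (Nat.cast_nonneg n), inv_mul_eq_div]
  rfl

end

set_option maxHeartbeats 1000000 in
/-- The choice of the finest scale, the order of the polynomial approximation and the accuracy of
the tree parameters. -/
lemma exists_scales {α : ℝ} (hα : 0 < α) {d₀ d : ℕ} (hd : d₀ ≤ d) {M : ℝ} (hM : 0 ≤ M) (k₀ : ℕ) :
    ∃ c > 0, ∃ N : ℕ, ∀ n ≥ N, 1 ≤ Real.log n ∧ ∃ (k₁ V : ℕ) (δ : ℝ), k₀ ≤ k₁ ∧ 1 ≤ V ∧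
      (V + 1) * (M * (1 / 2) ^ V) ≤ 1 ∧ 0 < δ ∧ δ ≤ 1 / 2 ∧
      ((2 : ℝ) ^ (-(k₁ : ℝ))) ^ α ≤ balance α d n ^ α ∧
      (V * 2 ^ k₁) ^ d₀ * ((V + 1) * (M * (1 / 2) ^ V)) ≤ c * balance α d n ^ α ∧
      (V * 2 ^ k₁) ^ d₀ * 2 ^ k₁ * δ ≤ c * balance α d n ^ α ∧
      (V * 2 ^ k₁) ^ d₀ * (1 - Real.log δ - Real.log ((2 : ℝ) ^ k₁)⁻¹) ≤
        c * (Real.log n ^ (d + 1) * (balance α d n)⁻¹ ^ d) := by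
  have hν : 0 < 2 * α + d := by positivity
  -- With `V` at least `κ * log n`, the bound `2 * log 2 > 1` gives `2 ^ (-V) ≤ n ^ (-(d + 2))`.
  set κ : ℝ := 2 * (d + 2) with hκ
  have hκ0 : 0 ≤ κ := by positivity
  set D : ℝ := (2 * (κ + 1)) ^ d with hD
  have hD0 : 0 < D := by positivity
  set ν : ℝ := 1 / (2 * α + d) with hνd
  have hν0 : 0 < ν := by positivity
  refine ⟨D * (κ + 2) * M + 2 * D + D * (d + 3 + 2 * ν), by positivity, ?_⟩
  have hev : ∀ᶠ n : ℕ in Filter.atTop, 1 ≤ Real.log n ∧ (2 : ℝ) ≤ n ∧ (κ + 2) * M ≤ n ∧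
      balance α d n ≤ (1 / 2) ^ k₀ := by
    have h1 := (Real.tendsto_log_atTop.comp tendsto_natCast_atTop_atTop).eventually_ge_atTop
      (1 : ℝ)
    have h2 := (tendsto_natCast_atTop_atTop (R := ℝ)).eventually_ge_atTop 2
    have h3 := (tendsto_natCast_atTop_atTop (R := ℝ)).eventually_ge_atTop ((κ + 2) * M)
    have h4 := (tendsto_balance (d := d) hα).eventually_le_const
      (show (0 : ℝ) < (1 / 2) ^ k₀ by positivity)
    filter_upwards [h1, h2, h3, h4] with n a b c e using ⟨a, b, c, e⟩
  obtain ⟨N, hN⟩ := Filter.eventually_atTop.1 hev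
  refine ⟨N, fun n hn => ?_⟩
  obtain ⟨hl, hn2, hnM, hbk⟩ := hN n hn
  refine ⟨hl, ?_⟩
  have hn0 : (0 : ℝ) < n := by linarith
  set ℓ := Real.log n with hℓ
  have hℓn : ℓ ≤ n := (Real.log_le_sub_one_of_pos hn0).trans (by linarith)
  have hb := balance_pos (α := α) (d := d) hl
  have hHn := inv_balance_le (d := d) hα hl
  have hHd := inv_balance_pow_le (d := d) hα hl
  rw [← hνd] at hHn
  set h := balance α d n with hh
  have hh1 : h ≤ 1 := hbk.trans (pow_le_one₀ (by norm_num) (by norm_num))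
  -- The finest dyadic scale is the first one below the balancing bandwidth.
  obtain ⟨k₁, hk1, hk2⟩ : ∃ k₁ : ℕ, ((2 : ℝ) ^ k₁)⁻¹ < h ∧ h ≤ 2 * ((2 : ℝ) ^ k₁)⁻¹ := by
    obtain ⟨m, h1, h2⟩ := exists_nat_pow_near_of_lt_one hb hh1 (by norm_num : (0 : ℝ) < 2⁻¹)
      (by norm_num)
    rw [inv_pow] at h1 h2
    exact ⟨m + 1, h1, h2.trans (by rw [pow_succ, mul_inv]; linarith)⟩
  have hH1 : 1 ≤ h⁻¹ := (one_le_inv₀ hb).2 hh1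
  set V := ⌈κ * ℓ⌉₊ with hV
  have hκℓ : 1 ≤ κ * ℓ := by rw [hκ]; nlinarith [Nat.cast_nonneg (α := ℝ) d]
  have hV1 : (1 : ℝ) ≤ V := hκℓ.trans (Nat.le_ceil _)
  have hV2 : (V : ℝ) ≤ (κ + 1) * ℓ := by
    have := (Nat.ceil_lt_add_one (zero_le_one.trans hκℓ)).le
    linarith
  have hVn : (1 / 2 : ℝ) ^ V ≤ ((n : ℝ) ^ (d + 2))⁻¹ := by
    have e1 : ((n : ℝ) ^ (d + 2))⁻¹ = Real.exp (-((d + 2) * ℓ)) := by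
      rw [Real.exp_neg, hℓ, mul_comm, Real.exp_mul, Real.exp_log hn0, ← Real.rpow_natCast]
      push_cast; rfl
    have e2 : (1 / 2 : ℝ) ^ V = Real.exp (-(V * Real.log 2)) := by
      rw [Real.exp_neg, mul_comm, Real.exp_mul, Real.exp_log two_pos, Real.rpow_natCast]
      simp
    rw [e1, e2, Real.exp_le_exp]
    have := Nat.le_ceil (κ * ℓ)
    have := Real.log_two_gt_d9
    nlinarith
  have hk2' : (2 : ℝ) ^ k₁ ≤ 2 * h⁻¹ := by
    rw [← div_eq_mul_inv, le_div_iff₀ hb]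
    rw [← div_eq_mul_inv, le_div_iff₀ (by positivity)] at hk2
    linarith
  set X : ℝ := (V * 2 ^ k₁) ^ d₀ with hX
  have hX0 : 0 ≤ X := by positivity
  have hXle : X ≤ D * ℓ ^ d * h⁻¹ ^ d := by
    have e1 : (V * 2 ^ k₁ : ℝ) ≤ 2 * (κ + 1) * ℓ * h⁻¹ := by
      calc (V * 2 ^ k₁ : ℝ) ≤ (κ + 1) * ℓ * (2 * h⁻¹) := by gcongr
        _ = _ := by ring
    have e2 : (1 : ℝ) ≤ 2 * (κ + 1) * ℓ * h⁻¹ :=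
      (one_le_mul_of_one_le_of_one_le hV1 (one_le_pow₀ one_le_two)).trans e1
    calc X ≤ (2 * (κ + 1) * ℓ * h⁻¹) ^ d₀ := by rw [hX]; gcongr
      _ ≤ (2 * (κ + 1) * ℓ * h⁻¹) ^ d := pow_le_pow_right₀ e2 hd
      _ = _ := by rw [hD, mul_pow, mul_pow]
  have hXn : X ≤ D * n ^ d * h⁻¹ ^ d := hXle.trans (by gcongr)
  have hE : (V + 1) * (M * (1 / 2) ^ V) ≤ (κ + 2) * M * n * ((n : ℝ) ^ (d + 2))⁻¹ := by
    calc _ ≤ ((κ + 2) * n) * (M * ((n : ℝ) ^ (d + 2))⁻¹) := by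
          gcongr
          nlinarith
      _ = _ := by ring
  have hnν : (1 : ℝ) ≤ n ^ ν := Real.one_le_rpow (by linarith) hν0.le
  -- In this `δ`, the power `n ^ d` absorbs the logarithms in `X`, `n ^ ν` absorbs `2 ^ k₁`, and one
  -- more `n` leaves `h⁻¹ ^ d / n`, which is at most `h ^ α`. Since `δ` is a power of `1 / n`, a
  -- tree still costs only a multiple of `log n`.
  refine ⟨k₁, V, ((n : ℝ) ^ (d + 1) * n ^ ν)⁻¹, ?_, by exact_mod_cast hV1, hE.trans ?_,
    by positivity, ?_, ?_, ?_, ?_, ?_⟩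
  · by_contra! hlt
    have : (1 / 2 : ℝ) ^ k₀ ≤ (1 / 2) ^ k₁ :=
      pow_le_pow_of_le_one (by norm_num) (by norm_num) hlt.le
    rw [one_div, inv_pow, inv_pow] at this
    rw [one_div, inv_pow] at hbk
    linarith
  · rw [← div_eq_mul_inv, div_le_one (by positivity), pow_succ]
    have e : (n : ℝ) ≤ n ^ (d + 1) := le_self_pow₀ (by linarith) (by omega)
    gcongr
    exact hnM.trans e
  · rw [one_div]
    refine inv_anti₀ two_pos ?_
    have e : (n : ℝ) ≤ n ^ (d + 1) := le_self_pow₀ (by linarith) (by omega)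
    nlinarith
  · refine Real.rpow_le_rpow (by positivity) ?_ hα.le
    rw [Real.rpow_neg two_pos.le, Real.rpow_natCast]
    exact hk1.le
  · calc _ ≤ D * n ^ d * h⁻¹ ^ d * ((κ + 2) * M * n * ((n : ℝ) ^ (d + 2))⁻¹) := by gcongr
      _ = D * (κ + 2) * M * (h⁻¹ ^ d / n) := by field_simp; ring
      _ ≤ D * (κ + 2) * M * h ^ α := by gcongr
      _ ≤ _ := by
        refine mul_le_mul_of_nonneg_right ?_ (by positivity)
        have : 0 ≤ 2 * D + D * (d + 3 + 2 * ν) := by positivity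
        linarith
  · calc _ ≤ D * n ^ d * h⁻¹ ^ d * (2 * n ^ ν) * ((n : ℝ) ^ (d + 1) * n ^ ν)⁻¹ := by
          gcongr
          linarith
      _ = 2 * D * (h⁻¹ ^ d / n) := by field_simp; ring
      _ ≤ 2 * D * h ^ α := by gcongr
      _ ≤ _ := by
        refine mul_le_mul_of_nonneg_right ?_ (by positivity)
        have : 0 ≤ D * (κ + 2) * M + D * (d + 3 + 2 * ν) := by positivity
        linarith
  · have e1 : -Real.log ((n : ℝ) ^ (d + 1) * n ^ ν)⁻¹ = (d + 1) * ℓ + ν * ℓ := by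
      rw [Real.log_inv, neg_neg, Real.log_mul (by positivity) (by positivity), Real.log_pow,
        Real.log_rpow hn0]
      push_cast; rfl
    have e2 : -Real.log ((2 : ℝ) ^ k₁)⁻¹ ≤ ℓ + ν * ℓ := by
      rw [Real.log_inv, neg_neg]
      calc _ ≤ Real.log (2 * n ^ ν) := Real.log_le_log (by positivity) (by linarith)
        _ = Real.log 2 + ν * ℓ := by
          rw [Real.log_mul two_ne_zero (by positivity), Real.log_rpow hn0]
        _ ≤ _ := by
          have := Real.log_two_lt_d9
          linarith
    calc _ ≤ (D * ℓ ^ d * h⁻¹ ^ d) * ((d + 3 + 2 * ν) * ℓ) := by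
          refine mul_le_mul hXle ?_ ?_ (by positivity)
          · linarith
          have e3 : 0 ≤ (d + 1) * ℓ + ν * ℓ := by positivity
          have e4 : Real.log ((2 : ℝ) ^ k₁)⁻¹ ≤ 0 :=
            Real.log_nonpos (by positivity) (inv_le_one_of_one_le₀ (one_le_pow₀ one_le_two))
          linarith
      _ = D * (d + 3 + 2 * ν) * (ℓ ^ (d + 1) * h⁻¹ ^ d) := by rw [pow_succ]; ring
      _ ≤ _ := by
        refine mul_le_mul_of_nonneg_right ?_ (by positivity)
        have : 0 ≤ D * (κ + 2) * M + 2 * D := by positivity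
        linarith

lemma exists_selector {p : ℕ} [NeZero p] (S : Finset (Fin p)) :
    ∃ σ : ℕ → Fin p, Set.InjOn σ (Set.Iio S.card) ∧ ∀ j ∈ S, ∃ i < S.card, σ i = j := by
  set e := S.equivFin with he
  refine ⟨fun i => if h : i < S.card then (e.symm ⟨i, h⟩ : Fin p) else 0, ?_, ?_⟩
  · intro i hi j hj hij
    have hi' : i < S.card := hi
    have hj' : j < S.card := hj
    simp only [hi', hj', dif_pos] at hij
    simpa using e.symm.injective (Subtype.ext hij)
  · intro j hj
    refine ⟨e ⟨j, hj⟩, (e ⟨j, hj⟩).2, ?_⟩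
    simp

/-- The kernels live on the `d₀` relevant coordinates, whereas the scale is balanced for `d ≥ d₀`;
the complexity in dimension `d₀` is bounded by that in dimension `d`. -/
theorem exists_le_prior_of_card {ψ : ℝ → ℝ} (hG : AssumptionG ψ) {P : PriorSpec} {d : ℕ}
    (hP : AssumptionP P d) {α R : ℝ} (hα : 0 < α) (hR : 0 < R) {d₀ : ℕ} (hd : d₀ ≤ d) :
    ∃ C > 0, ∃ N : ℕ, ∀ n ≥ N, ∀ (p : ℕ) [NeZero p], ∀ f₀ ∈ HolderBall p α R,
      ∀ S : Finset (Fin p), S.card = d₀ →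
      (∀ x ∈ cube p, ∀ y ∈ cube p, (∀ j ∈ S, x j = y j) → f₀ x = f₀ y) →
        Real.exp (-C * (n * (balance α d n ^ α) ^ 2 + d * Real.log p)) ≤
          (P.prior p).real {ω | ∀ x ∈ cube p, |ω.toFun ψ x - f₀ x| ≤ C * balance α d n ^ α} := by
  obtain ⟨ρ, hρ, M, hM, hstrip⟩ := hG.exists_hasStripExtension
  obtain ⟨MK, hMK⟩ : ∃ MK, ∀ x, |AssumptionG.kernel ψ x| ≤ MK :=
    ⟨_, fun x => by simpa using hstrip.abs_iteratedDeriv_le hρ 0 x⟩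
  obtain ⟨C₁, hC₁, τ₁, hτ₁, hprior⟩ := exists_le_prior hG hP hd
  obtain ⟨x, a, hx⟩ := exists_isInterpolation ⌈α⌉₊
  obtain ⟨k₀, hk₀2, hk₀τ⟩ : ∃ k₀ : ℕ, 2 ≤ k₀ ∧ ((2 : ℝ) ^ k₀)⁻¹ ≤ τ₁ := by
    obtain ⟨k, hk⟩ := exists_pow_lt_of_lt_one hτ₁ (by norm_num : (2 : ℝ)⁻¹ < 1)
    refine ⟨k + 2, by omega, ?_⟩
    rw [← inv_pow]
    exact (pow_le_pow_of_le_one (by norm_num) (by norm_num) (by omega)).trans hk.le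
  obtain ⟨C₂, hC₂, happrox⟩ := exists_isKernelApprox_of_locallyReproduced hG.isKernel
    (by positivity) (hstrip.polyApprox hρ) hMK (Fin d₀) hx hα.le
    (show 0 ≤ R * Fintype.card (Fin d₀) ^ (⌈α⌉₊ - 1) *
      (Fintype.card (Fin d₀) : ℝ) ^ (α - (⌈α⌉₊ - 1 : ℕ)) by positivity) hR.le hk₀2
  obtain ⟨c, hc, N, hscales⟩ := exists_scales hα hd (mul_pos two_pos hM).le k₀
  refine ⟨C₁ * (1 + c + 2 * C₂ * c) + C₂ * (1 + c), by positivity, N,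
    fun n hn p _ f₀ hf₀ S hS hdep => ?_⟩
  obtain ⟨hlog, k₁, V, δ, hk, hV, hV1, hδ, hδ2, hα1, hE, hXδ, hXl⟩ := hscales n hn
  obtain ⟨σ, hσ, hσS⟩ := exists_selector S
  rw [hS] at hσ hσS
  have hσi : Function.Injective fun i : Fin d₀ => σ i :=
    fun i j hij => Fin.ext (hσ i.2 j.2 hij)
  obtain ⟨T, μ, s, τ, hT, hs, hτ, hμ, hf⟩ := (happrox
    (fun y => f₀ (coordEmbed (fun i : Fin d₀ => σ i) y)) k₁ V (HolderBall.locallyReproduced hα hf₀ hσi hx)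
    (fun y hy => HolderBall.abs_le hf₀ (coordEmbed_mem_cube hσi hy)) hk hV hV1).exists_nat
  rw [Fintype.card_fin] at hT hμ hf
  have hb := balance_pos (α := α) (d := d) hlog
  set e := balance α d n ^ α with he
  have he0 : 0 < e := by positivity
  rw [← mul_balance_rpow_sq hα hlog, ← he] at hXl
  set Λ := (n : ℝ) * e ^ 2 with hΛ
  set X : ℝ := (V * 2 ^ k₁) ^ d₀ with hX
  have hp : 0 ≤ Real.log p := Real.log_natCast_nonneg p
  have hX1 : 1 ≤ X := one_le_pow₀ (one_le_mul_of_one_le_of_one_le (by exact_mod_cast hV)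
    (one_le_pow₀ one_le_two))
  set l := 1 - Real.log δ - Real.log ((2 : ℝ) ^ k₁)⁻¹ with hl
  have hl1 : 1 ≤ l := by
    have h1 : Real.log δ ≤ 0 := Real.log_nonpos hδ.le (by linarith)
    have h2 : Real.log ((2 : ℝ) ^ k₁)⁻¹ ≤ 0 :=
      Real.log_nonpos (by positivity) (inv_le_one_of_one_le₀ (one_le_pow₀ one_le_two))
    linarith
  have hXle : X ≤ X * l := le_mul_of_one_le_right (by positivity) hl1
  refine le_trans (Real.exp_le_exp.2 ?_) ((hprior p σ T μ s τ ((2 : ℝ) ^ k₁)⁻¹ (C₂ * X) δ hσ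
    (by positivity) hδ hδ2 (fun t ht => ⟨(hτ t ht).1, (hτ t ht).2.trans hk₀τ⟩) hs hμ).trans
      (measureReal_mono fun ω hω y hy => ?_))
  · rw [neg_mul, neg_mul]
    have h1 : T * l ≤ C₂ * (c * Λ) := by
      calc _ ≤ C₂ * X * l := by gcongr
        _ = C₂ * (X * l) := by ring
        _ ≤ _ := by gcongr
    have h2 : C₂ * X ≤ C₂ * (c * Λ) := by gcongr; linarith
    have h3 : (d₀ : ℝ) * Real.log p ≤ d * Real.log p := by gcongr
    have h4 : 0 ≤ d * Real.log p := by positivity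
    have h5 : 0 ≤ Λ := by positivity
    refine neg_le_neg ?_
    calc C₁ * (1 + d₀ * Real.log p + T * l + C₂ * X)
        ≤ C₁ * (c * Λ + d * Real.log p + C₂ * (c * Λ) + C₂ * (c * Λ)) := by gcongr; linarith
      _ ≤ C₁ * ((1 + c + 2 * C₂ * c) * (Λ + d * Real.log p)) := by
          gcongr
          have : 0 ≤ (c + 2 * C₂ * c) * (d * Real.log p) := by positivity
          nlinarith
      _ ≤ _ := by
          have : 0 ≤ C₂ * (1 + c) * (Λ + d * Real.log p) := by positivity
          linarith
  · have h1 := hω y hy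
    have h2 := hf (fun i => y (σ i)) fun i _ => hy _
    have h3 : f₀ (coordEmbed (fun i : Fin d₀ => σ i) fun i => y (σ i)) = f₀ y := by
      refine hdep _ (coordEmbed_mem_cube hσi fun i => hy _) _ hy fun j hj => ?_
      obtain ⟨i, hi, rfl⟩ := hσS j hj
      exact coordEmbed_apply_self hσi (fun i : Fin d₀ => y (σ i)) ⟨i, hi⟩
    rw [h3] at h2
    -- The total coefficient size `W` is taken to be `C₂ * X`, the same bound as for the number of
    -- trees.
    have h4 : (T + C₂ * X / ((2 : ℝ) ^ k₁)⁻¹) * δ ≤ 2 * C₂ * (c * e) := by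
      rw [div_inv_eq_mul]
      have h5 : (1 : ℝ) ≤ 2 ^ k₁ := one_le_pow₀ one_le_two
      calc _ ≤ (C₂ * X * 2 ^ k₁ + C₂ * X * 2 ^ k₁) * δ := by
            gcongr
            exact hT.trans (le_mul_of_one_le_right (by positivity) h5)
        _ = 2 * C₂ * (X * 2 ^ k₁ * δ) := by ring
        _ ≤ _ := by gcongr
    have h6 : C₂ * (((2 : ℝ) ^ (-(k₁ : ℝ))) ^ α + X * ((V + 1) * (2 * M * (1 / 2) ^ V))) ≤
        C₂ * (e + c * e) := by gcongr
    calc |ω.toFun ψ y - f₀ y| ≤ _ + _ := abs_sub_le _ _ _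
      _ ≤ C₁ * (2 * C₂ * (c * e)) + C₂ * (e + c * e) :=
        add_le_add (h1.trans (by gcongr)) (by rw [abs_sub_comm]; exact h2.trans h6)
      _ ≤ _ := by
        have : 0 ≤ C₁ * (1 + c) * e := by positivity
        linarith

end SoftBART

/-- The exact number of relevant covariates takes only the values `0, …, d`, so the constants and
thresholds of `exists_le_prior_of_card` can be summed over them. -/
theorem theorem1 (ψ : ℝ → ℝ) (hG : SoftBART.AssumptionG ψ) (P : SoftBART.PriorSpec) (d : ℕ)
    (hP : SoftBART.AssumptionP P d) (α R : ℝ) (hα : 0 < α) (hR : 0 < R) :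
    ∃ A > 0, ∃ C > 0, ∃ N : ℕ, ∀ n ≥ N, ∀ (p : ℕ) [NeZero p],
      ∀ f₀ ∈ SoftBART.HolderBall p α R, SoftBART.DependsOnAtMost d f₀ →
      ∀ t : ℝ, α * (d + 1) / (2 * α + d) ≤ t →
        Real.exp (-C * n * SoftBART.rate α d t n p ^ 2) ≤
          (P.prior p).real {ω | ∀ x ∈ SoftBART.cube p,
            |ω.toFun ψ x - f₀ x| ≤ A * SoftBART.rate α d t n p} := by
  choose C hC N h using fun i : Fin (d + 1) =>
    SoftBART.exists_le_prior_of_card hG hP hα hR (Nat.lt_succ_iff.1 i.2)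
  have hCle (i : Fin (d + 1)) : C i ≤ ∑ j, C j :=
    Finset.single_le_sum (fun j _ => (hC j).le) (Finset.mem_univ i)
  have hCpos : 0 < ∑ j, C j := Finset.sum_pos (fun j _ => hC j) ⟨0, Finset.mem_univ _⟩
  refine ⟨∑ j, C j, hCpos, ∑ j, C j, hCpos, 3 + ∑ j, N j, fun n hn p _ f₀ hf₀ hdep t ht => ?_⟩
  obtain ⟨S, hS, hdep⟩ := hdep
  set i : Fin (d + 1) := ⟨S.card, Nat.lt_succ_iff.2 hS⟩ with hi
  have hNi : N i ≤ ∑ j, N j := Finset.single_le_sum (fun j _ => Nat.zero_le _) (Finset.mem_univ i)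
  have hn3 : (3 : ℝ) ≤ n := by exact_mod_cast (show 3 ≤ n by omega)
  have hlog : 1 ≤ Real.log n := by
    rw [Real.le_log_iff_exp_le (by linarith)]
    linarith [Real.exp_one_lt_d9]
  have hp : 0 ≤ Real.log p := Real.log_natCast_nonneg p
  have hb := SoftBART.balance_pos (α := α) (d := d) hlog
  set e := SoftBART.balance α d n ^ α with he
  have he0 : 0 ≤ e := by positivity
  -- `e` is the first term of the rate with the smallest admissible `t`; as `log n ≥ 1`, larger `t`
  -- only increase the rate.
  have hrate : e + √(d * Real.log p / n) ≤ SoftBART.rate α d t n p := by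
    unfold SoftBART.rate
    rw [he, SoftBART.balance_rpow hlog]
    gcongr
  have hsq : n * e ^ 2 + d * Real.log p ≤ n * SoftBART.rate α d t n p ^ 2 := by
    have h1 : √(d * Real.log p / n) ^ 2 = d * Real.log p / n := Real.sq_sqrt (by positivity)
    calc n * e ^ 2 + d * Real.log p = n * (e ^ 2 + √(d * Real.log p / n) ^ 2) := by
          rw [h1]; field_simp
      _ ≤ n * (e + √(d * Real.log p / n)) ^ 2 := by
          gcongr
          nlinarith [mul_nonneg he0 (Real.sqrt_nonneg (d * Real.log p / n))]
      _ ≤ _ := by gcongr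
  have her : e ≤ SoftBART.rate α d t n p := by
    linarith [Real.sqrt_nonneg (d * Real.log p / n)]
  refine le_trans ?_ ((h i n (by omega) p f₀ hf₀ S rfl hdep).trans
    (measureReal_mono fun ω hω x hx => (hω x hx).trans ?_))
  · refine Real.exp_le_exp.2 ?_
    rw [mul_assoc, neg_mul, neg_mul]
    exact neg_le_neg (mul_le_mul (hCle i) hsq (by positivity) hCpos.le)
  · exact mul_le_mul (hCle i) her he0 hCpos.le
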